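/- Let $n\ge 1$. A germ at $0$ of a $\mathbb C$-analytic singular symplectic form on $\mathbb C^{2n}$ is a germ at $0$ of a closed holomorphic $2$-form $\omega$ such that the set $\Sigma_2(\omega)=\{x:\omega^n|_x=0\}$ (the Martinet hypersurface of $\omega$) is nowhere dense. Write $\omega^n=f\,\Omega$ with $\Omega$ a holomorphic volume form, so that $\Sigma_2(\omega)=\{f=0\}$; the Martinet hypersurface is called structurally smooth at $0$ if $f(0)=0$ and $df_0\neq 0$. Let $\omega_0$ and $\omega_1$ be germs at $0$ of $\mathbb C$-analytic singular symplectic forms on $\mathbb C^{2n}$ with a common Martinet hypersurface $\Sigma_2=\Sigma_2(\omega_0)=\Sigma_2(\omega_1)$ (equality of germs at $0$) that is structurally smooth at $0$ for both forms. Let $\iota:\Sigma_2\hookrightarrow\mathbb C^{2n}$ be the inclusion, and assume $$\operatorname{rank}(\iota^*\omega_0|_0)=\operatorname{rank}(\iota^*\omega_1|_0)\le 2n-4 .$$ For a $2$-form $\omega$ put $\ker(\omega^{n-1}|_0)=\{v\in T_0\mathbb C^{2n}: v\rfloor(\omega^{n-1}|_0)=0\}$. If $\iota^*\omega_0=\iota^*\omega_1$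 as germs at $0$ of forms on $\Sigma_2$ and $\ker(\omega_0^{n-1}|_0)=\ker(\omega_1^{n-1}|_0)$, then there exists a $\mathbb C$-analytic diffeomorphism-germ $\Psi:(\mathbb C^{2n},0)\to(\mathbb C^{2n},0)$ such that $$\Psi^*\omega_1=\omega_0 .$$ -/

import Mathlib

open Filter Topology

noncomputable section

namespace SingSymp

/-- Complex space `ℂ^{2n}`. -/
abbrev CSpace (n : ℕ) : Type := Fin (2 * n) → ℂ

/-- Differential `2`-forms of type `(2,0)` on `ℂ^{2n}` (complex bilinear alternating at each point).
Germs at `0` are handled through representatives: only the values near `0` ever matter. -/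
abbrev TwoForm (n : ℕ) : Type := CSpace n → CSpace n [⋀^Fin 2]→L[ℂ] ℂ

/-- The wedge product of alternating forms, i.e. the signed sum over shuffles
`(a ∧ b)(v) = ∑ sign(s) a(v_{s(1)}, …, v_{s(p)}) b(v_{s(p+1)}, …, v_{s(p+q)})`. -/
def wedge {V : Type*} [AddCommGroup V] [Module ℂ V] {p q : ℕ}
    (a : V [⋀^Fin p]→ₗ[ℂ] ℂ) (b : V [⋀^Fin q]→ₗ[ℂ] ℂ) : V [⋀^Fin (p + q)]→ₗ[ℂ] ℂ :=
  ((LinearMap.mul' ℂ ℂ).compAlternatingMap (a.domCoprod b)).domDomCongr finSumFinEquiv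

/-- The `k`-th exterior power `η^k = η ∧ ⋯ ∧ η` of an alternating `2`-form, with `η^0 = 1`. -/
def wedgePow {V : Type*} [AddCommGroup V] [Module ℂ V] (η : V [⋀^Fin 2]→ₗ[ℂ] ℂ) :
    (k : ℕ) → V [⋀^Fin (2 * k)]→ₗ[ℂ] ℂ
  | 0 => (AlternatingMap.constOfIsEmpty ℂ V (Fin 0) 1 : V [⋀^Fin 0]→ₗ[ℂ] ℂ)
  | k + 1 => wedge (wedgePow η k) η

/-- The kernel `{v : v ⌟ η = 0}` of an alternating form: inserting `v` into any slot of `η`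
gives zero. -/
def formKer {V : Type*} [AddCommGroup V] [Module ℂ V] {k : ℕ} (η : V [⋀^Fin k]→ₗ[ℂ] ℂ) :
    Submodule ℂ V where
  carrier := {v | ∀ (w : Fin k → V) (i : Fin k), η (Function.update w i v) = 0}
  add_mem' := by
    intro a b ha hb w i
    rw [AlternatingMap.map_update_add, ha w i, hb w i, add_zero]
  zero_mem' := by
    intro w i
    exact AlternatingMap.map_update_zero η w i
  smul_mem' := by
    intro c a ha w i
    rw [AlternatingMap.map_update_smul, ha w i, smul_zero]

/-- The rank of an alternating `2`-form on `V`: the codimension of its kernel. -/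
def formRank {V : Type*} [AddCommGroup V] [Module ℂ V] (η : V [⋀^Fin 2]→ₗ[ℂ] ℂ) : ℕ :=
  Module.finrank ℂ (V ⧸ formKer η)

/-- The value at `x` of the top power `ω^n` of a `2`-form on `ℂ^{2n}`. -/
def topPower {n : ℕ} (ω : TwoForm n) (x : CSpace n) : CSpace n [⋀^Fin (2 * n)]→ₗ[ℂ] ℂ :=
  wedgePow (ω x).toAlternatingMap n

/-- The Martinet hypersurface `Σ₂(ω) = {x : ω^n|_x = 0}`. -/
def martinetSet {n : ℕ} (ω : TwoForm n) : Set (CSpace n) :=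
  {x | topPower ω x = 0}

/-- The function `f` with `ω^n = f Ω`, where `Ω = dz₁ ∧ ⋯ ∧ dz_{2n}` is the standard volume form.
(Another volume form multiplies `f` by a nowhere vanishing function.) -/
def martinetFun {n : ℕ} (ω : TwoForm n) (x : CSpace n) : ℂ :=
  topPower ω x (fun i => Pi.single i 1)

/-- `ω` represents the germ at `0` of a `ℂ`-analytic singular symplectic form: it is analytic and
closed near `0`, and the set where `ω^n` vanishes is nowhere dense near `0`. -/
structure IsSingularSymplecticGerm {n : ℕ} (ω : TwoForm n) : Prop where
  analytic : AnalyticAt ℂ ω 0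
  closed : ∀ᶠ x in 𝓝 (0 : CSpace n), extDeriv ω x = 0
  nowhereDense : ∃ U ∈ 𝓝 (0 : CSpace n), IsNowhereDense (martinetSet ω ∩ U)

/-- The Martinet hypersurface of `ω` is structurally smooth at `0`: `f(0) = 0` and `df_0 ≠ 0`,
where `ω^n = f Ω`. -/
def StructurallySmooth {n : ℕ} (ω : TwoForm n) : Prop :=
  martinetFun ω 0 = 0 ∧ fderiv ℂ (martinetFun ω) 0 ≠ 0

/-- The tangent space `T_x Σ₂(ω) = ker df_x` at a point `x` of a structurally smooth Martinet
hypersurface `Σ₂(ω) = {f = 0}` (for `x` near `0`). -/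
def martinetTangent {n : ℕ} (ω : TwoForm n) (x : CSpace n) : Submodule ℂ (CSpace n) :=
  (fderiv ℂ (martinetFun ω) x).ker

/-- The restriction of an alternating `2`-form to a linear subspace `T`. With `T = T_x Σ₂` and
`η = ω|_x` this is the value `(ι^* ω)|_x` of the pullback of `ω` by the inclusion `ι` of `Σ₂`. -/
def restrictForm {n : ℕ} (T : Submodule ℂ (CSpace n)) (η : CSpace n [⋀^Fin 2]→L[ℂ] ℂ) :
    T [⋀^Fin 2]→ₗ[ℂ] ℂ :=
  η.toAlternatingMap.compLinearMap T.subtype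

/-- The pullback `Ψ^* ω` of a `2`-form by a map. -/
def pullback {n : ℕ} (Ψ : CSpace n → CSpace n) (ω : TwoForm n) : TwoForm n :=
  fun x => (ω (Ψ x)).compContinuousLinearMap (fderiv ℂ Ψ x)

/-- `Ψ` represents a `ℂ`-analytic diffeomorphism-germ `(ℂ^{2n}, 0) → (ℂ^{2n}, 0)`. -/
def IsDiffeoGerm {n : ℕ} (Ψ : CSpace n → CSpace n) : Prop :=
  AnalyticAt ℂ Ψ 0 ∧ Ψ 0 = 0 ∧
    ∃ Φ : CSpace n → CSpace n, AnalyticAt ℂ Φ 0 ∧ Φ 0 = 0 ∧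
      (∀ᶠ x in 𝓝 (0 : CSpace n), Φ (Ψ x) = x) ∧ (∀ᶠ x in 𝓝 (0 : CSpace n), Ψ (Φ x) = x)

end SingSymp

end

/-! The proof is Moser's homotopy method run along a complex parameter. An analytic change of
coordinates turns the common Martinet hypersurface into a hyperplane `ℓ = 0`. Let `σ₀`, `σ₁` be the
two forms in these coordinates, `δ = σ₁ - σ₀` and `σ_t = σ₀ + t δ`. The form `δ` is closed and
restricts to zero on the hyperplane, so a relative Poincaré lemma gives `δ = d(ℓ β)`. It then
suffices to solve `X_t ⌟ σ_t = -ℓ β` by an analytic field vanishing at the origin: its flow carries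
the forms of the pencil into one another.

The equation is singular where `σ_t` degenerates. Two degenerate alternating forms on an even
dimensional space that agree on a hyperplane span a pencil of degenerate forms
(`two_le_finrank_ker_pencil`), so every `σ_t` has corank at least two on `ℓ = 0`. Therefore the Gram
determinant of `σ_t` is `ℓ² g`, and Cramer's vector for the right-hand side `β` is `ℓ C'`;
cancelling `ℓ` leaves the solution `X = g⁻¹ C'` wherever `g ≠ 0`.

The condition on kernels gives `X_t(0) = 0`. A structurally smooth form has corank at most two at
the origin, and then the kernel of `ω^(n-1)` is that of `ω`, provided `n ≥ 2`, which the rank bound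
supplies. Thus `σ₀` and `σ₁` share a kernel plane at the origin. As `β(0)` vanishes on it, the
matrices in Cramer's formula have corank two there, and their determinants vanish to second order.

Structural smoothness gives `g ≠ 0` at the origin for `t = 0` and `t = 1`. For intermediate `t` it
may vanish, but the zeros of `t ↦ g(t, 0)` are isolated, so their complement in `ℂ` is connected and
the local equivalences of `moser_step` chain up from `0` to `1`.

Analytic flows and averages are obtained in the Banach space of continuous paths on `[0, 1]`.
Exterior powers are reduced to matrices by the Pfaffian identity `exists_wedgePow_sq_eq`: the
squared coefficient of `η^n` is a fixed nonzero multiple of the Gram determinant. -/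

set_option maxSynthPendingDepth 3

/-! ### Superposition operators on spaces of continuous functions -/

section Superposition

open scoped ENNReal NNReal

variable {S : Type*} [TopologicalSpace S] [CompactSpace S]
  {E F : Type*} [NormedAddCommGroup E] [NormedSpace ℂ E] [NormedAddCommGroup F] [NormedSpace ℂ F]

/-- The pointwise extension of a continuous multilinear map to continuous functions. -/
noncomputable def ContinuousMultilinearMap.liftContinuousMap (S : Type*) [TopologicalSpace S]
    [CompactSpace S] {k : ℕ} (m : E [×k]→L[ℂ] F) : C(S, E) [×k]→L[ℂ] C(S, F) :=
  MultilinearMap.mkContinuous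
    { toFun := fun φ => ⟨fun s => m fun i => φ i s, by fun_prop⟩
      map_update_add' := by
        intro _ φ i x y
        ext s
        have h : ∀ z : C(S, E), (fun j => Function.update φ i z j s) =
            Function.update (fun j => φ j s) i (z s) := by
          intro z; ext j; by_cases hj : j = i
          · subst hj; simp
          · simp [hj]
        simp [h]
      map_update_smul' := by
        intro _ φ i c x
        ext s
        have h : ∀ z : C(S, E), (fun j => Function.update φ i z j s) =
            Function.update (fun j => φ j s) i (z s) := by
          intro z; ext j; by_cases hj : j = i
          · subst hj; simp
          · simp [hj]
        simp [h] }
    ‖m‖ (by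
      intro φ
      rw [ContinuousMap.norm_le _ (by positivity)]
      intro s
      refine (m.le_opNorm _).trans ?_
      gcongr with i
      exact (φ i).norm_coe_le_norm s)

theorem ContinuousMultilinearMap.norm_liftContinuousMap_le {k : ℕ} (m : E [×k]→L[ℂ] F) :
    ‖m.liftContinuousMap S‖ ≤ ‖m‖ :=
  MultilinearMap.mkContinuous_norm_le _ (norm_nonneg _) _

/-- Composition with an analytic map is analytic on the space of continuous maps. -/
theorem AnalyticAt.exists_superposition [CompleteSpace F] {g : E → F} {x₀ : E}
    (hg : AnalyticAt ℂ g x₀) :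
    ∃ N : C(S, E) → C(S, F), AnalyticAt ℂ N (ContinuousMap.const S x₀) ∧
      ∀ᶠ φ in 𝓝 (ContinuousMap.const S x₀), ∀ s, N φ s = g (φ s) := by
  obtain ⟨p, r, hp⟩ := hg
  let q : FormalMultilinearSeries ℂ C(S, E) C(S, F) := fun k => (p k).liftContinuousMap S
  -- Lifting does not increase norms, so the lifted series converges at least where the original one
  -- does.
  have hrad : p.radius ≤ q.radius := by
    refine ENNReal.le_of_forall_nnreal_lt fun ρ hρ => ?_
    refine q.le_radius_of_summable ?_
    refine Summable.of_nonneg_of_le (fun k => by positivity) (fun k => ?_)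
      (p.summable_norm_mul_pow hρ)
    gcongr
    exact (p k).norm_liftContinuousMap_le
  have hq := (q.hasFPowerSeriesOnBall (hp.radius_pos.trans_le hrad)).mono hp.r_pos
    (hp.r_le.trans hrad)
  have hq' := hq.comp_sub (ContinuousMap.const S x₀)
  rw [zero_add] at hq'
  refine ⟨_, hq'.analyticAt, ?_⟩
  filter_upwards [Metric.eball_mem_nhds _ hp.r_pos] with φ hφ s
  have h1 : φ - ContinuousMap.const S x₀ ∈ Metric.eball (0 : C(S, E)) r := by
    simpa [Metric.mem_eball, edist_eq_enorm_sub] using hφ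
  have h2 : φ s - x₀ ∈ Metric.eball (0 : E) r := by
    have : ‖φ s - x₀‖ ≤ ‖φ - ContinuousMap.const S x₀‖ :=
      (φ - ContinuousMap.const S x₀).norm_coe_le_norm s
    rw [Metric.mem_eball, edist_zero_right] at h1 ⊢
    exact lt_of_le_of_lt (enorm_le_iff_norm_le.2 this) h1
  have h3 := (hq.hasSum h1).mapL (ContinuousMap.evalCLM ℂ s)
  have h4 := hp.hasSum h2
  simp only [zero_add, add_sub_cancel] at h3 h4
  exact h3.unique h4

end Superposition

/-! ### Averages over dilations, division by a linear form, relative Poincaré lemma -/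

section PathIntegral

open scoped unitInterval
open MeasureTheory

variable {E F : Type*} [NormedAddCommGroup E] [NormedSpace ℂ E]
  [NormedAddCommGroup F] [NormedSpace ℂ F]

/-- The primitive `s ↦ ∫ r in 0..s, φ r` of a continuous path, as a continuous linear map. -/
noncomputable def pathPrimitive (F : Type*) [NormedAddCommGroup F] [NormedSpace ℂ F] :
    C(I, F) →L[ℂ] C(I, F) :=
  LinearMap.mkContinuous
    { toFun := fun φ => ⟨fun s => ∫ r in (0 : ℝ)..s, Set.IccExtend zero_le_one φ r, by
        have h : Continuous (Set.IccExtend (zero_le_one (α := ℝ)) φ) := φ.continuous.Icc_extend'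
        exact (intervalIntegral.continuous_primitive
          (fun a b => h.intervalIntegrable a b) 0).comp continuous_subtype_val⟩
      map_add' := by
        intro φ ψ
        ext s
        have h : ∀ φ : C(I, F), Continuous (Set.IccExtend (zero_le_one (α := ℝ)) φ) :=
          fun φ => φ.continuous.Icc_extend'
        simpa [Set.IccExtend] using intervalIntegral.integral_add
          ((h φ).intervalIntegrable 0 s) ((h ψ).intervalIntegrable 0 s)
      map_smul' := by
        intro c φ
        ext s
        simp [Set.IccExtend] }
    1 (by
      intro φ
      rw [one_mul, ContinuousMap.norm_le _ (norm_nonneg _)]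
      intro s
      have := intervalIntegral.norm_integral_le_of_norm_le_const (a := 0) (b := (s : ℝ))
        (f := Set.IccExtend (zero_le_one (α := ℝ)) φ) (C := ‖φ‖)
        (fun r _ => φ.norm_coe_le_norm _)
      refine this.trans (mul_le_of_le_one_right (norm_nonneg _) ?_)
      rw [sub_zero, abs_of_nonneg s.2.1]
      exact s.2.2)

theorem pathPrimitive_apply (φ : C(I, F)) (s : I) :
    pathPrimitive F φ s = ∫ r in (0 : ℝ)..s, Set.IccExtend zero_le_one φ r := rfl

theorem pathPrimitive_apply_one_eq {φ : C(I, F)} {u : ℝ → F} (h : ∀ s : I, φ s = u s) :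
    pathPrimitive F φ 1 = ∫ r in (0 : ℝ)..1, u r := by
  rw [pathPrimitive_apply]
  refine intervalIntegral.integral_congr fun r hr => ?_
  rw [Set.uIcc_of_le (by simp)] at hr
  simp only [Set.Icc.coe_one] at hr
  rw [Set.IccExtend_of_mem _ _ hr, h]

theorem ContinuousMap.eventually_forall_of_eventually {S X : Type*} [TopologicalSpace S]
    [CompactSpace S] [TopologicalSpace X] {P : X → Prop} {x₀ : X} (h : ∀ᶠ x in 𝓝 x₀, P x) :
    ∀ᶠ φ in 𝓝 (ContinuousMap.const S x₀), ∀ s, P (φ s) := by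
  obtain ⟨U, hU, hUo, hxU⟩ := eventually_nhds_iff.1 h
  have := ContinuousMap.isOpen_setOfPred_mapsTo (X := S) (Y := X) (K := Set.univ) isCompact_univ hUo
  filter_upwards [this.mem_nhds (fun s _ => hxU)] with φ hφ s
  exact hU _ (hφ (Set.mem_univ s))

/-- The segment from `z - ℓ z • e` to `z`, as a path depending linearly on `z`. -/
noncomputable def scalePath (ℓ : E →L[ℂ] ℂ) (e : E) : E →L[ℂ] C(I, E) :=
  LinearMap.mkContinuous
    { toFun := fun z => ⟨fun s => z + (((s : ℝ) : ℂ) - 1) • (ℓ z • e), by fun_prop⟩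
      map_add' := by intro z w; ext s; simp only [ContinuousMap.coe_mk, map_add,
        ContinuousMap.add_apply]; module
      map_smul' := by intro c z; ext s; simp only [ContinuousMap.coe_mk, map_smul,
        ContinuousMap.smul_apply, RingHom.id_apply, smul_eq_mul]; module }
    (1 + ‖ℓ‖ * ‖e‖) (by
      intro z
      rw [ContinuousMap.norm_le _ (by positivity)]
      intro s
      refine (norm_add_le _ _).trans ?_
      rw [add_mul, one_mul, norm_smul, norm_smul]
      have h1 : ‖(((s : ℝ) : ℂ) - 1)‖ ≤ 1 := by
        have : (((s : ℝ) : ℂ) - 1) = (((s : ℝ) - 1 : ℝ) : ℂ) := by push_cast; ring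
        rw [this, Complex.norm_real, Real.norm_eq_abs, abs_le]
        constructor <;> linarith [s.2.1, s.2.2]
      have h2 := ℓ.le_opNorm z
      have h3 : ‖ℓ z‖ * ‖e‖ ≤ ‖ℓ‖ * ‖e‖ * ‖z‖ := by
        nlinarith [norm_nonneg e]
      have h4 : 0 ≤ ‖ℓ z‖ * ‖e‖ := by positivity
      nlinarith)

/-- The dilation `z ↦ z + (s - 1) ℓ(z) e`, contracting onto `ker ℓ` as `s → 0` when `ℓ e = 1`. -/
noncomputable def dilate (ℓ : E →L[ℂ] ℂ) (e : E) (s : ℝ) : E →L[ℂ] E :=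
  ContinuousLinearMap.id ℂ E + ((s : ℂ) - 1) • ℓ.smulRight e

theorem dilate_apply (ℓ : E →L[ℂ] ℂ) (e : E) (s : ℝ) (z : E) :
    dilate ℓ e s z = z + ((s : ℂ) - 1) • (ℓ z • e) := by simp [dilate]

theorem dilate_one (ℓ : E →L[ℂ] ℂ) (e z : E) : dilate ℓ e 1 z = z := by simp [dilate_apply]

theorem scalePath_apply (ℓ : E →L[ℂ] ℂ) (e z : E) (s : I) :
    scalePath ℓ e z s = dilate ℓ e s z := by rw [dilate_apply]; rfl

theorem scalePath_of_ker {ℓ : E →L[ℂ] ℂ} {e x₀ : E} (h : ℓ x₀ = 0) :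
    scalePath ℓ e x₀ = ContinuousMap.const I x₀ := by
  ext s; simp [scalePath_apply, dilate_apply, h]

theorem map_dilate_zero {ℓ : E →L[ℂ] ℂ} {e : E} (he : ℓ e = 1) (z : E) :
    ℓ (dilate ℓ e 0 z) = 0 := by simp [dilate_apply, he]

theorem hasDerivAt_dilate (ℓ : E →L[ℂ] ℂ) (e z : E) (s : ℝ) :
    HasDerivAt (fun s => dilate ℓ e s z) (ℓ z • e) s := by
  simp only [dilate_apply]
  have h : HasDerivAt (fun s : ℝ => (s : ℂ) - 1) 1 s := (Complex.ofRealCLM.hasDerivAt).sub_const 1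
  simpa using (h.smul_const (ℓ z • e)).const_add z

/-- At a base point in `ker ℓ` the dilation path is constant, and compactness of the interval makes
a neighbourhood condition uniform along nearby paths. -/
theorem eventually_forall_dilate {ℓ : E →L[ℂ] ℂ} {e x₀ : E} (h0 : ℓ x₀ = 0) {P : E → Prop}
    (h : ∀ᶠ x in 𝓝 x₀, P x) : ∀ᶠ z in 𝓝 x₀, ∀ s ∈ Set.Icc (0 : ℝ) 1, P (dilate ℓ e s z) := by
  have h1 := ContinuousMap.eventually_forall_of_eventually (S := I) h
  rw [← scalePath_of_ker (e := e) h0] at h1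
  filter_upwards [(scalePath ℓ e).continuous.continuousAt.eventually h1] with z hz s hs
  simpa [scalePath_apply] using hz ⟨s, hs⟩

/-- The average of `g` over the dilations of `z`. -/
noncomputable def dilationAverage (ℓ : E →L[ℂ] ℂ) (e : E) (g : E → F) (z : E) : F :=
  ∫ s in (0 : ℝ)..1, g (dilate ℓ e s z)

theorem dilationAverage_of_ker [CompleteSpace F] {ℓ : E →L[ℂ] ℂ} {e x : E} (h : ℓ x = 0)
    (g : E → F) : dilationAverage ℓ e g x = g x := by
  simp [dilationAverage, dilate_apply, h]

/-- The average is factored as an analytic map `M` into the Banach space of paths followed by a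
continuous linear functional. Both analyticity and differentiation under the integral sign are read
off from this factorization. -/
theorem AnalyticAt.dilationAverage_aux [CompleteSpace F] {ℓ : E →L[ℂ] ℂ} {e : E} {g : E → F}
    {x₀ : E} (hg : AnalyticAt ℂ g x₀) (h0 : ℓ x₀ = 0) :
    ∃ M : E → C(I, F), AnalyticAt ℂ M x₀ ∧
      (∀ᶠ z in 𝓝 x₀, ∀ s : I, M z s = g (dilate ℓ e s z)) ∧
      ∀ᶠ z in 𝓝 x₀, dilationAverage ℓ e g z = pathPrimitive F (M z) 1 := by
  obtain ⟨N, hN, hNg⟩ := hg.exists_superposition (S := I)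
  rw [← scalePath_of_ker (e := e) h0] at hN hNg
  have h1 : ∀ᶠ z in 𝓝 x₀, ∀ s : I, N (scalePath ℓ e z) s = g (dilate ℓ e s z) := by
    filter_upwards [(scalePath ℓ e).continuous.continuousAt.eventually hNg] with z hz s
    rw [hz s, scalePath_apply]
  refine ⟨fun z => N (scalePath ℓ e z), hN.comp ((scalePath ℓ e).analyticAt x₀), h1, ?_⟩
  filter_upwards [h1] with z hz
  rw [pathPrimitive_apply_one_eq (u := fun s => g (_root_.dilate ℓ e s z)) hz]
  rfl

theorem AnalyticAt.dilationAverage [CompleteSpace F] {ℓ : E →L[ℂ] ℂ} {e : E} {g : E → F}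
    {x₀ : E} (hg : AnalyticAt ℂ g x₀) (h0 : ℓ x₀ = 0) :
    AnalyticAt ℂ (dilationAverage ℓ e g) x₀ := by
  obtain ⟨M, hM, -, hM2⟩ := hg.dilationAverage_aux (e := e) h0
  refine AnalyticAt.congr ?_ (EventuallyEq.symm hM2)
  exact ((ContinuousMap.evalCLM ℂ (1 : I)).comp (pathPrimitive F)).analyticAt _ |>.comp hM

theorem AnalyticAt.eventually_fderiv_dilationAverage [CompleteSpace F] {ℓ : E →L[ℂ] ℂ} {e : E}
    {g : E → F} {x₀ : E} (hg : AnalyticAt ℂ g x₀) (h0 : ℓ x₀ = 0) :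
    ∀ᶠ z in 𝓝 x₀, ∀ a, fderiv ℂ (_root_.dilationAverage ℓ e g) z a =
      ∫ s in (0 : ℝ)..1, fderiv ℂ g (dilate ℓ e s z) (dilate ℓ e s a) := by
  obtain ⟨M, hM, hM1, hM2⟩ := hg.dilationAverage_aux (e := e) h0
  filter_upwards [hM.eventually_analyticAt, hM1.eventually_nhds, hM2.eventually_nhds,
    eventually_forall_dilate (e := e) h0 hg.eventually_analyticAt] with z h1 h2 h3 h4 a
  rw [EventuallyEq.fderiv_eq (f₁ := _root_.dilationAverage ℓ e g) h3]
  have h5 : HasFDerivAt (fun z => ((ContinuousMap.evalCLM ℂ (1 : I)).comp (pathPrimitive F)) (M z))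
      _ z := ((ContinuousMap.evalCLM ℂ (1 : I)).comp (pathPrimitive F)).hasFDerivAt.comp z
      h1.differentiableAt.hasFDerivAt
  have h6 := h5.fderiv
  simp only [ContinuousLinearMap.comp_apply, ContinuousMap.evalCLM_apply] at h6
  rw [h6]
  simp only [ContinuousLinearMap.comp_apply, ContinuousMap.evalCLM_apply]
  refine pathPrimitive_apply_one_eq fun s => ?_
  have h7 : HasFDerivAt (fun z => (ContinuousMap.evalCLM ℂ s : C(I, F) →L[ℂ] F) (M z))
      ((ContinuousMap.evalCLM ℂ s : C(I, F) →L[ℂ] F).comp (fderiv ℂ M z)) z :=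
    (ContinuousMap.evalCLM ℂ s : C(I, F) →L[ℂ] F).hasFDerivAt.comp z
      h1.differentiableAt.hasFDerivAt
  have h8 : HasFDerivAt (fun z => g (dilate ℓ e s z)) _ z :=
    (h4 s s.2).differentiableAt.hasFDerivAt.comp z (dilate ℓ e s).hasFDerivAt
  have h9 : (fun z => (ContinuousMap.evalCLM ℂ s : C(I, F) →L[ℂ] F) (M z)) =ᶠ[𝓝 z] fun z => g (dilate ℓ e s z) := by
    filter_upwards [h2] with w hw
    simpa using hw s
  have := h7.unique (h8.congr_of_eventuallyEq h9)
  simpa using congrArg (fun L => L a) this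

/-- Division of an analytic map vanishing on a hyperplane by the equation of the hyperplane. -/
theorem AnalyticAt.eventually_eq_smul_dilationAverage [CompleteSpace F] {ℓ : E →L[ℂ] ℂ} {e : E}
    (he : ℓ e = 1) {g : E → F} {x₀ : E} (hg : AnalyticAt ℂ g x₀) (h0 : ℓ x₀ = 0)
    (hz : ∀ᶠ z in 𝓝 x₀, ℓ z = 0 → g z = 0) :
    ∀ᶠ z in 𝓝 x₀, g z = ℓ z • _root_.dilationAverage ℓ e (fun z => fderiv ℂ g z e) z := by
  filter_upwards [eventually_forall_dilate (e := e) h0 hz,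
    eventually_forall_dilate (e := e) h0 hg.eventually_analyticAt] with z h1 h2
  -- Hadamard's argument: the dilation moves `z` with velocity `ℓ z • e` and starts on the
  -- hyperplane, where `g` vanishes, so the fundamental theorem of calculus exhibits the factor `ℓ
  -- z`.
  have h3 : ∀ s ∈ Set.Icc (0 : ℝ) 1, HasDerivAt (fun s => g (dilate ℓ e s z))
      (ℓ z • fderiv ℂ g (dilate ℓ e s z) e) s := by
    intro s hs
    have := ((h2 s hs).differentiableAt.hasFDerivAt.restrictScalars ℝ).comp_hasDerivAt s
      (hasDerivAt_dilate ℓ e z s)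
    simpa [Function.comp_def] using this
  have hcont : ContinuousOn (fun s : ℝ => ℓ z • fderiv ℂ g (dilate ℓ e s z) e)
      (Set.Icc 0 1) := by
    intro s hs
    have c1 : ContinuousAt (fun s : ℝ => fderiv ℂ g (dilate ℓ e s z)) s :=
      ContinuousAt.comp (f := fun s : ℝ => dilate ℓ e s z) (h2 s hs).fderiv.continuousAt
        (hasDerivAt_dilate ℓ e z s).continuousAt
    have := (c1.clm_apply (continuousAt_const (y := e))).const_smul (ℓ z)
    exact this.continuousWithinAt
  have h4 := intervalIntegral.integral_eq_sub_of_hasDerivAt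
    (f := fun s => g (dilate ℓ e s z)) (by rwa [Set.uIcc_of_le zero_le_one])
    (hcont.intervalIntegrable_of_Icc zero_le_one)
  rw [dilate_one, h1 0 (by simp) (map_dilate_zero he z), sub_zero] at h4
  rw [← h4, intervalIntegral.integral_smul]
  rfl

/-- Cancellation of the equation of a hyperplane. -/
theorem eventually_eq_of_smul_eq_smul {ℓ : E →L[ℂ] ℂ} {e : E}
    (he : ℓ e = 1) {g₁ g₂ : E → F} {x₀ : E} (hg₁ : ∀ᶠ z in 𝓝 x₀, ContinuousAt g₁ z)
    (hg₂ : ∀ᶠ z in 𝓝 x₀, ContinuousAt g₂ z) (h : ∀ᶠ z in 𝓝 x₀, ℓ z • g₁ z = ℓ z • g₂ z) :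
    ∀ᶠ z in 𝓝 x₀, g₁ z = g₂ z := by
  filter_upwards [hg₁, hg₂, h.eventually_nhds] with z h1 h2 h3
  by_cases hz : ℓ z = 0
  -- On the hyperplane the identity is recovered as a limit along the transversal line through `z`
  -- in the direction `e`.
  · have hline : Tendsto (fun τ : ℂ => z + τ • e) (𝓝[≠] 0) (𝓝 z) := by
      have : ContinuousAt (fun τ : ℂ => z + τ • e) 0 := by fun_prop
      have h := this.tendsto
      simp only [zero_smul, add_zero] at h
      exact h.mono_left nhdsWithin_le_nhds
    refine tendsto_nhds_unique (h1.tendsto.comp hline)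
      ((h2.tendsto.comp hline).congr' ?_)
    filter_upwards [hline.eventually h3, self_mem_nhdsWithin] with τ hτ hne
    have hne' : τ ≠ 0 := hne
    have : ℓ (z + τ • e) = τ := by simp [hz, he]
    rw [this] at hτ
    exact (smul_right_injective F hne' hτ).symm
  · exact smul_right_injective F hz h3.self_of_nhds

/-- The Poincaré lemma relative to a hyperplane: a closed `2`-form whose restriction to the
hyperplane `ℓ = 0` vanishes is the differential of `ℓ β`. -/
theorem eventually_relative_poincare {ℓ : E →L[ℂ] ℂ} {e : E} (he : ℓ e = 1)
    {δ : E → E →L[ℂ] E →L[ℂ] ℂ} {x₀ : E} (hδ : AnalyticAt ℂ δ x₀) (h0 : ℓ x₀ = 0)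
    (halt : ∀ z a, δ z a a = 0)
    (hclosed : ∀ᶠ z in 𝓝 x₀, ∀ a b c,
      fderiv ℂ δ z a b c + fderiv ℂ δ z b c a + fderiv ℂ δ z c a b = 0)
    (hker : ∀ᶠ z in 𝓝 x₀, ℓ z = 0 → ∀ a b, ℓ a = 0 → ℓ b = 0 → δ z a b = 0) :
    ∀ᶠ z in 𝓝 x₀, ∀ a b,
      fderiv ℂ (fun z => ℓ z • dilationAverage ℓ e (fun z => δ z e) z) z a b -
        fderiv ℂ (fun z => ℓ z • dilationAverage ℓ e (fun z => δ z e) z) z b a = δ z a b := by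
  have hskew : ∀ z a b, δ z a b = - δ z b a := by
    intro z a b
    have := halt z (a + b)
    simp only [map_add, add_apply, halt] at this
    linear_combination this
  have hδe : AnalyticAt ℂ (fun z => δ z e) x₀ := by
    exact ((ContinuousLinearMap.apply ℂ (E →L[ℂ] ℂ) e).analyticAt _).comp hδ
  filter_upwards [hδe.eventually_fderiv_dilationAverage (e := e) h0,
    (hδe.dilationAverage (e := e) h0).eventually_analyticAt,
    eventually_forall_dilate (e := e) h0 hδ.eventually_analyticAt,
    eventually_forall_dilate (e := e) h0 hclosed,
    eventually_forall_dilate (e := e) h0 hker] with z h1 h2 h3 h4 h5 a b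
  set H := dilate ℓ e with hH
  have hHc : ∀ w s, ContinuousAt (fun s : ℝ => H s w) s :=
    fun w s => (hasDerivAt_dilate ℓ e w s).continuousAt
  have c1 : ∀ s ∈ Set.Icc (0 : ℝ) 1, ContinuousAt (fun s : ℝ => δ (H s z)) s := fun s hs =>
    ContinuousAt.comp (f := fun s : ℝ => H s z) (h3 s hs).continuousAt (hHc z s)
  have c2 : ∀ s ∈ Set.Icc (0 : ℝ) 1, ContinuousAt (fun s : ℝ => fderiv ℂ δ (H s z)) s :=
    fun s hs => ContinuousAt.comp (f := fun s : ℝ => H s z) (h3 s hs).fderiv.continuousAt (hHc z s)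
  have i1 : IntervalIntegrable (fun s => δ (H s z) e) MeasureTheory.volume 0 1 :=
    ContinuousOn.intervalIntegrable_of_Icc zero_le_one fun s hs =>
      ((c1 s hs).clm_apply continuousAt_const).continuousWithinAt
  have i2 : ∀ a, IntervalIntegrable (fun s => fderiv ℂ δ (H s z) (H s a) e)
      MeasureTheory.volume 0 1 := fun a =>
    ContinuousOn.intervalIntegrable_of_Icc zero_le_one fun s hs =>
      (((c2 s hs).clm_apply (hHc a s)).clm_apply continuousAt_const).continuousWithinAt
  have i1' : ∀ b, IntervalIntegrable (fun s => δ (H s z) e b) MeasureTheory.volume 0 1 := fun b =>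
    ContinuousOn.intervalIntegrable_of_Icc zero_le_one fun s hs =>
      (((c1 s hs).clm_apply continuousAt_const).clm_apply continuousAt_const).continuousWithinAt
  have i2' : ∀ a b, IntervalIntegrable (fun s => fderiv ℂ δ (H s z) (H s a) e b)
      MeasureTheory.volume 0 1 := fun a b =>
    ContinuousOn.intervalIntegrable_of_Icc zero_le_one fun s hs =>
      ((((c2 s hs).clm_apply (hHc a s)).clm_apply continuousAt_const).clm_apply
        continuousAt_const).continuousWithinAt
  have hfde : ∀ s ∈ Set.Icc (0 : ℝ) 1, ∀ v,
      fderiv ℂ (fun z => δ z e) (H s z) v = fderiv ℂ δ (H s z) v e := by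
    intro s hs v
    have := ((h3 s hs).differentiableAt.hasFDerivAt.clm_apply
      (hasFDerivAt_const e (H s z))).fderiv
    simpa using congrArg (fun L => L v) this
  have hfdalt : ∀ s ∈ Set.Icc (0 : ℝ) 1, ∀ v a, fderiv ℂ δ (H s z) v a a = 0 := by
    intro s hs v a
    have h := (((h3 s hs).differentiableAt.hasFDerivAt.clm_apply
      (hasFDerivAt_const a (H s z))).clm_apply (hasFDerivAt_const a (H s z))).fderiv
    simp only [halt] at h
    simpa using (congrArg (fun L => L v) h).symm
  have hfdskew : ∀ s ∈ Set.Icc (0 : ℝ) 1, ∀ v a b,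
      fderiv ℂ δ (H s z) v a b = - fderiv ℂ δ (H s z) v b a := by
    intro s hs v a b
    have := hfdalt s hs v (a + b)
    simp only [map_add, add_apply, hfdalt s hs] at this
    linear_combination this
  have hfd : ∀ a b, fderiv ℂ (fun z => ℓ z • dilationAverage ℓ e (fun z => δ z e) z) z a b =
      ℓ z * (∫ s in (0 : ℝ)..1, fderiv ℂ δ (H s z) (H s a) e b) +
        ℓ a * ∫ s in (0 : ℝ)..1, δ (H s z) e b := by
    intro a b
    have h6 := (ℓ.hasFDerivAt (x := z)).smul h2.differentiableAt.hasFDerivAt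
    have h7 := congrArg (fun L => L a b) h6.fderiv
    simp only [add_apply, smul_apply, ContinuousLinearMap.smulRight_apply, h1, smul_eq_mul] at h7
    refine h7.trans ?_
    rw [intervalIntegral.integral_congr (g := fun s => fderiv ℂ δ (H s z) (H s a) e)]
    · rw [ContinuousLinearMap.intervalIntegral_apply (i2 a)]
      congr 2
      exact ContinuousLinearMap.intervalIntegral_apply i1 b
    · intro s hs
      rw [Set.uIcc_of_le zero_le_one] at hs
      exact hfde s hs _
  rw [hfd a b, hfd b a, ← intervalIntegral.integral_const_mul,
    ← intervalIntegral.integral_const_mul, ← intervalIntegral.integral_const_mul,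
    ← intervalIntegral.integral_const_mul,
    ← intervalIntegral.integral_add ((i2' a b).const_mul _) ((i1' b).const_mul _),
    ← intervalIntegral.integral_add ((i2' b a).const_mul _) ((i1' a).const_mul _),
    ← intervalIntegral.integral_sub (((i2' a b).const_mul _).add ((i1' b).const_mul _))
      (((i2' b a).const_mul _).add ((i1' a).const_mul _))]
  -- Cartan's formula: the integrand is the derivative in `s` of the pullback of `δ` by `H s`. At `s
  -- = 1` the pullback is `δ`; at `s = 0` it factors through the projection onto the hyperplane and
  -- vanishes.
  have hd : ∀ s ∈ Set.uIcc (0 : ℝ) 1, HasDerivAt (fun s => δ (H s z) (H s a) (H s b))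
      (ℓ z * fderiv ℂ δ (H s z) (H s a) e b + ℓ a * δ (H s z) e b -
        (ℓ z * fderiv ℂ δ (H s z) (H s b) e a + ℓ b * δ (H s z) e a)) s := by
    intro s hs
    rw [Set.uIcc_of_le zero_le_one] at hs
    have hK : ∀ w, HasDerivAt (fun τ : ℂ => w + (τ - 1) • (ℓ w • e)) (ℓ w • e) (s : ℂ) := by
      intro w
      simpa using (((hasDerivAt_id (s : ℂ)).sub_const 1).smul_const (ℓ w • e)).const_add w
    have hKH : ∀ w, w + ((s : ℂ) - 1) • (ℓ w • e) = H s w := fun w => (dilate_apply ℓ e s w).symm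
    have e1 : HasDerivAt (fun τ : ℂ => δ (z + (τ - 1) • (ℓ z • e)))
        (fderiv ℂ δ (H s z) (ℓ z • e)) (s : ℂ) := by
      refine HasFDerivAt.comp_hasDerivAt (s : ℂ) ?_ (hK z)
      rw [hKH]
      exact (h3 s hs).differentiableAt.hasFDerivAt
    have e2 := ((e1.clm_apply (hK a)).clm_apply (hK b)).comp_ofReal
    simp only [← dilate_apply ℓ e, ← hH, add_apply, map_smul, smul_apply, smul_eq_mul] at e2
    convert! e2 using 1
    have g1 := h4 s hs e (H s a) (H s b)
    -- `H s w` differs from `w` by a multiple of `e`, which an alternating form does not see when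
    -- `e` fills the other slot. This is why `β` needs no pullback of its argument.
    have g2 : ∀ v w, fderiv ℂ δ (H s z) v e (H s w) = fderiv ℂ δ (H s z) v e w := by
      intro v w
      have h6 := hfdalt s hs v e
      conv_lhs => rw [hH, dilate_apply ℓ e s w, map_add, map_smul, map_smul]
      rw [← hH, h6]
      simp
    have g3 : fderiv ℂ δ (H s z) (H s a) (H s b) e = - fderiv ℂ δ (H s z) (H s a) e b := by
      rw [← g2 _ b, hfdskew s hs]
    have g4 : ∀ w, δ (H s z) e (H s w) = δ (H s z) e w := by
      intro w
      rw [hH, dilate_apply ℓ e s w, map_add, map_smul, map_smul, halt]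
      simp
    rw [g3, g2] at g1
    rw [hskew _ (H s a) e, g4, g4]
    linear_combination (-ℓ z) * g1
  rw [intervalIntegral.integral_eq_sub_of_hasDerivAt hd]
  · rw [hH, dilate_one, dilate_one, dilate_one, h5 0 (by simp) (map_dilate_zero he z) _ _
      (map_dilate_zero he a) (map_dilate_zero he b), sub_zero]
  · exact ((((i2' a b).const_mul _).add ((i1' b).const_mul _)).sub
      (((i2' b a).const_mul _).add ((i1' a).const_mul _)))

end PathIntegral

/-! ### Analytic local flows of analytic vector fields -/

section Flow

open scoped unitInterval ContDiff
open MeasureTheory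

variable {F : Type*} [NormedAddCommGroup F] [NormedSpace ℂ F]

/-- The path `r ↦ φ (s r)`. -/
noncomputable def slowPath (s : I) (φ : C(I, F)) : C(I, F) := ⟨fun r => φ (s * r), by fun_prop⟩

omit [NormedSpace ℂ F] in
theorem slowPath_apply (s r : I) (φ : C(I, F)) : slowPath s φ r = φ (s * r) := rfl

/-- The change of variables behind rescaling of time: a solution of `φ' = τ Z(φ)` slowed down by the
factor `s` solves the equation with parameter `s τ`. -/
theorem pathPrimitive_slowPath (s : I) (φ : C(I, F)) (r : I) :
    ((s : ℝ) : ℂ) • pathPrimitive F (slowPath s φ) r = pathPrimitive F φ (s * r) := by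
  rw [pathPrimitive_apply, pathPrimitive_apply]
  have h := intervalIntegral.smul_integral_comp_mul_left (a := 0) (b := (r : ℝ))
    (Set.IccExtend (zero_le_one (α := ℝ)) φ) (s : ℝ)
  rw [mul_zero] at h
  rw [Set.Icc.coe_mul, ← h, Complex.coe_smul]
  congr 1
  refine intervalIntegral.integral_congr fun u hu => ?_
  rw [Set.uIcc_of_le r.2.1] at hu
  have hu1 : u ∈ Set.Icc (0 : ℝ) 1 := ⟨hu.1, hu.2.trans r.2.2⟩
  have hu2 : (s : ℝ) * u ∈ Set.Icc (0 : ℝ) 1 :=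
    ⟨mul_nonneg s.2.1 hu1.1, mul_le_one₀ s.2.2 hu1.1 hu1.2⟩
  rw [Set.IccExtend_of_mem _ _ hu1, Set.IccExtend_of_mem _ _ hu2]
  rfl

omit [NormedSpace ℂ F] in
theorem dist_slowPath_const_le (s : I) (φ : C(I, F)) (p : F) :
    dist (slowPath s φ) (ContinuousMap.const I p) ≤ dist φ (ContinuousMap.const I p) := by
  rw [ContinuousMap.dist_le dist_nonneg]
  intro r
  exact ContinuousMap.dist_apply_le_dist (f := φ) (g := ContinuousMap.const I p) (s * r)

theorem hasDerivWithinAt_pathPrimitive [CompleteSpace F] (φ : C(I, F)) :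
    HasDerivWithinAt (fun s : ℝ => ∫ r in (0 : ℝ)..s, Set.IccExtend zero_le_one φ r)
      (φ 1) (Set.Iic 1) 1 := by
  have h : Continuous (Set.IccExtend (zero_le_one (α := ℝ)) φ) := φ.continuous.Icc_extend'
  have := (intervalIntegral.integral_hasDerivAt_right (h.intervalIntegrable 0 1)
    h.stronglyMeasurable.stronglyMeasurableAtFilter h.continuousAt).hasDerivWithinAt
    (s := Set.Iic 1)
  rwa [Set.IccExtend_of_mem _ _ (by simp)] at this

/-- Existence of paths solving `φ' = τ Z(φ)`, `φ 0 = q`, depending analytically on `(τ, q)`,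
together with local uniqueness. -/
theorem AnalyticAt.exists_analytic_paths [CompleteSpace F] {Z : F → F} {p : F}
    (hZ : AnalyticAt ℂ Z p) :
    ∃ (N : C(I, F) → C(I, F)) (φ : ℂ × F → C(I, F)),
      AnalyticAt ℂ φ (0, p) ∧ φ (0, p) = ContinuousMap.const I p ∧
      (∀ᶠ ψ in 𝓝 (ContinuousMap.const I p), ∀ s, N ψ s = Z (ψ s)) ∧
      ∀ᶠ v in 𝓝 (((0 : ℂ), p), ContinuousMap.const I p),
        v.2 = ContinuousMap.const I v.1.2 + v.1.1 • pathPrimitive F (N v.2) ↔ φ v.1 = v.2 := by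
  obtain ⟨N, hN, hNZ⟩ := hZ.exists_superposition (S := I)
  let cst : F →L[ℂ] C(I, F) := ContinuousLinearMap.const ℂ I
  let f : (ℂ × F) × C(I, F) → C(I, F) :=
    fun v => v.2 - cst v.1.2 - v.1.1 • pathPrimitive F (N v.2)
  set u : (ℂ × F) × C(I, F) := ((0, p), ContinuousMap.const I p) with hu
  have hN' : AnalyticAt ℂ (fun v : (ℂ × F) × C(I, F) => N v.2) u :=
    AnalyticAt.comp (g := N) (f := fun v : (ℂ × F) × C(I, F) => v.2) hN analyticAt_snd
  have hf : AnalyticAt ℂ f u := by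
    have a1 : AnalyticAt ℂ (fun v : (ℂ × F) × C(I, F) => cst v.1.2) u :=
      (cst.analyticAt _).comp (analyticAt_snd.comp analyticAt_fst)
    have a2 : AnalyticAt ℂ (fun v : (ℂ × F) × C(I, F) => v.1.1) u :=
      analyticAt_fst.comp analyticAt_fst
    have a3 : AnalyticAt ℂ (fun v : (ℂ × F) × C(I, F) => pathPrimitive F (N v.2)) u :=
      ((pathPrimitive F).analyticAt _).comp hN'
    exact (analyticAt_snd.sub a1).sub (a2.smul a3)
  have cdf : ContDiffAt ℂ ω f u := hf.contDiffAt
  -- At `τ = 0` the integral equation reads `φ = q`, so its derivative in the path variable is the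
  -- identity and the implicit function theorem applies.
  have hinv : (fderiv ℂ f u ∘L .inr ℂ (ℂ × F) C(I, F)).IsInvertible := by
    have : fderiv ℂ f u ∘L .inr ℂ (ℂ × F) C(I, F) = ContinuousLinearMap.id ℂ _ := by
      have h1 : HasFDerivAt (fun ψ : C(I, F) => f ((0, p), ψ))
          (fderiv ℂ f u ∘L .inr ℂ (ℂ × F) C(I, F)) (ContinuousMap.const I p) :=
        hf.differentiableAt.hasFDerivAt.comp (ContinuousMap.const I p)
          (hasFDerivAt_prodMk_right ((0 : ℂ), p) (ContinuousMap.const I p))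
      have h2 : (fun ψ : C(I, F) => f ((0, p), ψ)) = fun ψ => ψ - cst p := by
        ext1 ψ; simp [f]
      rw [h2] at h1
      exact h1.unique ((hasFDerivAt_id _).sub_const _)
    rw [this]
    exact ⟨ContinuousLinearEquiv.refl ℂ _, rfl⟩
  have hfu : f u = 0 := by
    ext s
    simp [f, hu, cst]
  refine ⟨N, cdf.implicitFunction (by simp) hinv,
    (cdf.contDiffAt_implicitFunction (by simp) hinv).analyticAt,
    cdf.implicitFunction_apply_self (by simp) hinv, hNZ, ?_⟩
  filter_upwards [cdf.eventually_apply_eq_iff_implicitFunction (by simp) hinv] with v hv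
  rw [← hv, hfu]
  simp only [f]
  rw [sub_sub, sub_eq_zero]
  rfl

/-- Local flows of analytic vector fields are analytic. -/
theorem AnalyticAt.exists_flow [CompleteSpace F] {Z : F → F} {p : F} (hZ : AnalyticAt ℂ Z p) :
    ∃ Φ : ℂ × F → F, AnalyticAt ℂ Φ (0, p) ∧ (∀ᶠ q in 𝓝 p, Φ (0, q) = q) ∧
      (∀ᶠ v in 𝓝 ((0 : ℂ), p), fderiv ℂ Φ v (1, 0) = Z (Φ v)) ∧
      ∀ w, (∀ᶠ τ in 𝓝 (0 : ℂ), Z (p + τ • w) = w) → ∀ᶠ τ in 𝓝 (0 : ℂ), Φ (τ, p) = p + τ • w := by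
  obtain ⟨N, φ, hφ, hφ0, hNZ, huniq⟩ := hZ.exists_analytic_paths
  set c := ContinuousMap.const I p with hc
  have hcont : Tendsto φ (𝓝 (0, p)) (𝓝 c) := hφ0 ▸ hφ.continuousAt.tendsto
  -- all slowed-down solution paths stay close to the constant path
  have hsol : ∀ᶠ v in 𝓝 ((0 : ℂ), p),
      φ v = ContinuousMap.const I v.2 + v.1 • pathPrimitive F (N (φ v)) := by
    have : Tendsto (fun v => (v, φ v)) (𝓝 ((0 : ℂ), p)) (𝓝 (((0 : ℂ), p), c)) :=
      tendsto_id.prodMk_nhds hcont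
    filter_upwards [this.eventually huniq] with v hv
    exact hv.2 rfl
  obtain ⟨ε, hε, huniq'⟩ := Metric.eventually_nhds_iff.1 (huniq.and
    (Tendsto.eventually (f := Prod.snd) (tendsto_snd.mono_left (nhds_prod_eq.le)) hNZ))
  have hnear : ∀ᶠ v in 𝓝 ((0 : ℂ), p), dist v (0, p) < ε ∧ dist (φ v) c < ε :=
    (show ∀ᶠ v in 𝓝 ((0 : ℂ), p), dist v (0, p) < ε from Metric.ball_mem_nhds _ hε).and (hcont.eventually (Metric.ball_mem_nhds _ hε))
  -- By local uniqueness the solution with parameter `s τ` is the slowed-down solution with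
  -- parameter `τ`. Hence `s ↦ Φ (s τ, q)` runs along a single path, whose derivative is known from
  -- the integral equation.
  have hslow : ∀ᶠ v in 𝓝 ((0 : ℂ), p), ∀ s : I,
      φ (((s : ℝ) : ℂ) * v.1, v.2) = slowPath s (φ v) := by
    filter_upwards [hsol, hnear] with v hv hn s
    have hd : dist (((s : ℝ) : ℂ) * v.1, v.2) ((0 : ℂ), p) < ε := by
      refine lt_of_le_of_lt ?_ hn.1
      rw [Prod.dist_eq, Prod.dist_eq]
      refine max_le_max ?_ le_rfl
      simp only [dist_zero_right, norm_mul, Complex.norm_real, Real.norm_eq_abs,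
        abs_of_nonneg s.2.1]
      exact mul_le_of_le_one_left (norm_nonneg _) s.2.2
    have hd2 : dist (slowPath s (φ v)) c < ε := (dist_slowPath_const_le s _ _).trans_lt hn.2
    have h1 := huniq' (y := ((((s : ℝ) : ℂ) * v.1, v.2), slowPath s (φ v)))
      (by rw [Prod.dist_eq]; exact max_lt hd hd2)
    have h2 := huniq' (y := (v, φ v)) (by rw [Prod.dist_eq]; exact max_lt hn.1 hn.2)
    refine h1.1.1 ?_
    have h3 : N (slowPath s (φ v)) = slowPath s (N (φ v)) := by
      ext r
      rw [h1.2 r, slowPath_apply, slowPath_apply, h2.2]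
    ext r
    have h4 := congrArg (fun ψ => ψ (s * r)) hv
    simp only [ContinuousMap.add_apply, ContinuousMap.const_apply, ContinuousMap.smul_apply] at h4
    simp only [slowPath_apply, ContinuousMap.add_apply, ContinuousMap.const_apply,
      ContinuousMap.smul_apply, h3]
    rw [h4, ← pathPrimitive_slowPath, smul_smul, mul_comm v.1]
  let Φ : ℂ × F → F := fun v => φ v 1
  have hΦ : AnalyticAt ℂ Φ (0, p) :=
    ((ContinuousMap.evalCLM ℂ (1 : I) : C(I, F) →L[ℂ] F).analyticAt _).comp hφ
  have hΦp : Φ (0, p) = p := by simp [Φ, hφ0, hc]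
  refine ⟨Φ, hΦ, ?_, ?_, ?_⟩
  · have : Tendsto (fun q : F => ((0 : ℂ), q)) (𝓝 p) (𝓝 (0, p)) :=
      (continuous_const.prodMk continuous_id).tendsto' _ _ rfl
    filter_upwards [this.eventually hsol] with q hq
    have := congrArg (fun ψ => ψ 1) hq
    simpa [Φ] using this
  -- Differentiating `s ↦ Φ (s τ, q)` at `s = 1` in two ways gives `τ ∂_τ Φ = τ Z(Φ)`; the
  -- derivative is one-sided because paths live on `[0, 1]`. Cancelling the linear form `τ` then
  -- extends the flow equation to `τ = 0`.
  · have hne : ∀ᶠ v in 𝓝 ((0 : ℂ), p), v.1 ≠ 0 → fderiv ℂ Φ v (1, 0) = Z (Φ v) := by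
      filter_upwards [hslow, hsol, hnear, hΦ.eventually_analyticAt] with v h1 h2 h3 h4 hv
      have h5 := huniq' (y := (v, φ v)) (by rw [Prod.dist_eq]; exact max_lt h3.1 h3.2)
      have d1 : HasDerivWithinAt (fun s : ℝ => Φ ((s : ℂ) * v.1, v.2))
          (fderiv ℂ Φ v (v.1, 0)) (Set.Icc 0 1) 1 := by
        have e1 : HasDerivAt (fun s : ℝ => ((s : ℂ) * v.1, v.2)) (v.1, (0 : F)) 1 := by
          simpa using ((Complex.ofRealCLM.hasDerivAt (x := 1)).mul_const v.1).prodMk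
            (hasDerivAt_const (1 : ℝ) v.2)
        have e2 : HasFDerivAt Φ ((fderiv ℂ Φ v).restrictScalars ℝ)
            (((1 : ℝ) : ℂ) * v.1, v.2) := by
          simpa using h4.differentiableAt.hasFDerivAt.restrictScalars ℝ
        exact (e2.comp_hasDerivAt (1 : ℝ) e1).hasDerivWithinAt
      have d2 : HasDerivWithinAt (fun s : ℝ => Φ ((s : ℂ) * v.1, v.2))
          (v.1 • Z (Φ v)) (Set.Icc 0 1) 1 := by
        have e3 := ((hasDerivWithinAt_pathPrimitive (N (φ v))).const_smul v.1).const_add v.2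
        rw [h5.2 1] at e3
        refine (e3.mono fun s hs => hs.2).congr ?_ ?_
        · intro s hs
          have := h1 ⟨s, hs⟩
          have h6 := congrArg (fun ψ => ψ ⟨s, hs⟩) h2
          simp only [Φ, this, slowPath_apply, mul_one]
          exact h6
        · have h6 := congrArg (fun ψ => ψ 1) h2
          simp only [Φ, Complex.ofReal_one, one_mul]
          exact h6
      have h7 := (uniqueDiffOn_Icc_zero_one (1 : ℝ) (by simp)).eq_deriv _ d1 d2
      have h8 : ((v.1, 0) : ℂ × F) = v.1 • (1, 0) := by simp
      rw [h8, map_smul] at h7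
      exact smul_right_injective F hv h7
    have hL : ∀ w : F, (ContinuousLinearMap.fst ℂ ℂ F) (1, w) = 1 := fun w => rfl
    refine (eventually_eq_of_smul_eq_smul (ℓ := ContinuousLinearMap.fst ℂ ℂ F) (e := (1, 0))
      (hL 0) (g₁ := fun v => fderiv ℂ Φ v (1, 0)) (g₂ := fun v => Z (Φ v)) ?_ ?_ ?_)
    · filter_upwards [hΦ.eventually_analyticAt] with v hv
      exact hv.fderiv.continuousAt.clm_apply continuousAt_const
    · have : AnalyticAt ℂ (fun v => Z (Φ v)) (0, p) :=
        AnalyticAt.comp (g := Z) (f := Φ) (hΦp.symm ▸ hZ) hΦ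
      filter_upwards [this.eventually_analyticAt] with v hv
      exact hv.continuousAt
    · filter_upwards [hne] with v hv
      by_cases h : v.1 = 0
      · simp [h]
      · rw [hv h]
  · intro w hw
    -- A line along which `Z` is constantly equal to its direction `w` solves the integral equation,
    -- hence is the flow line by local uniqueness.
    let line : C(I, F) := ⟨fun s => ((s : ℝ) : ℂ) • w, by fun_prop⟩
    let ψ : ℂ → C(I, F) := fun τ => c + τ • line
    have hψ : Tendsto ψ (𝓝 0) (𝓝 c) := by
      have : Continuous ψ := by fun_prop
      exact this.tendsto' _ _ (by simp [ψ])
    have hpair : Tendsto (fun τ => ((τ, p), ψ τ)) (𝓝 (0 : ℂ)) (𝓝 (((0 : ℂ), p), c)) :=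
      (tendsto_id.prodMk_nhds tendsto_const_nhds).prodMk_nhds hψ
    obtain ⟨r, hr, hwr⟩ := Metric.eventually_nhds_iff.1 hw
    filter_upwards [hpair.eventually huniq, hψ.eventually hNZ, Metric.ball_mem_nhds (0 : ℂ) hr]
      with τ h1 h2 h3
    have h4 : ∀ s : I, N (ψ τ) s = w := by
      intro s
      rw [h2 s]
      have : ψ τ s = p + (τ * ((s : ℝ) : ℂ)) • w := by simp [ψ, hc, line, mul_smul]
      rw [this]
      refine hwr ?_
      rw [dist_zero_right, norm_mul, Complex.norm_real, Real.norm_eq_abs, abs_of_nonneg s.2.1]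
      rw [Metric.mem_ball, dist_zero_right] at h3
      exact (mul_le_of_le_one_right (norm_nonneg _) s.2.2).trans_lt h3
    have h5 : ψ τ = ContinuousMap.const I p + τ • pathPrimitive F (N (ψ τ)) := by
      ext s
      have h6 : pathPrimitive F (N (ψ τ)) s = ((s : ℝ) : ℂ) • w := by
        rw [pathPrimitive_apply, Complex.coe_smul]
        have : Set.IccExtend (zero_le_one (α := ℝ)) (N (ψ τ)) = fun _ => w := by
          ext r
          rw [Set.IccExtend_apply]
          exact h4 _
        rw [this]
        simp
      change c s + τ • line s = p + τ • pathPrimitive F (N (ψ τ)) s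
      rw [h6]
      simp [hc, line]
    have h7 := congrArg (fun ψ => ψ 1) (h1.1 h5)
    simpa [Φ, ψ, hc, line] using h7

end Flow

/-! ### Invariance of a closed form under the flow of an annihilating field -/

section FlowInvariance

variable {F : Type*} [NormedAddCommGroup F] [NormedSpace ℂ F]

theorem fderiv_apply_apply_self_eq_zero {Ω : F → F →L[ℂ] F →L[ℂ] ℂ}
    (halt : ∀ z a, Ω z a a = 0) {z : F} (h : DifferentiableAt ℂ Ω z) (v a : F) :
    fderiv ℂ Ω z v a a = 0 := by
  have h := ((h.hasFDerivAt.clm_apply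
    (hasFDerivAt_const a z)).clm_apply (hasFDerivAt_const a z)).fderiv
  simp only [halt] at h
  simpa using (congrArg (fun L => L v) h).symm

theorem apply_eq_neg_of_alternating {B : F →L[ℂ] F →L[ℂ] ℂ} (halt : ∀ a, B a a = 0) (a b : F) :
    B a b = - B b a := by
  have := halt (a + b)
  simp only [map_add, add_apply, halt] at this
  linear_combination this

/-- A closed `2`-form annihilated by a vector field is invariant under its local flow. -/
theorem eventually_flow_preserves [CompleteSpace F] {Ω : F → F →L[ℂ] F →L[ℂ] ℂ} {Z : F → F}
    {p : F} (hΩ : AnalyticAt ℂ Ω p) (hZ : AnalyticAt ℂ Z p) (halt : ∀ z a, Ω z a a = 0)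
    (hclosed : ∀ᶠ z in 𝓝 p, ∀ a b c,
      fderiv ℂ Ω z a b c + fderiv ℂ Ω z b c a + fderiv ℂ Ω z c a b = 0)
    (hann : ∀ᶠ z in 𝓝 p, ∀ b, Ω z (Z z) b = 0)
    {Φ : ℂ × F → F} (hΦ : AnalyticAt ℂ Φ (0, p)) (hΦ0 : ∀ᶠ q in 𝓝 p, Φ (0, q) = q)
    (hflow : ∀ᶠ v in 𝓝 ((0 : ℂ), p), fderiv ℂ Φ v (1, 0) = Z (Φ v)) :
    ∀ᶠ v in 𝓝 ((0 : ℂ), p), ∀ a b,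
      Ω (Φ v) (fderiv ℂ Φ v (0, a)) (fderiv ℂ Φ v (0, b)) = Ω v.2 a b := by
  have hΦp : Φ (0, p) = p := hΦ0.self_of_nhds
  have hcont : Tendsto Φ (𝓝 (0, p)) (𝓝 p) := by
    have := hΦ.continuousAt.tendsto
    rwa [hΦp] at this
  have hskew := fun z => apply_eq_neg_of_alternating (halt z)
  -- The Lie derivative vanishes: `L_Z Ω = d(Z ⌟ Ω) + Z ⌟ dΩ`, and both terms are zero.
  have key : ∀ᶠ v in 𝓝 ((0 : ℂ), p), ∀ a b, HasDerivAt (fun τ : ℂ =>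
      Ω (Φ (τ, v.2)) (fderiv ℂ Φ (τ, v.2) (0, a)) (fderiv ℂ Φ (τ, v.2) (0, b))) 0 v.1 := by
    filter_upwards [hΦ.eventually_analyticAt, hflow.eventually_nhds,
      hcont.eventually hΩ.eventually_analyticAt, hcont.eventually hZ.eventually_analyticAt,
      hcont.eventually hclosed, hcont.eventually hann.eventually_nhds] with v h1 h2 h3 h4 h5 h6 a b
    have hline : HasDerivAt (fun τ : ℂ => (τ, v.2)) ((1 : ℂ), (0 : F)) v.1 :=
      (hasDerivAt_id v.1).prodMk (hasDerivAt_const v.1 v.2)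
    have d1 : HasDerivAt (fun τ : ℂ => Φ (τ, v.2)) (Z (Φ v)) v.1 := by
      rw [← h2.self_of_nhds]
      exact h1.differentiableAt.hasFDerivAt.comp_hasDerivAt v.1 hline
    have d2 : HasDerivAt (fun τ : ℂ => Ω (Φ (τ, v.2))) (fderiv ℂ Ω (Φ v) (Z (Φ v))) v.1 :=
      h3.differentiableAt.hasFDerivAt.comp_hasDerivAt v.1 d1
    -- The variational equation along the flow, obtained by exchanging the time and space
    -- derivatives in the second derivative of `Φ`.
    have d3 : ∀ a, HasDerivAt (fun τ : ℂ => fderiv ℂ Φ (τ, v.2) (0, a))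
        (fderiv ℂ Z (Φ v) (fderiv ℂ Φ v (0, a))) v.1 := by
      intro a
      have e1 : HasDerivAt (fun τ : ℂ => fderiv ℂ Φ (τ, v.2))
          (fderiv ℂ (fderiv ℂ Φ) v (1, 0)) v.1 :=
        h1.fderiv.differentiableAt.hasFDerivAt.comp_hasDerivAt v.1 hline
      have e2 := e1.clm_apply (hasDerivAt_const v.1 ((0 : ℂ), a))
      have hsymm : IsSymmSndFDerivAt ℂ Φ v := (h1.contDiffAt (n := ⊤)).isSymmSndFDerivAt (by simp)
      have e3 : HasFDerivAt (fun w => fderiv ℂ Φ w (1, 0)) _ v :=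
        h1.fderiv.differentiableAt.hasFDerivAt.clm_apply (hasFDerivAt_const ((1 : ℂ), (0 : F)) v)
      have e4 : HasFDerivAt (fun w => Z (Φ w)) _ v :=
        h4.differentiableAt.hasFDerivAt.comp v h1.differentiableAt.hasFDerivAt
      have e5 := congrArg (fun L => L (0, a)) (e3.unique (e4.congr_of_eventuallyEq h2))
      convert! e2 using 1
      rw [map_zero, add_zero, hsymm (1, 0) (0, a)]
      simpa using e5.symm
    have d4 := (d2.clm_apply (d3 a)).clm_apply (d3 b)
    convert! d4 using 1
    set y := Φ v
    set a' := fderiv ℂ Φ v (0, a)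
    set b' := fderiv ℂ Φ v (0, b)
    have hann' : ∀ c d, fderiv ℂ Ω y d (Z y) c + Ω y (fderiv ℂ Z y d) c = 0 := by
      intro c d
      have f1 : HasFDerivAt (fun z => Ω z (Z z) c) _ y :=
        (h3.differentiableAt.hasFDerivAt.clm_apply h4.differentiableAt.hasFDerivAt).clm_apply
          (hasFDerivAt_const c y)
      have f2 : HasFDerivAt (fun z => Ω z (Z z) c) (0 : F →L[ℂ] ℂ) y := by
        refine (hasFDerivAt_const (0 : ℂ) y).congr_of_eventuallyEq ?_
        filter_upwards [h6] with z hz using hz c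
      have := congrArg (fun L => L d) (f1.unique f2)
      simp at this
      linear_combination this
    have g1 := hann' b' a'
    have g2 := hann' a' b'
    have g3 := h5 (Z y) a' b'
    have g4 := apply_eq_neg_of_alternating
      (fun w => fderiv_apply_apply_self_eq_zero halt h3.differentiableAt a' w) b' (Z y)
    have g5 := hskew y a' (fderiv ℂ Z y b')
    simp only [add_apply]
    rw [g5]
    linear_combination -g3 - g1 + g2 + g4
  have hstart : ∀ᶠ q in 𝓝 p, ∀ a, fderiv ℂ Φ (0, q) (0, a) = a := by
    have hinr : Tendsto (fun q : F => ((0 : ℂ), q)) (𝓝 p) (𝓝 (0, p)) :=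
      (continuous_const.prodMk continuous_id).tendsto' _ _ rfl
    filter_upwards [hΦ0.eventually_nhds, hinr.eventually hΦ.eventually_analyticAt] with q h1 h2 a
    have e1 : HasFDerivAt (fun q => Φ (0, q)) _ q :=
      h2.differentiableAt.hasFDerivAt.comp q (hasFDerivAt_prodMk_right (0 : ℂ) q)
    have e2 : HasFDerivAt (fun q => Φ (0, q)) (ContinuousLinearMap.id ℂ F) q :=
      (hasFDerivAt_id q).congr_of_eventuallyEq h1
    simpa using congrArg (fun L => L a) (e1.unique e2)
  obtain ⟨ε, hε, hkey⟩ := Metric.eventually_nhds_iff.1 key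
  obtain ⟨ε', hε', hst⟩ := Metric.eventually_nhds_iff.1 (hstart.and hΦ0)
  filter_upwards [Metric.ball_mem_nhds ((0 : ℂ), p) hε, Metric.ball_mem_nhds ((0 : ℂ), p) hε']
    with v hv hv' a b
  rw [Metric.mem_ball, Prod.dist_eq, max_lt_iff] at hv hv'
  have hd : ∀ τ ∈ Metric.ball (0 : ℂ) ε, HasDerivAt (fun τ : ℂ =>
      Ω (Φ (τ, v.2)) (fderiv ℂ Φ (τ, v.2) (0, a)) (fderiv ℂ Φ (τ, v.2) (0, b))) 0 τ := by
    intro τ hτ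
    exact hkey (y := (τ, v.2)) (by rw [Prod.dist_eq]; exact max_lt hτ hv.2) a b
  have := Metric.isOpen_ball.is_const_of_deriv_eq_zero
    (convex_ball (0 : ℂ) ε).isPreconnected
    (fun τ hτ => (hd τ hτ).differentiableAt.differentiableWithinAt)
    (fun τ hτ => (hd τ hτ).deriv) (x := v.1) (y := 0) hv.1 (Metric.mem_ball_self hε)
  have h0 := hst (y := v.2) hv'.2
  simp only [h0.1, h0.2] at this
  exact this

end FlowInvariance

namespace SingSymp

/-! ### Exterior powers of a two-form as sums over permutations -/

section WedgePower

variable {V : Type*} [AddCommGroup V] [Module ℂ V]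

theorem alternatization_domDomCongr {ι ι' N : Type*} [Fintype ι] [Fintype ι'] [DecidableEq ι]
    [DecidableEq ι'] [AddCommGroup N] [Module ℂ N] (e : ι ≃ ι')
    (m : MultilinearMap ℂ (fun _ : ι => V) N) :
    MultilinearMap.alternatization (m.domDomCongr e) =
      (MultilinearMap.alternatization m).domDomCongr e := by
  ext v
  rw [AlternatingMap.domDomCongr_apply, MultilinearMap.alternatization_apply,
    MultilinearMap.alternatization_apply]
  refine Fintype.sum_equiv (Equiv.permCongr e.symm) _ _ fun σ => ?_
  rw [Equiv.Perm.sign_permCongr]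
  congr 1
  simp [MultilinearMap.domDomCongr_apply]

/-- The (non alternating) product `η ⊗ ⋯ ⊗ η`. -/
def tensorPow (η : V [⋀^Fin 2]→ₗ[ℂ] ℂ) : (k : ℕ) → MultilinearMap ℂ (fun _ : Fin (2 * k) => V) ℂ
  | 0 => MultilinearMap.constOfIsEmpty ℂ (fun _ : Fin 0 => V) 1
  | k + 1 => ((LinearMap.mul' ℂ ℂ).compMultilinearMap
      ((tensorPow η k).domCoprod η.toMultilinearMap)).domDomCongr finSumFinEquiv

/-- Alternatization of a tensor product is the shuffle product of the alternatizations. As `η` is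
already alternating, each factor contributes `2! = 2`. The recursive wedge power thereby acquires an
explicit permutation expansion. -/
theorem alternatization_tensorPow (η : V [⋀^Fin 2]→ₗ[ℂ] ℂ) (k : ℕ) :
    MultilinearMap.alternatization (tensorPow η k) = (2 : ℂ) ^ k • wedgePow η k := by
  induction k with
  | zero =>
    ext v
    rw [MultilinearMap.alternatization_apply]
    have : Subsingleton (Equiv.Perm (Fin (2 * 0))) :=
      inferInstanceAs (Subsingleton (Equiv.Perm (Fin 0)))
    rw [Fintype.sum_subsingleton _ (1 : Equiv.Perm (Fin (2 * 0)))]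
    simp [tensorPow, wedgePow]
  | succ k ih =>
    have h1 : MultilinearMap.alternatization (tensorPow η (k + 1)) =
        ((LinearMap.mul' ℂ ℂ).compAlternatingMap ((MultilinearMap.alternatization
          (tensorPow η k)).domCoprod (MultilinearMap.alternatization
            (η : MultilinearMap ℂ (fun _ : Fin 2 => V) ℂ)))).domDomCongr finSumFinEquiv := by
      rw [← MultilinearMap.domCoprod_alternization, ← LinearMap.compMultilinearMap_alternatization,
        ← alternatization_domDomCongr]
      rfl
    rw [h1, ih, AlternatingMap.coe_alternatization]
    have h2 : ((2 : ℂ) ^ k • wedgePow η k).domCoprod ((Fintype.card (Fin 2)).factorial • η) =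
        (2 : ℂ) ^ (k + 1) • (wedgePow η k).domCoprod η := by
      rw [← AlternatingMap.domCoprod'_apply, ← AlternatingMap.domCoprod'_apply,
        ← TensorProduct.smul_tmul', TensorProduct.tmul_smul, map_smul]
      rw [show ((Fintype.card (Fin 2)).factorial) = 2 by simp, map_nsmul, pow_succ, mul_smul]
      congr 1
      rw [ofNat_smul_eq_nsmul ℂ 2]
    rw [h2]
    ext v
    simp [wedgePow, wedge]

/-- The enumeration `(i, a) ↦ 2 i + a`. -/
def pairEquiv (k : ℕ) : Fin k × Fin 2 ≃ Fin (2 * k) :=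
  finProdFinEquiv.trans (finCongr (mul_comm k 2))

theorem pairEquiv_val {k : ℕ} (i : Fin k) (a : Fin 2) :
    (pairEquiv k (i, a) : ℕ) = a + 2 * i := by simp [pairEquiv]

theorem tensorPow_apply (η : V [⋀^Fin 2]→ₗ[ℂ] ℂ) (k : ℕ) (v : Fin (2 * k) → V) :
    tensorPow η k v = ∏ i : Fin k, η ![v (pairEquiv k (i, 0)), v (pairEquiv k (i, 1))] := by
  induction k with
  | zero => simp [tensorPow]
  | succ k ih =>
    have h1 : tensorPow η (k + 1) v = tensorPow η k (fun i => v (Fin.castAdd 2 i)) *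
        η (fun i => v (Fin.natAdd (2 * k) i)) := by
      simp [tensorPow, MultilinearMap.domDomCongr_apply, MultilinearMap.domCoprod_apply]
      rfl
    rw [h1, ih, Fin.prod_univ_castSucc]
    congr 1
    congr 1
    ext i
    fin_cases i
    · simp only [Fin.zero_eta, Matrix.cons_val_zero]
      congr 1
      ext
      simp [pairEquiv_val]
    · simp only [Fin.mk_one, Matrix.cons_val_one, Matrix.cons_val_zero]
      congr 1
      ext
      simp [pairEquiv_val]
      omega

theorem wedgePow_apply (η : V [⋀^Fin 2]→ₗ[ℂ] ℂ) (k : ℕ) (v : Fin (2 * k) → V) :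
    (2 : ℂ) ^ k * wedgePow η k v = ∑ σ : Equiv.Perm (Fin (2 * k)), (σ.sign : ℂ) *
      ∏ i : Fin k, η ![v (σ (pairEquiv k (i, 0))), v (σ (pairEquiv k (i, 1)))] := by
  have h := congrArg (fun m => m v) (alternatization_tensorPow η k)
  simp only [AlternatingMap.smul_apply, smul_eq_mul] at h
  rw [← h, MultilinearMap.alternatization_apply]
  refine Finset.sum_congr rfl fun σ _ => ?_
  rw [MultilinearMap.domDomCongr_apply, tensorPow_apply]
  rcases Int.units_eq_one_or (Equiv.Perm.sign σ) with hs | hs <;> simp [hs]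

/-- The value of `η^k` only depends on the Gram matrix. -/
theorem wedgePow_apply_congr {W : Type*} [AddCommGroup W] [Module ℂ W]
    {η : V [⋀^Fin 2]→ₗ[ℂ] ℂ} {θ : W [⋀^Fin 2]→ₗ[ℂ] ℂ} {k : ℕ} {v : Fin (2 * k) → V}
    {w : Fin (2 * k) → W} (h : ∀ i j, η ![v i, v j] = θ ![w i, w j]) :
    wedgePow η k v = wedgePow θ k w := by
  have h2 : (2 : ℂ) ^ k ≠ 0 := pow_ne_zero _ two_ne_zero
  refine mul_left_cancel₀ h2 ?_
  rw [wedgePow_apply, wedgePow_apply]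
  simp only [h]

theorem wedgePow_apply_eq_zero {η : V [⋀^Fin 2]→ₗ[ℂ] ℂ} {k : ℕ} {v : Fin (2 * k) → V}
    {i : Fin (2 * k)} (h : ∀ j, η ![v i, v j] = 0) : wedgePow η k v = 0 := by
  have h2 : (2 : ℂ) ^ k ≠ 0 := pow_ne_zero _ two_ne_zero
  refine (mul_eq_zero.1 (?_ : (2 : ℂ) ^ k * _ = 0)).resolve_left h2
  rw [wedgePow_apply]
  refine Finset.sum_eq_zero fun σ _ => mul_eq_zero_of_right _ ?_
  obtain ⟨⟨j, a⟩, hj⟩ := (pairEquiv k).surjective (σ.symm i)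
  refine Finset.prod_eq_zero (Finset.mem_univ j) ?_
  have hi : σ (pairEquiv k (j, a)) = i := by simp [hj]
  have hswap : ∀ x y, η ![x, y] = - η ![y, x] := by
    intro x y
    have := η.map_swap ![y, x] (i := 0) (j := 1) (by simp)
    rw [← this]
    congr 1
    ext l
    fin_cases l <;> simp
  fin_cases a
  · simp only [Fin.zero_eta] at hi
    rw [hi, h]
  · simp only [Fin.mk_one] at hi
    rw [hi, hswap, h, neg_zero]

theorem update_pair_zero {α : Type*} (a b c : α) : Function.update ![a, b] 0 c = ![c, b] := by
  ext i; fin_cases i <;> simp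

theorem update_pair_one {α : Type*} (a b c : α) : Function.update ![a, b] 1 c = ![a, c] := by
  ext i; fin_cases i <;> simp

/-- The bilinear map underlying an alternating `2`-form. -/
def bilinOf (η : V [⋀^Fin 2]→ₗ[ℂ] ℂ) : V →ₗ[ℂ] V →ₗ[ℂ] ℂ :=
  LinearMap.mk₂ ℂ (fun a b => η ![a, b])
    (fun a b c => by simpa only [update_pair_zero] using η.map_update_add ![a, c] 0 a b)
    (fun r a b => by simpa only [update_pair_zero] using η.map_update_smul ![a, b] 0 r a)
    (fun a b c => by simpa only [update_pair_one] using η.map_update_add ![a, b] 1 b c)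
    (fun r a b => by simpa only [update_pair_one] using η.map_update_smul ![a, b] 1 r b)

theorem bilinOf_apply (η : V [⋀^Fin 2]→ₗ[ℂ] ℂ) (a b : V) : bilinOf η a b = η ![a, b] := rfl

theorem bilinOf_self (η : V [⋀^Fin 2]→ₗ[ℂ] ℂ) (a : V) : bilinOf η a a = 0 :=
  η.map_eq_zero_of_eq ![a, a] (i := 0) (j := 1) rfl (by simp)

/-- A family `x₁, y₁, …, x_k, y_k` with `η(x_i, y_i) = 1` and all other pairings zero. -/
def IsSymplecticFamily {k : ℕ} (B : V →ₗ[ℂ] V →ₗ[ℂ] ℂ) (w : Fin k × Fin 2 → V) : Prop :=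
  ∀ p q, B (w p) (w q) =
    if p.1 = q.1 then (if p.2 = q.2 then 0 else if p.2 = 0 then 1 else -1) else 0

/-- A term is nonzero only if `σ` permutes the pairs as blocks. A permutation of blocks of size two
is even, so the sign of `σ` is the product of the signs within the pairs, and these are exactly the
factors of the product. Every term is thus `0` or `1`. -/
theorem sign_mul_prod_symplectic {k : ℕ} (σ : Equiv.Perm (Fin k × Fin 2)) :
    ∃ N : ℕ, ((Equiv.Perm.sign σ : ℤ) : ℂ) * ∏ i : Fin k,
      (if (σ (i, 0)).1 = (σ (i, 1)).1 then (if (σ (i, 0)).2 = (σ (i, 1)).2 then 0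
        else if (σ (i, 0)).2 = 0 then 1 else -1) else 0 : ℂ) = N := by
  by_cases h : ∀ i, (σ (i, 0)).1 = (σ (i, 1)).1
  · have h' : ∀ i a, (σ (i, a)).1 = (σ (i, 0)).1 := by
      intro i a
      fin_cases a
      · rfl
      · exact (h i).symm
    have hτ : Function.Surjective fun i => (σ (i, 0)).1 := by
      intro j
      obtain ⟨⟨i, a⟩, hi⟩ := σ.surjective (j, 0)
      exact ⟨i, by simp only; rw [← h' i a, hi]⟩
    let τ : Equiv.Perm (Fin k) := Equiv.ofBijective _ ⟨Finite.injective_iff_surjective.2 hτ, hτ⟩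
    have hπ : ∀ i, Function.Injective fun a => (σ (i, a)).2 := by
      intro i a b hab
      have : σ (i, a) = σ (i, b) := Prod.ext ((h' i a).trans (h' i b).symm) hab
      simpa using σ.injective this
    let π : Fin k → Equiv.Perm (Fin 2) := fun i =>
      Equiv.ofBijective _ ⟨hπ i, Finite.injective_iff_surjective.1 (hπ i)⟩
    have hσ : σ = (Equiv.prodCongrRight π).trans (Equiv.prodCongrLeft fun _ => τ) := by
      ext1 ⟨i, a⟩
      exact Prod.ext (h' i a) rfl
    have hsign : Equiv.Perm.sign σ = ∏ i, Equiv.Perm.sign (π i) := by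
      conv_lhs => rw [hσ]
      rw [Equiv.Perm.sign_trans, Equiv.Perm.sign_prodCongrLeft, Equiv.Perm.sign_prodCongrRight]
      simp
    have hterm : ∀ ρ : Equiv.Perm (Fin 2), (if ρ 0 = ρ 1 then 0 else if ρ 0 = 0 then 1 else -1 : ℤ)
        = Equiv.Perm.sign ρ := by decide
    refine ⟨1, ?_⟩
    rw [hsign]
    have : ∀ i, (if (σ (i, 0)).1 = (σ (i, 1)).1 then (if (σ (i, 0)).2 = (σ (i, 1)).2 then 0
        else if (σ (i, 0)).2 = 0 then 1 else -1) else 0 : ℂ) = ((Equiv.Perm.sign (π i) : ℤ) : ℂ) := by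
      intro i
      rw [if_pos (h i), ← hterm (π i)]
      simp only [π]
      push_cast
      rfl
    simp only [this]
    push_cast
    rw [← Finset.prod_mul_distrib]
    refine Finset.prod_eq_one fun i _ => ?_
    rcases Int.units_eq_one_or (Equiv.Perm.sign (π i)) with hs | hs <;> simp [hs]
  · push Not at h
    obtain ⟨i, hi⟩ := h
    refine ⟨0, ?_⟩
    rw [Finset.prod_eq_zero (Finset.mem_univ i) (by rw [if_neg hi])]
    simp

/-- No cancellation is possible in the permutation expansion: all terms are natural numbers and the
identity contributes `1`. -/
theorem IsSymplecticFamily.wedgePow_ne_zero {k : ℕ} {η : V [⋀^Fin 2]→ₗ[ℂ] ℂ}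
    {w : Fin k × Fin 2 → V} (hw : IsSymplecticFamily (bilinOf η) w) :
    wedgePow η k (fun i => w ((pairEquiv k).symm i)) ≠ 0 := by
  intro h0
  have h := wedgePow_apply η k (fun i => w ((pairEquiv k).symm i))
  rw [h0, mul_zero] at h
  rw [← (Equiv.permCongr (pairEquiv k)).sum_comp] at h
  simp only [Equiv.permCongr_apply, Equiv.symm_apply_apply, Equiv.Perm.sign_permCongr,
    ← bilinOf_apply, hw _ _] at h
  choose N hN using sign_mul_prod_symplectic (k := k)
  simp only [hN] at h
  have h1 := hN 1
  simp at h1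
  rw [← Nat.cast_sum, eq_comm, Nat.cast_eq_zero, Finset.sum_eq_zero_iff] at h
  have h2 := h 1 (Finset.mem_univ _)
  rw [h2] at h1
  simp at h1

end WedgePower

end SingSymp

namespace SingSymp

/-! ### Symplectic families, corank, and the kernel of exterior powers -/

section SymplecticFamilies

variable {V : Type*} [AddCommGroup V] [Module ℂ V]

theorem alternating_neg {B : V →ₗ[ℂ] V →ₗ[ℂ] ℂ} (hB : ∀ a, B a a = 0) (a b : V) :
    B a b = - B b a := by
  have := hB (a + b)
  simp only [map_add, LinearMap.add_apply, hB] at this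
  linear_combination this

theorem IsSymplecticFamily.append {B : V →ₗ[ℂ] V →ₗ[ℂ] ℂ} (hB : ∀ a, B a a = 0) {k : ℕ}
    {w : Fin k × Fin 2 → V} (hw : IsSymplecticFamily B w) {x y : V} (hxy : B x y = 1)
    (hx : ∀ p, B x (w p) = 0) (hy : ∀ p, B y (w p) = 0) :
    ∃ w' : Fin (k + 1) × Fin 2 → V, IsSymplecticFamily B w' ∧
      (∀ i a, w' (Fin.castSucc i, a) = w (i, a)) ∧ w' (Fin.last k, 0) = x := by
  have hyx : B y x = -1 := by rw [alternating_neg hB, hxy]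
  have hx' : ∀ p, B (w p) x = 0 := fun p => by rw [alternating_neg hB, hx, neg_zero]
  have hy' : ∀ p, B (w p) y = 0 := fun p => by rw [alternating_neg hB, hy, neg_zero]
  refine ⟨fun p => Fin.lastCases (motive := fun _ => V) (![x, y] p.2) (fun i => w (i, p.2)) p.1,
    ?_, ?_, ?_⟩
  · rintro ⟨i, a⟩ ⟨j, b⟩
    induction i using Fin.lastCases with
    | last =>
      induction j using Fin.lastCases with
      | last => fin_cases a <;> fin_cases b <;> simp [hB, hxy, hyx]
      | cast j =>
        have : Fin.last k ≠ Fin.castSucc j := (Fin.castSucc_lt_last j).ne'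
        fin_cases a <;> simp [hx, hy, this]
    | cast i =>
      induction j using Fin.lastCases with
      | last =>
        have : Fin.castSucc i ≠ Fin.last k := (Fin.castSucc_lt_last i).ne
        fin_cases b <;> simp [hx', hy', this]
      | cast j => simpa using hw (i, a) (j, b)
  · intro i a; simp
  · simp

/-- A symplectic family can be extended by one pair as long as the rank allows it. -/
theorem IsSymplecticFamily.extend [FiniteDimensional ℂ V] {B : V →ₗ[ℂ] V →ₗ[ℂ] ℂ}
    (hB : ∀ a, B a a = 0) {k : ℕ} {w : Fin k × Fin 2 → V} (hw : IsSymplecticFamily B w)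
    (hdim : 2 * k + Module.finrank ℂ (LinearMap.ker B) < Module.finrank ℂ V) :
    ∃ w' : Fin (k + 1) × Fin 2 → V, IsSymplecticFamily B w' ∧
      ∀ i a, w' (Fin.castSucc i, a) = w (i, a) := by
  let S := Submodule.span ℂ (Set.range w)
  have hS : Module.finrank ℂ (S ⊔ LinearMap.ker B : Submodule ℂ V) < Module.finrank ℂ V := by
    have h1 := Submodule.finrank_add_le_finrank_add_finrank S (LinearMap.ker B)
    have h2 : Module.finrank ℂ S ≤ 2 * k := by
      have := finrank_range_le_card (R := ℂ) w
      simpa [Set.finrank, S, mul_comm] using this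
    omega
  -- Symplectic Gram–Schmidt: `u` is taken outside `S ⊔ ker B`, so that its component `π u`
  -- orthogonal to the family is not in the kernel and can be paired with a new vector.
  obtain ⟨u, -, hu⟩ := SetLike.exists_of_lt
    (lt_top_iff_ne_top.2 fun h : S ⊔ LinearMap.ker B = ⊤ => by
      rw [h, finrank_top] at hS
      exact lt_irrefl _ hS)
  let π : V → V := fun u =>
    u - ∑ i, (B u (w (i, 1)) • w (i, 0) - B u (w (i, 0)) • w (i, 1))
  have hπw : ∀ u p, B (π u) (w p) = 0 := by
    rintro u ⟨j, b⟩
    simp only [π, map_sub, map_sum, map_smul, LinearMap.sub_apply, LinearMap.smul_apply,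
      LinearMap.sum_apply, hw _ _, smul_eq_mul]
    fin_cases b
    · simp [Finset.sum_ite_eq']
    · simp [Finset.sum_ite_eq']
  have hπs : ∀ u, u - π u ∈ S := by
    intro u
    simp only [π, sub_sub_cancel]
    refine Submodule.sum_mem _ fun i _ => Submodule.sub_mem _ ?_ ?_ <;>
    exact Submodule.smul_mem _ _ (Submodule.subset_span ⟨_, rfl⟩)
  have hBs : ∀ u, ∀ s ∈ S, B (π u) s = 0 := by
    intro u s hs
    have : S ≤ LinearMap.ker (B (π u)) := by
      rw [Submodule.span_le]
      rintro _ ⟨p, rfl⟩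
      exact hπw u p
    exact this hs
  have hπu : π u ∉ LinearMap.ker B := by
    intro h
    apply hu
    have := Submodule.add_mem_sup (hπs u) h
    simpa using this
  obtain ⟨x, hx⟩ : ∃ x, B (π u) x ≠ 0 := by
    by_contra hcon
    push Not at hcon
    exact hπu (LinearMap.ext hcon)
  have hx2 : B (π u) (π x) = B (π u) x := by
    have := hBs u _ (hπs x)
    rw [map_sub, sub_eq_zero] at this
    exact this.symm
  obtain ⟨w', hw', he, -⟩ := hw.append hB (x := π u) (y := (B (π u) x)⁻¹ • π x)
    (by rw [map_smul, hx2, smul_eq_mul, inv_mul_cancel₀ hx]) (hπw u)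
    (fun p => by simp [hπw])
  exact ⟨w', hw', he⟩

/-- A single extension needs only one dimension left over after the family and the kernel; for the
last step, from `m - 1` to `m` pairs, this is the bound with `+ 1`. That slack is what yields parity
of the rank. -/
theorem IsSymplecticFamily.extend_to [FiniteDimensional ℂ V] {B : V →ₗ[ℂ] V →ₗ[ℂ] ℂ}
    (hB : ∀ a, B a a = 0) {k : ℕ} {w : Fin k × Fin 2 → V} (hw : IsSymplecticFamily B w) {m : ℕ}
    (hkm : k ≤ m)
    (hdim : 2 * m + Module.finrank ℂ (LinearMap.ker B) ≤ Module.finrank ℂ V + 1) :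
    ∃ w' : Fin m × Fin 2 → V, IsSymplecticFamily B w' ∧
      ∀ i a, w' (Fin.castLE hkm i, a) = w (i, a) := by
  induction m, hkm using Nat.le_induction with
  | base => exact ⟨w, hw, fun i a => rfl⟩
  | succ m hm ih =>
    obtain ⟨w₁, h1, h2⟩ := ih (by omega)
    obtain ⟨w₂, h3, h4⟩ := h1.extend hB (by omega)
    exact ⟨w₂, h3, fun i a => by rw [← h2, ← h4]; rfl⟩

/-- Pairing with the `2 k` members of the family maps `V` onto a space of dimension `2 k`, and this
map kills `ker B`. -/
theorem IsSymplecticFamily.le_finrank [FiniteDimensional ℂ V] {B : V →ₗ[ℂ] V →ₗ[ℂ] ℂ}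
    {k : ℕ} {w : Fin k × Fin 2 → V} (hw : IsSymplecticFamily B w) :
    2 * k + Module.finrank ℂ (LinearMap.ker B) ≤ Module.finrank ℂ V := by
  let T : V →ₗ[ℂ] (Fin k × Fin 2 → ℂ) := LinearMap.pi fun p => B.flip (w p)
  have hT : ∀ v p, T v p = B v (w p) := fun v p => rfl
  have hsurj : LinearMap.range T = ⊤ := by
    rw [LinearMap.range_eq_top]
    intro c
    refine ⟨∑ i, (c (i, 1) • w (i, 0) - c (i, 0) • w (i, 1)), ?_⟩
    ext ⟨j, b⟩
    rw [hT]
    simp only [map_sub, map_sum, map_smul, LinearMap.sub_apply, LinearMap.smul_apply,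
      LinearMap.sum_apply, hw _ _, smul_eq_mul]
    fin_cases b <;> simp
  have h1 := LinearMap.finrank_range_add_finrank_ker T
  have h2 : Module.finrank ℂ (LinearMap.ker B) ≤ Module.finrank ℂ (LinearMap.ker T) := by
    refine Submodule.finrank_mono fun v hv => ?_
    ext p
    rw [hT, LinearMap.mem_ker.1 hv]
    rfl
  rw [hsurj, finrank_top, Module.finrank_fintype_fun_eq_card, Fintype.card_prod, Fintype.card_fin,
    Fintype.card_fin] at h1
  omega

theorem isSymplecticFamily_empty (B : V →ₗ[ℂ] V →ₗ[ℂ] ℂ) (w : Fin 0 × Fin 2 → V) :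
    IsSymplecticFamily B w := fun p => p.1.elim0

/-- A degenerate alternating form on an even dimensional space has corank at least two. -/
theorem two_le_finrank_ker [FiniteDimensional ℂ V] {B : V →ₗ[ℂ] V →ₗ[ℂ] ℂ}
    (hB : ∀ a, B a a = 0) {n : ℕ} (hV : Module.finrank ℂ V = 2 * n)
    (hker : LinearMap.ker B ≠ ⊥) : 2 ≤ Module.finrank ℂ (LinearMap.ker B) := by
  have h0 : Module.finrank ℂ (LinearMap.ker B) ≠ 0 := fun h => hker (Submodule.finrank_eq_zero.1 h)
  by_contra hlt
  -- If the corank were one, the `+ 1` in `extend_to` would still allow `n` pairs, one dimension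
  -- more than `le_finrank` permits.
  obtain ⟨w, hw, -⟩ := (isSymplecticFamily_empty B fun p => p.1.elim0).extend_to hB
    (Nat.zero_le n) (by omega)
  have := hw.le_finrank
  omega

theorem mem_formKer_wedgePow {η : V [⋀^Fin 2]→ₗ[ℂ] ℂ} {v : V} (h : bilinOf η v = 0) (k : ℕ) :
    v ∈ formKer (wedgePow η k) := by
  intro w i
  refine wedgePow_apply_eq_zero (i := i) fun j => ?_
  rw [Function.update_self]
  exact congrArg (fun L : V →ₗ[ℂ] ℂ => L (Function.update w i v j)) h

/-- If `η` has corank at most two in dimension `2 (k + 2)`, the kernel of `η^(k + 1)` is that of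
`η`. -/
theorem bilinOf_eq_zero_of_mem_formKer [FiniteDimensional ℂ V] {η : V [⋀^Fin 2]→ₗ[ℂ] ℂ} {k : ℕ}
    (hV : Module.finrank ℂ V = 2 * (k + 2))
    (hη : Module.finrank ℂ (LinearMap.ker (bilinOf η)) ≤ 2) {v : V}
    (hv : v ∈ formKer (wedgePow η (k + 1))) : bilinOf η v = 0 := by
  by_contra hne
  obtain ⟨x, hx⟩ : ∃ x, bilinOf η v x ≠ 0 := by
    by_contra hcon
    push Not at hcon
    exact hne (LinearMap.ext hcon)
  have hB := bilinOf_self η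
  -- If `v` were not in the kernel of `η`, it would be the first vector of a symplectic family of `k
  -- + 1` pairs; corank at most two leaves room for these. On that family `η^(k+1)` does not vanish,
  -- although `v` occupies one of its slots.
  obtain ⟨w, hw, -, hwv⟩ := (isSymplecticFamily_empty (bilinOf η) fun p => p.1.elim0).append hB
    (x := v) (y := (bilinOf η v x)⁻¹ • x) (by rw [map_smul, smul_eq_mul, inv_mul_cancel₀ hx])
    (fun p => p.1.elim0) (fun p => p.1.elim0)
  obtain ⟨w', hw', hext⟩ := hw.extend_to hB (m := k + 1) (by omega) (by omega)
  have h0 : w' (0, 0) = v := by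
    rw [← hwv, ← hext]
    rfl
  refine hw'.wedgePow_ne_zero ?_
  have := hv (fun i => w' ((pairEquiv (k + 1)).symm i)) (pairEquiv (k + 1) (0, 0))
  rwa [Function.update_eq_self_iff.2 (by simp [h0])] at this

end SymplecticFamilies

/-! ### The Pfaffian identity for the Gram determinant -/

section Gram

/-- The determinant of the Gram matrix of a bilinear form in the standard basis. -/
def gramDet {N : ℕ} (B : (Fin N → ℂ) →ₗ[ℂ] (Fin N → ℂ) →ₗ[ℂ] ℂ) : ℂ :=
  (LinearMap.toMatrix₂' ℂ B).det

theorem gramDet_comp {N : ℕ} (B : (Fin N → ℂ) →ₗ[ℂ] (Fin N → ℂ) →ₗ[ℂ] ℂ)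
    (L : (Fin N → ℂ) →ₗ[ℂ] (Fin N → ℂ)) :
    gramDet (B.compl₁₂ L L) = LinearMap.det L ^ 2 * gramDet B := by
  rw [gramDet, LinearMap.toMatrix₂'_compl₁₂, Matrix.det_mul, Matrix.det_mul, Matrix.det_transpose,
    LinearMap.det_toMatrix', gramDet]
  ring

theorem toMatrix₂'_vecMul {N : ℕ} (B : (Fin N → ℂ) →ₗ[ℂ] (Fin N → ℂ) →ₗ[ℂ] ℂ) (v : Fin N → ℂ)
    (j : Fin N) :
    Matrix.vecMul v (LinearMap.toMatrix₂' ℂ B) j = B v (Pi.single j 1) := by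
  conv_rhs => rw [pi_eq_sum_univ' v]
  simp [Matrix.vecMul, dotProduct, LinearMap.toMatrix₂'_apply]

theorem vecMul_toMatrix₂'_eq_zero_iff {N : ℕ} {B : (Fin N → ℂ) →ₗ[ℂ] (Fin N → ℂ) →ₗ[ℂ] ℂ}
    {v : Fin N → ℂ} : Matrix.vecMul v (LinearMap.toMatrix₂' ℂ B) = 0 ↔ B v = 0 := by
  constructor
  · intro h
    refine LinearMap.pi_ext' fun j => LinearMap.ext_ring ?_
    simpa [toMatrix₂'_vecMul] using congrFun h j
  · intro h
    ext j
    rw [toMatrix₂'_vecMul, h]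
    rfl

theorem ker_eq_bot_iff_gramDet_ne_zero {N : ℕ} {B : (Fin N → ℂ) →ₗ[ℂ] (Fin N → ℂ) →ₗ[ℂ] ℂ} :
    LinearMap.ker B = ⊥ ↔ gramDet B ≠ 0 := by
  rw [gramDet, ne_eq, ← Matrix.exists_vecMul_eq_zero_iff, LinearMap.ker_eq_bot']
  simp only [vecMul_toMatrix₂'_eq_zero_iff]
  push Not
  exact forall_congr' fun v => ⟨fun h hne h0 => hne (h h0), fun h h0 => by
    by_contra hne; exact h hne h0⟩

theorem topForm_apply_image {N : ℕ} (P : (Fin N → ℂ) [⋀^Fin N]→ₗ[ℂ] ℂ)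
    (L : (Fin N → ℂ) →ₗ[ℂ] (Fin N → ℂ)) :
    P (fun i => L (Pi.single i 1)) = LinearMap.det L * P (fun i => Pi.single i 1) := by
  have h := AlternatingMap.eq_smul_basis_det (Pi.basisFun ℂ (Fin N)) P
  have he : ⇑(Pi.basisFun ℂ (Fin N)) = fun i => Pi.single i 1 := by ext1 i; simp
  rw [he] at h
  have h2 := (Pi.basisFun ℂ (Fin N)).det_comp L (fun i => Pi.single i 1)
  have h3 := (Pi.basisFun ℂ (Fin N)).det_self
  rw [he] at h3
  have h1 : P (fun i => L (Pi.single i 1)) = P (fun i => Pi.single i 1) *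
      (Pi.basisFun ℂ (Fin N)).det (fun i => L (Pi.single i 1)) := by
    conv_lhs => rw [h]
    rfl
  rw [h1, mul_comm]
  congr 1
  refine h2.trans ?_
  rw [h3, mul_one]

theorem topForm_apply_update {N : ℕ} (P : (Fin N → ℂ) [⋀^Fin N]→ₗ[ℂ] ℂ) (i : Fin N)
    (v : Fin N → ℂ) :
    P (Function.update (fun i => Pi.single i 1) i v) = v i * P (fun i => Pi.single i 1) := by
  have h := AlternatingMap.eq_smul_basis_det (Pi.basisFun ℂ (Fin N)) P
  have he : ⇑(Pi.basisFun ℂ (Fin N)) = fun i => Pi.single i 1 := by ext1 i; simp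
  rw [he] at h
  have h1 : P (Function.update (fun i => Pi.single i 1) i v) = P (fun i => Pi.single i 1) *
      (Pi.basisFun ℂ (Fin N)).det (Function.update (fun i => Pi.single i 1) i v) := by
    conv_lhs => rw [h]
    rfl
  rw [h1, mul_comm, Pi.basisFun_det]
  congr 1
  have h2 := Matrix.cramer_transpose_apply (1 : Matrix (Fin N) (Fin N) ℂ) v i
  rw [Matrix.transpose_one, Matrix.cramer_one] at h2
  have h3 : (1 : Matrix (Fin N) (Fin N) ℂ).updateRow i v =
      Function.update (fun i => Pi.single i 1) i v := by
    ext k j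
    by_cases hk : k = i
    · subst hk; simp
    · rw [Matrix.updateRow_ne hk, Function.update_of_ne hk]
      simp [Matrix.one_apply, Pi.single_apply, eq_comm]
  rw [h3] at h2
  exact h2.symm

theorem topForm_eq_zero_iff {N : ℕ} {P : (Fin N → ℂ) [⋀^Fin N]→ₗ[ℂ] ℂ} :
    P = 0 ↔ P (fun i => Pi.single i 1) = 0 := by
  constructor
  · rintro rfl; rfl
  · intro h
    have he : ⇑(Pi.basisFun ℂ (Fin N)) = fun i => Pi.single i 1 := by ext1 i; simp
    rw [AlternatingMap.eq_smul_basis_det (Pi.basisFun ℂ (Fin N)) P, he, h, zero_smul]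

/-- A nonzero kernel vector `v` has some coordinate `v i ≠ 0`. Putting it in place of the `i`-th
basis vector multiplies the value of the top form by `v i`, yet makes that value zero. -/
theorem wedgePow_top_eq_zero_of_gramDet {n : ℕ} {η : (Fin (2 * n) → ℂ) [⋀^Fin 2]→ₗ[ℂ] ℂ}
    (h : gramDet (bilinOf η) = 0) : wedgePow η n (fun i => Pi.single i 1) = 0 := by
  obtain ⟨v, hv, hv0⟩ := Matrix.exists_vecMul_eq_zero_iff.2 h
  rw [vecMul_toMatrix₂'_eq_zero_iff] at hv0
  obtain ⟨i, hi⟩ := Function.ne_iff.1 hv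
  have h1 := mem_formKer_wedgePow hv0 n (fun i => Pi.single i 1) i
  rw [topForm_apply_update] at h1
  exact (mul_eq_zero.1 h1).resolve_left hi

/-- The square of the coefficient of `η^n` is a universal multiple of the Gram determinant. -/
theorem exists_wedgePow_sq_eq (n : ℕ) : ∃ c : ℂ, c ≠ 0 ∧
    ∀ η : (Fin (2 * n) → ℂ) [⋀^Fin 2]→ₗ[ℂ] ℂ,
      wedgePow η n (fun i => Pi.single i 1) ^ 2 = c * gramDet (bilinOf η) := by
  let lin : (Fin n × Fin 2 → (Fin (2 * n) → ℂ)) → (Fin (2 * n) → ℂ) →ₗ[ℂ] (Fin (2 * n) → ℂ) :=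
    fun w => (Pi.basisFun ℂ (Fin (2 * n))).constr ℂ fun i => w ((pairEquiv n).symm i)
  have hlin : ∀ w i, lin w (Pi.single i 1) = w ((pairEquiv n).symm i) := by
    intro w i
    rw [← Pi.basisFun_apply, Module.Basis.constr_basis]
  have hval : ∀ (η : (Fin (2 * n) → ℂ) [⋀^Fin 2]→ₗ[ℂ] ℂ) w,
      wedgePow η n (fun i => w ((pairEquiv n).symm i)) =
        LinearMap.det (lin w) * wedgePow η n (fun i => Pi.single i 1) := by
    intro η w
    rw [← topForm_apply_image]
    simp only [hlin]
  -- The constant is computed on any one symplectic basis of any one form. In the remaining case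
  -- every form is degenerate and both sides vanish, so that no standard form has to be exhibited.
  by_cases hex : ∃ (η₀ : (Fin (2 * n) → ℂ) [⋀^Fin 2]→ₗ[ℂ] ℂ) (w₀ : Fin n × Fin 2 → _),
      IsSymplecticFamily (bilinOf η₀) w₀
  · obtain ⟨η₀, w₀, hw₀⟩ := hex
    have hgen : ∀ (η : (Fin (2 * n) → ℂ) [⋀^Fin 2]→ₗ[ℂ] ℂ) w, IsSymplecticFamily (bilinOf η) w →
        gramDet (bilinOf η) ≠ 0 ∧ LinearMap.det (lin w) ≠ 0 := by
      intro η w hw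
      have h1 := hw.le_finrank
      simp only [Module.finrank_fintype_fun_eq_card, Fintype.card_fin] at h1
      refine ⟨ker_eq_bot_iff_gramDet_ne_zero.1 (Submodule.finrank_eq_zero.1 (by omega)), ?_⟩
      intro h0
      apply hw.wedgePow_ne_zero
      rw [hval, h0, zero_mul]
    set p := wedgePow η₀ n (fun i => w₀ ((pairEquiv n).symm i)) with hp
    set d := gramDet ((bilinOf η₀).compl₁₂ (lin w₀) (lin w₀)) with hd
    have hp0 : p ≠ 0 := hw₀.wedgePow_ne_zero
    have hd0 : d ≠ 0 := by
      rw [hd, gramDet_comp]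
      exact mul_ne_zero (pow_ne_zero _ (hgen η₀ w₀ hw₀).2) (hgen η₀ w₀ hw₀).1
    refine ⟨p ^ 2 / d, div_ne_zero (pow_ne_zero _ hp0) hd0, fun η => ?_⟩
    by_cases hη : gramDet (bilinOf η) = 0
    · rw [wedgePow_top_eq_zero_of_gramDet hη, hη]
      simp
    have hk := ker_eq_bot_iff_gramDet_ne_zero.2 hη
    obtain ⟨w, hw, -⟩ := (isSymplecticFamily_empty (bilinOf η) fun p => p.1.elim0).extend_to
      (bilinOf_self η) (Nat.zero_le n) (by rw [hk]; simp)
    -- Any two symplectic bases have the same Gram matrix. Hence both quantities, evaluated on a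
    -- symplectic basis of `η`, take the reference values `p` and `d`.
    have h1 : LinearMap.det (lin w) * wedgePow η n (fun i => Pi.single i 1) = p := by
      rw [← hval, hp]
      refine wedgePow_apply_congr fun i j => ?_
      exact (hw _ _).trans (hw₀ _ _).symm
    have h2 : LinearMap.det (lin w) ^ 2 * gramDet (bilinOf η) = d := by
      rw [← gramDet_comp, hd, gramDet, gramDet]
      congr 1
      ext i j
      simp only [LinearMap.toMatrix₂'_apply, LinearMap.compl₁₂_apply, hlin, hw _ _, hw₀ _ _]
    have h3 := (hgen η w hw).2
    rw [← h1, ← h2]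
    field_simp
  · refine ⟨1, one_ne_zero, fun η => ?_⟩
    have hη : gramDet (bilinOf η) = 0 := by
      by_contra hη
      have hk := ker_eq_bot_iff_gramDet_ne_zero.2 hη
      obtain ⟨w, hw, -⟩ := (isSymplecticFamily_empty (bilinOf η) fun p => p.1.elim0).extend_to
        (bilinOf_self η) (Nat.zero_le n) (by rw [hk]; simp)
      exact hex ⟨η, w, hw⟩
    rw [wedgePow_top_eq_zero_of_gramDet hη, hη]
    simp

end Gram

end SingSymp

namespace SingSymp

/-! ### Corank and order of vanishing of determinants -/

section OrderOfVanishing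

variable {N : ℕ}

/-- The determinant of a curve of matrices whose value at `0` has corank at least `k` vanishes to
order `k` at `0`. -/
theorem exists_det_eq_pow_mul {M : ℂ → Matrix (Fin N) (Fin N) ℂ}
    (hM : ∀ i j, DifferentiableAt ℂ (fun τ => M τ i j) 0) {k : ℕ}
    (hk : k ≤ Module.finrank ℂ (LinearMap.ker (Matrix.vecMulLinear (M 0)))) :
    ∃ h : ℂ → ℂ, ContinuousAt h 0 ∧ ∀ τ, (M τ).det = τ ^ k * h τ := by
  set K := LinearMap.ker (Matrix.vecMulLinear (M 0)) with hK
  obtain ⟨C, hC⟩ := Submodule.exists_isCompl K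
  let b₀ := ((Module.finBasis ℂ K).prod (Module.finBasis ℂ C)).map (K.prodEquivOfIsCompl C hC)
  have hcard : Fintype.card (Fin (Module.finrank ℂ K) ⊕ Fin (Module.finrank ℂ C)) = N := by
    have := Submodule.finrank_add_eq_of_isCompl hC
    simpa using this
  let e := Fintype.equivFinOfCardEq hcard
  let b := b₀.reindex e
  have hb : ∀ i, Matrix.vecMul (b (e (Sum.inl i))) (M 0) = 0 := by
    intro i
    have : b (e (Sum.inl i)) = (Module.finBasis ℂ K i : Fin N → ℂ) := by
      simp [b, b₀]
    rw [this]
    exact (Module.finBasis ℂ K i).2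
  let row : Fin N → ℂ → Fin N → ℂ := fun i τ => Matrix.vecMul (b i) (M τ)
  have hrow : ∀ i, DifferentiableAt ℂ (row i) 0 := by
    intro i
    rw [differentiableAt_pi]
    intro j
    simp only [row, Matrix.vecMul, dotProduct]
    exact DifferentiableAt.fun_sum fun l _ => (hM l j).const_mul _
  -- In a basis adapted to the left kernel at `0`, the rows belonging to kernel vectors vanish at
  -- `0`. Each is `τ` times its divided difference, and these factors `τ` come out of the
  -- determinant.
  let c : Fin N → ℂ → ℂ := fun i τ => Sum.elim (fun _ => τ) (fun _ => 1) (e.symm i)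
  let r : Fin N → ℂ → Fin N → ℂ := fun i =>
    Sum.elim (fun _ => dslope (row i) 0) (fun _ => row i) (e.symm i)
  have hr : ∀ i τ, row i τ = c i τ • r i τ := by
    intro i τ
    obtain ⟨s, rfl⟩ := e.surjective i
    rcases s with s | s
    · have := sub_smul_dslope (row (e (Sum.inl s))) 0 τ
      have h0 : row (e (Sum.inl s)) 0 = 0 := hb s
      rw [h0, sub_zero, sub_zero] at this
      simp only [c, r, Equiv.symm_apply_apply, Sum.elim_inl, this]
    · simp [c, r]
  have hrc : ∀ i, ContinuousAt (r i) 0 := by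
    intro i
    obtain ⟨s, rfl⟩ := e.surjective i
    rcases s with s | s
    · simp only [r, Equiv.symm_apply_apply, Sum.elim_inl]
      exact continuousAt_dslope_same.2 (hrow _)
    · simp only [r, Equiv.symm_apply_apply, Sum.elim_inr]
      exact (hrow _).continuousAt
  have hprod : ∀ τ, ∏ i, c i τ = τ ^ Module.finrank ℂ K := by
    intro τ
    rw [← e.prod_comp]
    simp [c]
  set P : Matrix (Fin N) (Fin N) ℂ := Matrix.of fun i => b i with hP
  have hPdet : P.det ≠ 0 := by
    intro h0
    obtain ⟨v, hv, hv0⟩ := Matrix.exists_vecMul_eq_zero_iff.2 h0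
    apply hv
    have hli := b.linearIndependent
    rw [Fintype.linearIndependent_iff] at hli
    ext i
    refine hli v ?_ i
    rw [← hv0]
    ext j
    simp [Matrix.vecMul, dotProduct, hP]
  have hmul : ∀ τ, P.det * (M τ).det =
      τ ^ Module.finrank ℂ K * (Matrix.of fun i => r i τ).det := by
    intro τ
    rw [← Matrix.det_mul, ← hprod, ← Matrix.det_mul_column]
    congr 1
    ext i j
    have := congrFun (hr i τ) j
    simpa [row, Matrix.vecMul, Matrix.mul_apply, dotProduct, hP] using this
  refine ⟨fun τ => P.det⁻¹ * (τ ^ (Module.finrank ℂ K - k) * (Matrix.of fun i => r i τ).det),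
    ?_, fun τ => ?_⟩
  · refine continuousAt_const.mul ((continuousAt_id.pow _).mul ?_)
    have h1 : ContinuousAt (fun τ => (fun i => r i τ : Fin N → Fin N → ℂ)) 0 :=
      continuousAt_pi.2 hrc
    have h2 : Continuous fun A : Matrix (Fin N) (Fin N) ℂ => A.det := continuous_id.matrix_det
    exact h2.continuousAt.comp h1
  · have h1 := hmul τ
    have h2 : τ ^ Module.finrank ℂ K = τ ^ k * τ ^ (Module.finrank ℂ K - k) := by
      rw [← pow_add, Nat.add_sub_cancel' hk]
    rw [h2] at h1
    field_simp
    linear_combination h1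

theorem hasDerivAt_det_of_two_le {M : ℂ → Matrix (Fin N) (Fin N) ℂ}
    (hM : ∀ i j, DifferentiableAt ℂ (fun τ => M τ i j) 0)
    (hk : 2 ≤ Module.finrank ℂ (LinearMap.ker (Matrix.vecMulLinear (M 0)))) :
    HasDerivAt (fun τ => (M τ).det) 0 0 := by
  obtain ⟨h, hc, hh⟩ := exists_det_eq_pow_mul hM hk
  rw [hasDerivAt_iff_tendsto_slope]
  have h1 : Tendsto (fun τ : ℂ => τ * h τ) (𝓝[≠] 0) (𝓝 0) := by
    have := (continuousAt_id.mul hc).tendsto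
    simp only [id, zero_mul, Pi.mul_apply] at this
    exact this.mono_left nhdsWithin_le_nhds
  refine h1.congr' ?_
  filter_upwards [self_mem_nhdsWithin] with τ hτ
  have : τ ≠ 0 := hτ
  simp only [slope, hh, vsub_eq_sub, sub_zero, smul_eq_mul, ne_eq, OfNat.ofNat_ne_zero,
    not_false_eq_true, zero_pow, zero_mul]
  field_simp

/-- Intended for the Cramer determinants at the origin: if the right-hand side vanishes on the left
kernel vectors in `K`, these survive the replacement of a column. -/
theorem finrank_ker_updateCol {A : Matrix (Fin N) (Fin N) ℂ} {K : Submodule ℂ (Fin N → ℂ)}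
    (hK : ∀ v ∈ K, Matrix.vecMul v A = 0) (i : Fin N) {b : Fin N → ℂ}
    (hb : ∀ v ∈ K, v ⬝ᵥ b = 0) :
    Module.finrank ℂ K ≤ Module.finrank ℂ (LinearMap.ker (Matrix.vecMulLinear (A.updateCol i b))) := by
  refine Submodule.finrank_mono fun v hv => ?_
  rw [LinearMap.mem_ker, Matrix.vecMulLinear_apply]
  ext j
  by_cases hj : j = i
  · subst hj
    simpa [Matrix.vecMul] using hb v hv
  · have := congrFun (hK v hv) j
    simpa [Matrix.vecMul, dotProduct, hj] using this

/-- Replacing one column imposes one linear condition on a left kernel of dimension at least two, so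
a nonzero kernel vector survives. -/
theorem cramer_eq_zero_of_two_le {A : Matrix (Fin N) (Fin N) ℂ}
    (hA : 2 ≤ Module.finrank ℂ (LinearMap.ker (Matrix.vecMulLinear A))) (b : Fin N → ℂ) :
    A.cramer b = 0 := by
  ext i
  rw [Matrix.cramer_apply, Pi.zero_apply]
  set K := LinearMap.ker (Matrix.vecMulLinear A)
  let φ : K →ₗ[ℂ] ℂ := ((dotProductBilin ℂ ℂ).flip b).comp K.subtype
  have hφ : 0 < Module.finrank ℂ (LinearMap.ker φ) := by
    have h1 := LinearMap.finrank_range_add_finrank_ker φ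
    have h2 : Module.finrank ℂ (LinearMap.range φ) ≤ 1 := by
      simpa using Submodule.finrank_le (LinearMap.range φ)
    omega
  obtain ⟨v, hv⟩ := Module.finrank_pos_iff_exists_ne_zero.1 hφ
  refine Matrix.exists_vecMul_eq_zero_iff.1 ⟨(v : K), by simpa using hv, ?_⟩
  have hvA : Matrix.vecMul ((v : K) : Fin N → ℂ) A = 0 := (v : K).2
  have hvb : ((v : K) : Fin N → ℂ) ⬝ᵥ b = 0 := v.2
  ext j
  by_cases hj : j = i
  · subst hj
    simpa [Matrix.vecMul] using hvb
  · have := congrFun hvA j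
    simpa [Matrix.vecMul, dotProduct, hj] using this

/-- Corank three would make the determinant divisible by `τ ^ 3`, against its exact order two. -/
theorem finrank_ker_lt_three {M : ℂ → Matrix (Fin N) (Fin N) ℂ}
    (hM : ∀ i j, DifferentiableAt ℂ (fun τ => M τ i j) 0) {u : ℂ → ℂ} (hu : ContinuousAt u 0)
    (hu0 : u 0 ≠ 0) (hdet : ∀ᶠ τ in 𝓝 (0 : ℂ), (M τ).det = τ ^ 2 * u τ) :
    Module.finrank ℂ (LinearMap.ker (Matrix.vecMulLinear (M 0))) ≤ 2 := by
  by_contra! hlt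
  obtain ⟨h, hc, hh⟩ := exists_det_eq_pow_mul hM (k := 3) hlt
  apply hu0
  have h1 : Tendsto (fun τ : ℂ => τ * h τ) (𝓝[≠] 0) (𝓝 0) := by
    have := (continuousAt_id.mul hc).tendsto
    simp only [id, zero_mul, Pi.mul_apply] at this
    exact this.mono_left nhdsWithin_le_nhds
  refine tendsto_nhds_unique (hu.tendsto.mono_left nhdsWithin_le_nhds) (h1.congr' ?_)
  filter_upwards [self_mem_nhdsWithin, hdet.filter_mono nhdsWithin_le_nhds] with τ hτ h2
  have hτ' : τ ≠ 0 := hτ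
  rw [hh] at h2
  have : τ ^ 2 ≠ 0 := pow_ne_zero _ hτ'
  refine mul_left_cancel₀ this ?_
  linear_combination h2

theorem ker_vecMulLinear_toMatrix₂' (B : (Fin N → ℂ) →ₗ[ℂ] (Fin N → ℂ) →ₗ[ℂ] ℂ) :
    LinearMap.ker (Matrix.vecMulLinear (LinearMap.toMatrix₂' ℂ B)) = LinearMap.ker B := by
  ext v
  simp [LinearMap.mem_ker, vecMul_toMatrix₂'_eq_zero_iff]

end OrderOfVanishing

end SingSymp

namespace SingSymp

/-! ### Pencils of degenerate alternating forms -/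

section Degeneracy

variable {V : Type*} [AddCommGroup V] [Module ℂ V]

/-- Two degenerate alternating forms on an even dimensional space which agree on a hyperplane span
a pencil of degenerate forms. -/
theorem two_le_finrank_ker_pencil [FiniteDimensional ℂ V] {B₀ B₁ : V →ₗ[ℂ] V →ₗ[ℂ] ℂ}
    (hB₀ : ∀ a, B₀ a a = 0) (hB₁ : ∀ a, B₁ a a = 0) {n : ℕ}
    (hV : Module.finrank ℂ V = 2 * n) {ℓ : V →ₗ[ℂ] ℂ} {e : V} (he : ℓ e = 1)
    (hagree : ∀ a b, ℓ a = 0 → ℓ b = 0 → B₀ a b = B₁ a b)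
    (hd₀ : LinearMap.ker B₀ ≠ ⊥) (hd₁ : LinearMap.ker B₁ ≠ ⊥) (t : ℂ) :
    2 ≤ Module.finrank ℂ (LinearMap.ker (B₀ + t • (B₁ - B₀))) := by
  have hex : ∀ B : V →ₗ[ℂ] V →ₗ[ℂ] ℂ, (∀ a, B a a = 0) → LinearMap.ker B ≠ ⊥ →
      ∃ r, r ≠ 0 ∧ B r = 0 ∧ ℓ r = 0 := by
    intro B hB hd
    have h2 := two_le_finrank_ker hB hV hd
    have h1 := LinearMap.finrank_range_add_finrank_ker (ℓ.comp (LinearMap.ker B).subtype)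
    have h3 : Module.finrank ℂ (LinearMap.range (ℓ.comp (LinearMap.ker B).subtype)) ≤ 1 := by
      simpa using Submodule.finrank_le (LinearMap.range (ℓ.comp (LinearMap.ker B).subtype))
    have h4 : 0 < Module.finrank ℂ (LinearMap.ker (ℓ.comp (LinearMap.ker B).subtype)) := by omega
    obtain ⟨v, hv⟩ := Module.finrank_pos_iff_exists_ne_zero.1 h4
    exact ⟨(v : LinearMap.ker B), by simpa using hv, (v : LinearMap.ker B).2, v.2⟩
  obtain ⟨r₀, hr₀, hk₀, hℓ₀⟩ := hex B₀ hB₀ hd₀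
  obtain ⟨r₁, hr₁, hk₁, hℓ₁⟩ := hex B₁ hB₁ hd₁
  set Bt := B₀ + t • (B₁ - B₀) with hBt
  have happ : ∀ a b, Bt a b = B₀ a b + t * (B₁ a b - B₀ a b) := fun a b => by simp [hBt]
  have halt : ∀ a, Bt a a = 0 := fun a => by simp [happ, hB₀, hB₁]
  refine two_le_finrank_ker halt hV ?_
  have hz₀ : ∀ b, ℓ b = 0 → Bt r₀ b = 0 := by
    intro b hb
    rw [happ, ← hagree _ _ hℓ₀ hb, hk₀]
    simp
  have hz₁ : ∀ b, ℓ b = 0 → Bt r₁ b = 0 := by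
    intro b hb
    rw [happ, hagree _ _ hℓ₁ hb, hk₁]
    simp
  suffices h : ∃ r, r ≠ 0 ∧ Bt r = 0 by
    obtain ⟨r, hr, hr0⟩ := h
    intro hbot
    exact hr ((Submodule.eq_bot_iff _).1 hbot r hr0)
  have hfull : ∀ r, (∀ b, ℓ b = 0 → Bt r b = 0) → Bt r e = 0 → Bt r = 0 := by
    intro r h1 h2
    ext v
    have : v = (v - ℓ v • e) + ℓ v • e := by abel
    rw [this, map_add, map_smul, h2, h1 _ (by simp [he])]
    simp
  -- Each kernel, having dimension at least two, has supplied a vector `r₀` or `r₁` in the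
  -- hyperplane. The functionals `Bt r₀` and `Bt r₁` vanish on the hyperplane, so they are multiples
  -- of `ℓ` and a linear combination of the vectors is killed. If that combination is itself zero,
  -- `r₁` is a multiple of `r₀` and lies in both kernels.
  by_cases ha : Bt r₀ e = 0
  · exact ⟨r₀, hr₀, hfull _ hz₀ ha⟩
  by_cases hr : Bt r₁ e • r₀ - Bt r₀ e • r₁ = 0
  · have h1 : r₁ = ((Bt r₀ e)⁻¹ * Bt r₁ e) • r₀ := by
      rw [sub_eq_zero] at hr
      rw [mul_smul, hr, smul_smul, inv_mul_cancel₀ ha, one_smul]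
    refine ⟨r₁, hr₁, ?_⟩
    have h2 : B₀ r₁ = 0 := by rw [h1, map_smul, hk₀, smul_zero]
    ext v
    rw [happ, h2, hk₁]
    simp
  · refine ⟨_, hr, hfull _ (fun b hb => ?_) ?_⟩
    · simp [hz₀ b hb, hz₁ b hb]
    · simp only [map_sub, map_smul, LinearMap.sub_apply, LinearMap.smul_apply, smul_eq_mul]
      ring

end Degeneracy

/-! ### Gram matrices and Cramer vectors depending analytically on parameters -/

section Matrices

variable {N : ℕ}

/-- The Gram matrix of a continuous bilinear form in the standard basis. -/
noncomputable def gramMatrix (B : (Fin N → ℂ) →L[ℂ] (Fin N → ℂ) →L[ℂ] ℂ) : Matrix (Fin N) (Fin N) ℂ :=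
  LinearMap.toMatrix₂' ℂ B.toLinearMap₁₂

theorem gramMatrix_apply (B : (Fin N → ℂ) →L[ℂ] (Fin N → ℂ) →L[ℂ] ℂ) (i j : Fin N) :
    gramMatrix B i j = B (Pi.single i 1) (Pi.single j 1) := by
  simp [gramMatrix, LinearMap.toMatrix₂'_apply]

theorem ker_vecMulLinear_gramMatrix (B : (Fin N → ℂ) →L[ℂ] (Fin N → ℂ) →L[ℂ] ℂ) :
    LinearMap.ker (Matrix.vecMulLinear (gramMatrix B)) = LinearMap.ker B.toLinearMap₁₂ :=
  ker_vecMulLinear_toMatrix₂' _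

theorem gramMatrix_mulVec (B : (Fin N → ℂ) →L[ℂ] (Fin N → ℂ) →L[ℂ] ℂ) (X : Fin N → ℂ)
    (i : Fin N) : (gramMatrix B).mulVec X i = B (Pi.single i 1) X := by
  conv_rhs => rw [pi_eq_sum_univ' X]
  simp [Matrix.mulVec, dotProduct, gramMatrix_apply, mul_comm]

variable {F : Type*} [NormedAddCommGroup F] [NormedSpace ℂ F]

theorem analyticAt_gramMatrix {W : F → (Fin N → ℂ) →L[ℂ] (Fin N → ℂ) →L[ℂ] ℂ} {p : F}
    (hW : AnalyticAt ℂ W p) (i j : Fin N) : AnalyticAt ℂ (fun v => gramMatrix (W v) i j) p := by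
  simp only [gramMatrix_apply]
  have h1 : AnalyticAt ℂ (fun v => W v (Pi.single i 1)) p :=
    AnalyticAt.comp (g := ContinuousLinearMap.apply ℂ ((Fin N → ℂ) →L[ℂ] ℂ) (Pi.single i 1))
      (ContinuousLinearMap.analyticAt _ _) hW
  exact ((ContinuousLinearMap.apply ℂ ℂ (Pi.single j 1)).analyticAt _).comp h1

theorem analyticAt_det {M : F → Matrix (Fin N) (Fin N) ℂ} {p : F}
    (hM : ∀ i j, AnalyticAt ℂ (fun v => M v i j) p) : AnalyticAt ℂ (fun v => (M v).det) p := by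
  simp only [Matrix.det_apply]
  refine Finset.analyticAt_fun_sum _ fun σ _ => ?_
  have h : AnalyticAt ℂ (fun v => ∏ i, M v (σ i) i) p :=
    Finset.analyticAt_fun_prod _ fun i _ => hM _ _
  rcases Int.units_eq_one_or (Equiv.Perm.sign σ) with hs | hs
  · simpa [hs] using h
  · simp only [hs, Units.neg_smul, one_smul]
    exact h.neg

theorem analyticAt_updateCol {M : F → Matrix (Fin N) (Fin N) ℂ} {b : F → Fin N → ℂ} {p : F}
    (hM : ∀ i j, AnalyticAt ℂ (fun v => M v i j) p)
    (hb : ∀ i, AnalyticAt ℂ (fun v => b v i) p) (k i j : Fin N) :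
    AnalyticAt ℂ (fun v => (M v).updateCol k (b v) i j) p := by
  by_cases hj : j = k
  · subst hj
    simpa using hb i
  · simpa [hj] using hM i j

theorem analyticAt_cramer {M : F → Matrix (Fin N) (Fin N) ℂ} {b : F → Fin N → ℂ} {p : F}
    (hM : ∀ i j, AnalyticAt ℂ (fun v => M v i j) p)
    (hb : ∀ i, AnalyticAt ℂ (fun v => b v i) p) :
    AnalyticAt ℂ (fun v => (M v).cramer (b v)) p := by
  rw [analyticAt_pi_iff]
  intro i
  simp only [Matrix.cramer_apply]
  exact analyticAt_det fun k j => analyticAt_updateCol hM hb i k j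

/-- The directional derivative of a determinant vanishes where the matrix has corank two. -/
theorem fderiv_det_eq_zero {M : F → Matrix (Fin N) (Fin N) ℂ} {p : F}
    (hM : ∀ i j, AnalyticAt ℂ (fun v => M v i j) p)
    (hk : 2 ≤ Module.finrank ℂ (LinearMap.ker (Matrix.vecMulLinear (M p)))) (w : F) :
    fderiv ℂ (fun v => (M v).det) p w = 0 := by
  have hline : HasDerivAt (fun τ : ℂ => p + τ • w) w 0 := by
    simpa using ((hasDerivAt_id (0 : ℂ)).smul_const w).const_add p
  have hp : p + (0 : ℂ) • w = p := by simp
  have hM' : ∀ i j, DifferentiableAt ℂ (fun τ : ℂ => M (p + τ • w) i j) 0 := by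
    intro i j
    have h1 : DifferentiableAt ℂ (fun v => M v i j) (p + (0 : ℂ) • w) := by
      rw [hp]; exact (hM i j).differentiableAt
    exact h1.comp (0 : ℂ) hline.differentiableAt
  have h1 := hasDerivAt_det_of_two_le hM' (by rwa [hp])
  have h2 : HasFDerivAt (fun v => (M v).det) (fderiv ℂ (fun v => (M v).det) p)
      (p + (0 : ℂ) • w) := by
    rw [hp]; exact (analyticAt_det hM).differentiableAt.hasFDerivAt
  exact HasDerivAt.unique (h2.comp_hasDerivAt (0 : ℂ) hline) (f := fun τ => (M (p + τ • w)).det) h1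

end Matrices

end SingSymp

/-! ### One step of the homotopy method -/

section MoserStep

variable {E : Type*} [NormedAddCommGroup E] [NormedSpace ℂ E]

/-- The `2`-form `B + ds ∧ γ` on `ℂ × E`. -/
noncomputable def extForm (E : Type*) [NormedAddCommGroup E] [NormedSpace ℂ E] :
    ((E →L[ℂ] E →L[ℂ] ℂ) × (E →L[ℂ] ℂ)) →L[ℂ] ((ℂ × E) →L[ℂ] (ℂ × E) →L[ℂ] ℂ) :=
  let pullSnd : (E →L[ℂ] ℂ) →L[ℂ] ((ℂ × E) →L[ℂ] ℂ) :=
    (ContinuousLinearMap.compL ℂ (ℂ × E) E ℂ).flip (.snd ℂ ℂ E)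
  let wedgeFst : ((ℂ × E) →L[ℂ] ℂ) →L[ℂ] ((ℂ × E) →L[ℂ] (ℂ × E) →L[ℂ] ℂ) :=
    ContinuousLinearMap.smulRightL ℂ (ℂ × E) ((ℂ × E) →L[ℂ] ℂ) (.fst ℂ ℂ E)
  (((ContinuousLinearMap.compL ℂ (ℂ × E) E ((ℂ × E) →L[ℂ] ℂ)).flip (.snd ℂ ℂ E)).comp
    (ContinuousLinearMap.compL ℂ E (E →L[ℂ] ℂ) ((ℂ × E) →L[ℂ] ℂ) pullSnd)).comp
      (.fst ℂ _ _) +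
  ((wedgeFst - (ContinuousLinearMap.flipₗᵢ ℂ (ℂ × E) (ℂ × E) ℂ
    ).toContinuousLinearEquiv.toContinuousLinearMap.comp wedgeFst).comp pullSnd).comp (.snd ℂ _ _)

theorem extForm_apply (B : E →L[ℂ] E →L[ℂ] ℂ) (γ : E →L[ℂ] ℂ) (v w : ℂ × E) :
    extForm E (B, γ) v w = B v.2 w.2 + (v.1 * γ w.2 - w.1 * γ v.2) := by
  simp [extForm]

variable {σ δ : E → E →L[ℂ] E →L[ℂ] ℂ} {α : E → E →L[ℂ] ℂ}

theorem hasFDerivAt_pencil {v : ℂ × E} (hσ : DifferentiableAt ℂ σ v.2)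
    (hδ : DifferentiableAt ℂ δ v.2) :
    HasFDerivAt (fun v : ℂ × E => σ v.2 + v.1 • δ v.2)
      ((fderiv ℂ σ v.2).comp (.snd ℂ ℂ E) + (v.1 • (fderiv ℂ δ v.2).comp (.snd ℂ ℂ E) +
        (ContinuousLinearMap.fst ℂ ℂ E).smulRight (δ v.2))) v := by
  have h1 : HasFDerivAt (fun v : ℂ × E => σ v.2) ((fderiv ℂ σ v.2).comp (.snd ℂ ℂ E)) v :=
    hσ.hasFDerivAt.comp v hasFDerivAt_snd
  have h2 : HasFDerivAt (fun v : ℂ × E => δ v.2) ((fderiv ℂ δ v.2).comp (.snd ℂ ℂ E)) v :=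
    hδ.hasFDerivAt.comp v hasFDerivAt_snd
  exact h1.add ((hasFDerivAt_fst (𝕜 := ℂ) (p := v)).smul h2)

/-- One step of Moser's homotopy method: if `ω_t = σ + t δ` with `δ = dα` and the vector field
`X_t`, vanishing at the origin, satisfies `X_t ⌟ ω_t = -α`, then the forms `ω_t` with `t` close to
`t₀` are equivalent to `ω_{t₀}`. -/
theorem moser_step [CompleteSpace E] (hσ : AnalyticAt ℂ σ 0) (hδ : AnalyticAt ℂ δ 0)
    (hα : AnalyticAt ℂ α 0) (haltσ : ∀ z a, σ z a a = 0) (haltδ : ∀ z a, δ z a a = 0)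
    (hcσ : ∀ᶠ z in 𝓝 0, ∀ a b c,
      fderiv ℂ σ z a b c + fderiv ℂ σ z b c a + fderiv ℂ σ z c a b = 0)
    (hcδ : ∀ᶠ z in 𝓝 0, ∀ a b c,
      fderiv ℂ δ z a b c + fderiv ℂ δ z b c a + fderiv ℂ δ z c a b = 0)
    (hdα : ∀ᶠ z in 𝓝 0, ∀ a b, fderiv ℂ α z a b - fderiv ℂ α z b a = δ z a b)
    {X : ℂ × E → E} {t₀ : ℂ} (hX : AnalyticAt ℂ X (t₀, 0))
    (hXα : ∀ᶠ v in 𝓝 (t₀, (0 : E)), ∀ b, (σ v.2 + v.1 • δ v.2) (X v) b = - α v.2 b)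
    (hX0 : ∀ᶠ t in 𝓝 t₀, X (t, 0) = 0) :
    ∀ᶠ τ in 𝓝 (0 : ℂ), ∃ ψ : E → E, AnalyticAt ℂ ψ 0 ∧ ψ 0 = 0 ∧ (fderiv ℂ ψ 0).IsInvertible ∧
      ∀ᶠ z in 𝓝 0, ∀ a b, (σ (ψ z) + (t₀ + τ) • δ (ψ z)) (fderiv ℂ ψ z a) (fderiv ℂ ψ z b) =
        (σ z + t₀ • δ z) a b := by
  set p : ℂ × E := (t₀, 0) with hp
  have hsnd : Tendsto (fun v : ℂ × E => v.2) (𝓝 p) (𝓝 0) := continuous_snd.tendsto' _ _ rfl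
  -- Time becomes a coordinate, which makes the field autonomous. The form `σ + t δ + dt ∧ α` is
  -- closed because `d(dt ∧ α) = -dt ∧ δ` cancels `dt ∧ δ`, and the equation for `X` says that `(1,
  -- X)` annihilates it.
  let Ω : ℂ × E → (ℂ × E) →L[ℂ] (ℂ × E) →L[ℂ] ℂ := fun v =>
    extForm E (σ v.2 + v.1 • δ v.2, α v.2)
  have hσ' : AnalyticAt ℂ (fun v : ℂ × E => σ v.2) p :=
    AnalyticAt.comp (g := σ) (f := fun v : ℂ × E => v.2) hσ analyticAt_snd
  have hδ' : AnalyticAt ℂ (fun v : ℂ × E => δ v.2) p :=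
    AnalyticAt.comp (g := δ) (f := fun v : ℂ × E => v.2) hδ analyticAt_snd
  have hα' : AnalyticAt ℂ (fun v : ℂ × E => α v.2) p :=
    AnalyticAt.comp (g := α) (f := fun v : ℂ × E => v.2) hα analyticAt_snd
  have hΩ : AnalyticAt ℂ Ω p :=
    ((extForm E).analyticAt _).comp ((hσ'.add (analyticAt_fst.smul hδ')).prod hα')
  have hskewσ := fun z => apply_eq_neg_of_alternating (haltσ z)
  have hskewδ := fun z => apply_eq_neg_of_alternating (haltδ z)
  have haltΩ : ∀ v a, Ω v a a = 0 := by
    intro v a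
    simp [Ω, extForm_apply, haltσ, haltδ]
  have hcΩ : ∀ᶠ v in 𝓝 p, ∀ a b c,
      fderiv ℂ Ω v a b c + fderiv ℂ Ω v b c a + fderiv ℂ Ω v c a b = 0 := by
    filter_upwards [hsnd.eventually hσ.eventually_analyticAt,
      hsnd.eventually hδ.eventually_analyticAt, hsnd.eventually hα.eventually_analyticAt,
      hsnd.eventually hcσ, hsnd.eventually hcδ, hsnd.eventually hdα] with v h1 h2 h3 h4 h5 h6 a b c
    have e1 := hasFDerivAt_pencil h1.differentiableAt h2.differentiableAt
    have e2 : HasFDerivAt (fun v : ℂ × E => α v.2) ((fderiv ℂ α v.2).comp (.snd ℂ ℂ E)) v :=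
      h3.differentiableAt.hasFDerivAt.comp v hasFDerivAt_snd
    have e3 : HasFDerivAt Ω _ v := (extForm E).hasFDerivAt.comp v (e1.prodMk e2)
    have e4 : ∀ a b c, fderiv ℂ Ω v a b c =
        (fderiv ℂ σ v.2 a.2 b.2 c.2 + (v.1 * fderiv ℂ δ v.2 a.2 b.2 c.2 + a.1 * δ v.2 b.2 c.2)) +
        (b.1 * fderiv ℂ α v.2 a.2 c.2 - c.1 * fderiv ℂ α v.2 a.2 b.2) := by
      intro a b c
      rw [e3.fderiv, ContinuousLinearMap.comp_apply, ContinuousLinearMap.prod_apply,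
        extForm_apply]
      simp
    rw [e4, e4, e4]
    linear_combination h4 a.2 b.2 c.2 + v.1 * h5 a.2 b.2 c.2 - a.1 * h6 b.2 c.2 -
      b.1 * h6 c.2 a.2 - c.1 * h6 a.2 b.2
  let Z : ℂ × E → ℂ × E := fun v => (1, X v)
  have hZ : AnalyticAt ℂ Z p := analyticAt_const.prod hX
  have hann : ∀ᶠ v in 𝓝 p, ∀ b, Ω v (Z v) b = 0 := by
    filter_upwards [hXα] with v hv b
    have h1 := hv b.2
    -- Evaluating the equation for `X` on `X` itself gives zero on the left.
    have h2 : α v.2 (X v) = 0 := by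
      have := hv (X v)
      simp only [add_apply, smul_apply, haltσ, haltδ] at this
      simpa using this.symm
    simp only [Ω, Z, extForm_apply]
    rw [h1, h2]
    ring
  obtain ⟨Φ, hΦ, hΦ0, hflow, hfix⟩ := hZ.exists_flow
  have hpres := eventually_flow_preserves hΩ hZ haltΩ hcΩ hann hΦ hΦ0 hflow
  -- the flow translates the time coordinate
  have htime : ∀ᶠ v in 𝓝 ((0 : ℂ), p), (Φ v).1 = v.2.1 + v.1 := by
    have key : ∀ᶠ v in 𝓝 ((0 : ℂ), p), HasDerivAt (fun τ : ℂ => (Φ (τ, v.2)).1 - τ) 0 v.1 := by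
      filter_upwards [hΦ.eventually_analyticAt, hflow] with v h1 h2
      have d1 : HasDerivAt (fun τ : ℂ => Φ (τ, v.2)) (Z (Φ v)) v.1 := by
        rw [← h2]
        exact h1.differentiableAt.hasFDerivAt.comp_hasDerivAt v.1
          ((hasDerivAt_id v.1).prodMk (hasDerivAt_const v.1 v.2))
      have d2 : HasDerivAt (fun τ : ℂ => (Φ (τ, v.2)).1) 1 v.1 := by
        have := (ContinuousLinearMap.fst ℂ ℂ E).hasFDerivAt.comp_hasDerivAt v.1 d1
        exact this
      simpa using d2.fun_sub (hasDerivAt_id' v.1)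
    obtain ⟨ε, hε, hkey⟩ := Metric.eventually_nhds_iff.1 key
    obtain ⟨ε', hε', hst⟩ := Metric.eventually_nhds_iff.1 hΦ0
    filter_upwards [Metric.ball_mem_nhds ((0 : ℂ), p) hε, Metric.ball_mem_nhds ((0 : ℂ), p) hε']
      with v hv hv'
    rw [Metric.mem_ball, Prod.dist_eq, max_lt_iff] at hv hv'
    have hd : ∀ τ ∈ Metric.ball (0 : ℂ) ε, HasDerivAt (fun τ : ℂ => (Φ (τ, v.2)).1 - τ) 0 τ := by
      intro τ hτ
      exact hkey (y := (τ, v.2)) (by rw [Prod.dist_eq]; exact max_lt hτ hv.2)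
    have := Metric.isOpen_ball.is_const_of_deriv_eq_zero
      (convex_ball (0 : ℂ) ε).isPreconnected
      (fun τ hτ => (hd τ hτ).differentiableAt.differentiableWithinAt)
      (fun τ hτ => (hd τ hτ).deriv) (x := v.1) (y := 0) hv.1 (Metric.mem_ball_self hε)
    rw [hst (y := v.2) hv'.2, sub_zero] at this
    linear_combination this
  -- `X` vanishes along the time axis, so the flow line through the origin is straight and `ψ` fixes
  -- the origin.
  have hfix' : ∀ᶠ τ in 𝓝 (0 : ℂ), Φ (τ, p) = p + τ • ((1 : ℂ), (0 : E)) := by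
    refine hfix _ ?_
    have : Tendsto (fun τ : ℂ => t₀ + τ) (𝓝 0) (𝓝 t₀) :=
      (continuous_const.add continuous_id).tendsto' _ _ (by simp)
    filter_upwards [this.eventually hX0] with τ hτ
    simp only [Z, hp, Prod.smul_mk, smul_eq_mul, mul_one, smul_zero, Prod.mk_add_mk, add_zero, hτ]
  let ι : ℂ × E → ℂ × (ℂ × E) := fun v => (v.1, (t₀, v.2))
  have hι : ∀ v, HasFDerivAt ι ((ContinuousLinearMap.fst ℂ ℂ E).prod
      ((0 : (ℂ × E) →L[ℂ] ℂ).prod (.snd ℂ ℂ E))) v := fun v =>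
    hasFDerivAt_fst.prodMk ((hasFDerivAt_const t₀ v).prodMk hasFDerivAt_snd)
  have hιc : Tendsto ι (𝓝 ((0 : ℂ), (0 : E))) (𝓝 ((0 : ℂ), p)) := (hι (0, 0)).continuousAt.tendsto
  let ψ : ℂ → E → E := fun τ z => (Φ (τ, (t₀, z))).2
  let D : ℂ × E → E →L[ℂ] E := fun v => (ContinuousLinearMap.snd ℂ ℂ E).comp
    ((fderiv ℂ Φ (ι v)).comp ((ContinuousLinearMap.inr ℂ ℂ (ℂ × E)).comp (.inr ℂ ℂ E)))
  have hψd : ∀ᶠ v in 𝓝 ((0 : ℂ), (0 : E)), HasFDerivAt (ψ v.1) (D v) v.2 := by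
    filter_upwards [hιc.eventually hΦ.eventually_analyticAt] with v h1
    have e1 : HasFDerivAt (fun z : E => ((v.1, (t₀, z)) : ℂ × (ℂ × E)))
        ((ContinuousLinearMap.inr ℂ ℂ (ℂ × E)).comp (.inr ℂ ℂ E)) v.2 :=
      (hasFDerivAt_prodMk_right v.1 ((t₀, v.2) : ℂ × E)).comp v.2 (hasFDerivAt_prodMk_right t₀ v.2)
    have e2 : HasFDerivAt (fun z : E => Φ (v.1, (t₀, z))) ((fderiv ℂ Φ (ι v)).comp
        ((ContinuousLinearMap.inr ℂ ℂ (ℂ × E)).comp (.inr ℂ ℂ E))) v.2 :=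
      HasFDerivAt.comp v.2 (g := Φ) h1.differentiableAt.hasFDerivAt e1
    exact hasFDerivAt_snd.comp v.2 e2
  have hDc : ContinuousAt D (0, 0) := by
    have e1 : ContinuousAt (fun v => fderiv ℂ Φ (ι v)) ((0 : ℂ), (0 : E)) :=
      ContinuousAt.comp (g := fderiv ℂ Φ) (f := ι) hΦ.fderiv.continuousAt
        (hι (0, 0)).continuousAt
    exact continuousAt_const.clm_comp (e1.clm_comp continuousAt_const)
  have hD0 : D (0, 0) = ContinuousLinearMap.id ℂ E := by
    have e1 := hψd.self_of_nhds
    refine e1.unique ((hasFDerivAt_id (0 : E)).congr_of_eventuallyEq ?_)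
    have : Tendsto (fun z : E => (t₀, z)) (𝓝 0) (𝓝 p) :=
      (continuous_const.prodMk continuous_id).tendsto' _ _ rfl
    filter_upwards [this.eventually hΦ0] with z hz
    simp [ψ, hz]
  have hinv : ∀ᶠ τ in 𝓝 (0 : ℂ), (D (τ, 0)).IsInvertible := by
    have e1 : Tendsto (fun τ : ℂ => D (τ, 0)) (𝓝 0) (𝓝 (ContinuousLinearMap.id ℂ E)) := by
      rw [← hD0]
      exact ContinuousAt.comp (g := D) (f := fun τ : ℂ => (τ, (0 : E))) hDc
        (by fun_prop)
    have e2 := (ContinuousLinearEquiv.refl ℂ E).nhds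
    exact e1.eventually e2
  have hlift : Tendsto (fun τ : ℂ => (τ, (0 : E))) (𝓝 0) (𝓝 (0, 0)) :=
    (continuous_id.prodMk continuous_const).tendsto' _ _ rfl
  have hall : ∀ᶠ v in 𝓝 ((0 : ℂ), (0 : E)), HasFDerivAt (ψ v.1) (D v) v.2 ∧
      AnalyticAt ℂ Φ (ι v) ∧ (∀ᶠ u in 𝓝 (ι v), (Φ u).1 = u.2.1 + u.1) ∧
      ∀ a b, Ω (Φ (ι v)) (fderiv ℂ Φ (ι v) (0, a)) (fderiv ℂ Φ (ι v) (0, b)) =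
        Ω (ι v).2 a b :=
    hψd.and ((hιc.eventually hΦ.eventually_analyticAt).and
      ((hιc.eventually htime.eventually_nhds).and (hιc.eventually hpres)))
  filter_upwards [hlift.eventually hall.eventually_nhds, hinv, hfix'] with τ h1 h2 h3
  have h10 := h1.self_of_nhds
  have hz : ∀ᶠ z in 𝓝 (0 : E), HasFDerivAt (ψ τ) (D (τ, z)) z ∧
      AnalyticAt ℂ Φ (ι (τ, z)) ∧ (∀ᶠ u in 𝓝 (ι (τ, z)), (Φ u).1 = u.2.1 + u.1) ∧
      ∀ a b, Ω (Φ (ι (τ, z))) (fderiv ℂ Φ (ι (τ, z)) (0, a)) (fderiv ℂ Φ (ι (τ, z)) (0, b)) =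
        Ω (ι (τ, z)).2 a b := by
    have : Tendsto (fun z : E => (τ, z)) (𝓝 0) (𝓝 (τ, 0)) :=
      (continuous_const.prodMk continuous_id).tendsto' _ _ rfl
    exact this.eventually h1
  refine ⟨ψ τ, ?_, ?_, ?_, ?_⟩
  · have e1 : AnalyticAt ℂ (fun z : E => ((τ, (t₀, z)) : ℂ × (ℂ × E))) 0 :=
      analyticAt_const.prod (analyticAt_const.prod analyticAt_id)
    have e2 : AnalyticAt ℂ (fun z : E => Φ (τ, (t₀, z))) 0 :=
      AnalyticAt.comp (g := Φ) (f := fun z : E => ((τ, (t₀, z)) : ℂ × (ℂ × E))) h10.2.1 e1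
    exact analyticAt_snd.comp e2
  · change (Φ (τ, p)).2 = 0
    rw [h3]
    simp [hp]
  · rw [h10.1.fderiv]
    exact h2
  · filter_upwards [hz] with z hz a b
    obtain ⟨k1, k2, k3, k4⟩ := hz
    -- All points are shifted by the same time `τ`, so vectors tangent to a time slice stay tangent
    -- to slices and the term `dt ∧ α` drops out.
    have k5 : ∀ a : E, fderiv ℂ Φ (ι (τ, z)) (0, (0, a)) = (0, D (τ, z) a) := by
      intro a
      refine Prod.ext ?_ rfl
      have e1 : HasFDerivAt (fun u => (Φ u).1) _ (ι (τ, z)) :=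
        hasFDerivAt_fst.comp _ k2.differentiableAt.hasFDerivAt
      have e2 : HasFDerivAt (fun u : ℂ × (ℂ × E) => u.2.1 + u.1) _ (ι (τ, z)) :=
        ((ContinuousLinearMap.fst ℂ ℂ E).comp (ContinuousLinearMap.snd ℂ ℂ (ℂ × E)) +
          ContinuousLinearMap.fst ℂ ℂ (ℂ × E)).hasFDerivAt
      have := congrArg (fun L => L (0, (0, a))) (e1.unique (e2.congr_of_eventuallyEq k3))
      simpa using this
    have k6 := k4 (0, a) (0, b)
    rw [k5, k5] at k6
    have k7 : (Φ (ι (τ, z))).1 = t₀ + τ := k3.self_of_nhds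
    simp only [Ω, extForm_apply, zero_mul, sub_zero, add_zero] at k6
    rw [k7] at k6
    rw [k1.fderiv]
    exact k6

end MoserStep

/-! ### Division by a linear form and by its square -/

section Division

variable {E F : Type*} [NormedAddCommGroup E] [NormedSpace ℂ E] [NormedAddCommGroup F]
  [NormedSpace ℂ F] [CompleteSpace F]

/-- Division by a linear form of an analytic map vanishing on its kernel. -/
theorem exists_eq_smul_of_ker {ℓ : E →L[ℂ] ℂ} {e : E} (he : ℓ e = 1) {f : E → F} {P : Set E}
    (hf : ∀ p ∈ P, AnalyticAt ℂ f p) (hP : ∀ p ∈ P, ℓ p = 0)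
    (hz : ∀ p ∈ P, ∀ᶠ z in 𝓝 p, ℓ z = 0 → f z = 0) :
    ∃ g : E → F, (∀ p ∈ P, AnalyticAt ℂ g p) ∧ (∀ z, ℓ z = 0 → g z = fderiv ℂ f z e) ∧
      ∀ p ∈ P, ∀ᶠ z in 𝓝 p, f z = ℓ z • g z := by
  refine ⟨dilationAverage ℓ e (fun z => fderiv ℂ f z e), fun p hp => ?_, fun z h0 => ?_,
    fun p hp => (hf p hp).eventually_eq_smul_dilationAverage he (hP p hp) (hz p hp)⟩
  · refine AnalyticAt.dilationAverage ?_ (hP p hp)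
    exact ((ContinuousLinearMap.apply ℂ F e).analyticAt _).comp (hf p hp).fderiv
  · exact dilationAverage_of_ker h0 _

/-- Division by the square of a linear form. -/
theorem exists_eq_sq_smul_of_ker {ℓ : E →L[ℂ] ℂ} {e : E} (he : ℓ e = 1) {f : E → F} {P : Set E}
    (hf : ∀ p ∈ P, AnalyticAt ℂ f p) (hP : ∀ p ∈ P, ℓ p = 0)
    (hz : ∀ p ∈ P, ∀ᶠ z in 𝓝 p, ℓ z = 0 → f z = 0 ∧ fderiv ℂ f z e = 0) :
    ∃ g : E → F, (∀ p ∈ P, AnalyticAt ℂ g p) ∧ ∀ p ∈ P, ∀ᶠ z in 𝓝 p, f z = ℓ z ^ 2 • g z := by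
  obtain ⟨g₁, h1, h2, h3⟩ := exists_eq_smul_of_ker he hf hP
    (fun p hp => (hz p hp).mono fun z h h0 => (h h0).1)
  -- On the hyperplane the first quotient equals the transversal derivative of `f`, so the second
  -- vanishing condition permits another division.
  obtain ⟨g, k1, -, k3⟩ := exists_eq_smul_of_ker he h1 hP
    (fun p hp => (hz p hp).mono fun z h h0 => by rw [h2 z h0]; exact (h h0).2)
  refine ⟨g, k1, fun p hp => ?_⟩
  filter_upwards [h3 p hp, k3 p hp] with z e1 e2
  rw [e1, e2, smul_smul, sq]

/-- Cancellation of the square of a linear form. -/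
theorem eventually_eq_of_sq_smul_eq_sq_smul {E F : Type*} [NormedAddCommGroup E] [NormedSpace ℂ E]
    [NormedAddCommGroup F] [NormedSpace ℂ F] {ℓ : E →L[ℂ] ℂ} {e : E} (he : ℓ e = 1) {g₁ g₂ : E → F}
    {x₀ : E} (hg₁ : ∀ᶠ z in 𝓝 x₀, ContinuousAt g₁ z) (hg₂ : ∀ᶠ z in 𝓝 x₀, ContinuousAt g₂ z)
    (h : ∀ᶠ z in 𝓝 x₀, ℓ z ^ 2 • g₁ z = ℓ z ^ 2 • g₂ z) : ∀ᶠ z in 𝓝 x₀, g₁ z = g₂ z := by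
  refine eventually_eq_of_smul_eq_smul he hg₁ hg₂ ?_
  refine eventually_eq_of_smul_eq_smul he (hg₁.mono fun z hz => ℓ.continuous.continuousAt.smul hz)
    (hg₂.mono fun z hz => ℓ.continuous.continuousAt.smul hz) ?_
  filter_upwards [h] with z hz
  simpa only [smul_smul, ← sq] using hz

end Division

namespace SingSymp

/-! ### The vector field of the homotopy method -/

section MoserField

variable {n : ℕ} {σ₀ σ₁ : (Fin (2 * n) → ℂ) → (Fin (2 * n) → ℂ) →L[ℂ] (Fin (2 * n) → ℂ) →L[ℂ] ℂ}
  {ℓ : (Fin (2 * n) → ℂ) →L[ℂ] ℂ} {e : Fin (2 * n) → ℂ} {u₀ u₁ : (Fin (2 * n) → ℂ) → ℂ}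

theorem ker_ne_bot_of_gramMatrix_det_eq_zero {N : ℕ}
    {B : (Fin N → ℂ) →L[ℂ] (Fin N → ℂ) →L[ℂ] ℂ} (h : (gramMatrix B).det = 0) :
    LinearMap.ker B.toLinearMap₁₂ ≠ ⊥ := by
  intro hbot
  exact ker_eq_bot_iff_gramDet_ne_zero.1 hbot h

theorem two_le_finrank_ker_gramMatrix_pencil
    {B₀ B₁ : (Fin (2 * n) → ℂ) →L[ℂ] (Fin (2 * n) → ℂ) →L[ℂ] ℂ} (halt₀ : ∀ a, B₀ a a = 0)
    (halt₁ : ∀ a, B₁ a a = 0) (he : ℓ e = 1)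
    (hagree : ∀ a b, ℓ a = 0 → ℓ b = 0 → B₀ a b = B₁ a b) (h₀ : (gramMatrix B₀).det = 0)
    (h₁ : (gramMatrix B₁).det = 0) (t : ℂ) : 2 ≤ Module.finrank ℂ
      (LinearMap.ker (Matrix.vecMulLinear (gramMatrix (B₀ + t • (B₁ - B₀))))) := by
  rw [ker_vecMulLinear_gramMatrix]
  have h : (B₀ + t • (B₁ - B₀)).toLinearMap₁₂ =
      B₀.toLinearMap₁₂ + t • (B₁.toLinearMap₁₂ - B₀.toLinearMap₁₂) := rfl
  have h2 := two_le_finrank_ker_pencil (n := n) (ℓ := ℓ.toLinearMap) (e := e)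
    (B₀ := B₀.toLinearMap₁₂) (B₁ := B₁.toLinearMap₁₂) halt₀ halt₁ (by simp) he hagree
    (ker_ne_bot_of_gramMatrix_det_eq_zero h₀) (ker_ne_bot_of_gramMatrix_det_eq_zero h₁) t
  rw [← h] at h2
  exact h2

/-- Along the pencil spanned by two forms with common Martinet hypersurface `ℓ = 0` and common
restriction to it, the square of the Martinet function is divisible by `ℓ ^ 2`. -/
theorem exists_gramMatrix_det_eq_sq_mul (hσ₀ : AnalyticAt ℂ σ₀ 0) (hσ₁ : AnalyticAt ℂ σ₁ 0)
    (halt₀ : ∀ z a, σ₀ z a a = 0) (halt₁ : ∀ z a, σ₁ z a a = 0)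
    (hagree : ∀ᶠ z in 𝓝 0, ℓ z = 0 → ∀ a b, ℓ a = 0 → ℓ b = 0 → σ₀ z a b = σ₁ z a b)
    (he : ℓ e = 1) (hu₀ : AnalyticAt ℂ u₀ 0) (hu₁ : AnalyticAt ℂ u₁ 0)
    (hdet₀ : ∀ᶠ z in 𝓝 0, (gramMatrix (σ₀ z)).det = ℓ z ^ 2 * u₀ z)
    (hdet₁ : ∀ᶠ z in 𝓝 0, (gramMatrix (σ₁ z)).det = ℓ z ^ 2 * u₁ z) :
    ∃ g : ℂ × (Fin (2 * n) → ℂ) → ℂ, (∀ t, AnalyticAt ℂ g (t, 0)) ∧ g (0, 0) = u₀ 0 ∧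
      g (1, 0) = u₁ 0 ∧ ∀ t, ∀ᶠ v in 𝓝 (t, (0 : Fin (2 * n) → ℂ)),
        (gramMatrix (σ₀ v.2 + v.1 • (σ₁ v.2 - σ₀ v.2))).det = ℓ v.2 ^ 2 * g v := by
  set W := fun v : ℂ × (Fin (2 * n) → ℂ) => σ₀ v.2 + v.1 • (σ₁ v.2 - σ₀ v.2) with hW
  have hsnd : ∀ t : ℂ, Tendsto (fun v : ℂ × (Fin (2 * n) → ℂ) => v.2) (𝓝 (t, 0)) (𝓝 0) :=
    fun t => continuous_snd.tendsto' _ _ rfl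
  have hWa : ∀ v : ℂ × (Fin (2 * n) → ℂ), AnalyticAt ℂ σ₀ v.2 → AnalyticAt ℂ σ₁ v.2 →
      AnalyticAt ℂ W v := by
    intro v h0 h1
    have e0 : AnalyticAt ℂ (fun v : ℂ × (Fin (2 * n) → ℂ) => σ₀ v.2) v :=
      AnalyticAt.comp (g := σ₀) (f := fun v : ℂ × (Fin (2 * n) → ℂ) => v.2) h0 analyticAt_snd
    have e1 : AnalyticAt ℂ (fun v : ℂ × (Fin (2 * n) → ℂ) => σ₁ v.2) v :=
      AnalyticAt.comp (g := σ₁) (f := fun v : ℂ × (Fin (2 * n) → ℂ) => v.2) h1 analyticAt_snd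
    exact e0.add (analyticAt_fst.smul (e1.sub e0))
  have hcorank : ∀ᶠ z in 𝓝 (0 : Fin (2 * n) → ℂ), ℓ z = 0 → ∀ t : ℂ,
      2 ≤ Module.finrank ℂ (LinearMap.ker (Matrix.vecMulLinear (gramMatrix (W (t, z))))) := by
    filter_upwards [hagree, hdet₀, hdet₁] with z h1 h2 h3 h0 t
    exact two_le_finrank_ker_gramMatrix_pencil (halt₀ z) (halt₁ z) he (h1 h0) (by simp [h2, h0])
      (by simp [h3, h0]) t
  let L : (ℂ × (Fin (2 * n) → ℂ)) →L[ℂ] ℂ := ℓ.comp (.snd ℂ ℂ _)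
  have hLe : L (0, e) = 1 := by simpa [L] using he
  have hDa : ∀ v, AnalyticAt ℂ W v → AnalyticAt ℂ (fun v => (gramMatrix (W v)).det) v :=
    fun v hv => analyticAt_det (analyticAt_gramMatrix hv)
  -- The division is carried out simultaneously at all points `(t, 0)`, so that one and the same `g`
  -- makes `t ↦ g (t, 0)` entire.
  obtain ⟨g, hg, hDg⟩ := exists_eq_sq_smul_of_ker (ℓ := L) hLe
    (f := fun v => (gramMatrix (W v)).det) (P := Set.range fun t : ℂ => (t, (0 : Fin (2 * n) → ℂ)))
    (by rintro _ ⟨t, rfl⟩; exact hDa _ (hWa _ hσ₀ hσ₁)) (by rintro _ ⟨t, rfl⟩; simp [L]) (by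
      rintro _ ⟨t, rfl⟩
      filter_upwards [(hsnd t).eventually hcorank, (hsnd t).eventually hσ₀.eventually_analyticAt,
        (hsnd t).eventually hσ₁.eventually_analyticAt] with v h1 h2 h3 h0
      have h4 := h1 h0 v.1
      refine ⟨?_, fderiv_det_eq_zero (analyticAt_gramMatrix (hWa v h2 h3)) h4 _⟩
      by_contra hne
      rw [ker_vecMulLinear_gramMatrix] at h4
      have := (ker_eq_bot_iff_gramDet_ne_zero (B := (W (v.1, v.2)).toLinearMap₁₂)).2 hne
      rw [this] at h4
      simp at h4)
  -- Cancelling `ℓ ^ 2` on the slices `t = 0` and `t = 1` identifies the values of `g` there with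
  -- the given units.
  have hslice : ∀ (t : ℂ) (u : (Fin (2 * n) → ℂ) → ℂ), AnalyticAt ℂ u 0 →
      (∀ᶠ z in 𝓝 0, (gramMatrix (W (t, z))).det = ℓ z ^ 2 * u z) → g (t, 0) = u 0 := by
    intro t u hu h
    have hin : Tendsto (fun z : Fin (2 * n) → ℂ => (t, z)) (𝓝 0) (𝓝 (t, 0)) :=
      (continuous_const.prodMk continuous_id).tendsto' _ _ rfl
    have := eventually_eq_of_sq_smul_eq_sq_smul he (x₀ := 0) (g₁ := fun z => g (t, z)) (g₂ := u) ?_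
      (hu.eventually_analyticAt.mono fun z hz => hz.continuousAt) ?_
    · exact this.self_of_nhds
    · filter_upwards [hin.eventually (hg _ ⟨t, rfl⟩).eventually_analyticAt] with z hz
      exact ContinuousAt.comp (f := fun z => (t, z)) hz.continuousAt (by fun_prop)
    · filter_upwards [h, hin.eventually (hDg _ ⟨t, rfl⟩)] with z h1 h2
      rw [smul_eq_mul, smul_eq_mul, ← h1, h2]
      rfl
  refine ⟨g, fun t => hg _ ⟨t, rfl⟩, hslice 0 u₀ hu₀ ?_, hslice 1 u₁ hu₁ ?_,
    fun t => hDg _ ⟨t, rfl⟩⟩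
  · simpa [hW] using hdet₀
  · simpa [hW] using hdet₁

/-- The vector field of the homotopy method near a parameter where the pencil has a structurally
smooth Martinet hypersurface. -/
theorem exists_moser_field (hσ₀ : AnalyticAt ℂ σ₀ 0) (hσ₁ : AnalyticAt ℂ σ₁ 0)
    (halt₀ : ∀ z a, σ₀ z a a = 0) (halt₁ : ∀ z a, σ₁ z a a = 0) (he : ℓ e = 1)
    {K : Submodule ℂ (Fin (2 * n) → ℂ)} (hK : 2 ≤ Module.finrank ℂ K)
    (hK₀ : ∀ v ∈ K, σ₀ 0 v = 0) (hK₁ : ∀ v ∈ K, σ₁ 0 v = 0)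
    {β : (Fin (2 * n) → ℂ) → (Fin (2 * n) → ℂ) →L[ℂ] ℂ} (hβ : AnalyticAt ℂ β 0)
    (hβ0 : β 0 = σ₁ 0 e - σ₀ 0 e) {g : ℂ × (Fin (2 * n) → ℂ) → ℂ} {t : ℂ}
    (hg : AnalyticAt ℂ g (t, 0)) (hgt : g (t, 0) ≠ 0)
    (hdet : ∀ᶠ v in 𝓝 (t, (0 : Fin (2 * n) → ℂ)),
      (gramMatrix (σ₀ v.2 + v.1 • (σ₁ v.2 - σ₀ v.2))).det = ℓ v.2 ^ 2 * g v)
    (hcorank : ∀ᶠ z in 𝓝 0, ℓ z = 0 → ∀ t : ℂ, 2 ≤ Module.finrank ℂ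
      (LinearMap.ker (Matrix.vecMulLinear (gramMatrix (σ₀ z + t • (σ₁ z - σ₀ z)))))) :
    ∃ X : ℂ × (Fin (2 * n) → ℂ) → Fin (2 * n) → ℂ, AnalyticAt ℂ X (t, 0) ∧
      (∀ᶠ v in 𝓝 (t, (0 : Fin (2 * n) → ℂ)), ∀ b,
        (σ₀ v.2 + v.1 • (σ₁ v.2 - σ₀ v.2)) (X v) b = - (ℓ v.2 • β v.2) b) ∧
      ∀ᶠ s in 𝓝 t, X (s, 0) = 0 := by
  set W := fun v : ℂ × (Fin (2 * n) → ℂ) => σ₀ v.2 + v.1 • (σ₁ v.2 - σ₀ v.2) with hW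
  set b := fun (v : ℂ × (Fin (2 * n) → ℂ)) i => β v.2 (Pi.single i 1) with hb
  have hsnd : Tendsto (fun v : ℂ × (Fin (2 * n) → ℂ) => v.2) (𝓝 (t, 0)) (𝓝 0) :=
    continuous_snd.tendsto' _ _ rfl
  have hWa : ∀ s : ℂ, AnalyticAt ℂ W (s, 0) := by
    intro s
    have e0 : AnalyticAt ℂ (fun v : ℂ × (Fin (2 * n) → ℂ) => σ₀ v.2) (s, 0) :=
      AnalyticAt.comp (g := σ₀) (f := fun v : ℂ × (Fin (2 * n) → ℂ) => v.2) hσ₀ analyticAt_snd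
    have e1 : AnalyticAt ℂ (fun v : ℂ × (Fin (2 * n) → ℂ) => σ₁ v.2) (s, 0) :=
      AnalyticAt.comp (g := σ₁) (f := fun v : ℂ × (Fin (2 * n) → ℂ) => v.2) hσ₁ analyticAt_snd
    exact e0.add (analyticAt_fst.smul (e1.sub e0))
  have hβa : ∀ s : ℂ, AnalyticAt ℂ (fun v : ℂ × (Fin (2 * n) → ℂ) => β v.2) (s, 0) := fun s =>
    AnalyticAt.comp (g := β) (f := fun v : ℂ × (Fin (2 * n) → ℂ) => v.2) hβ analyticAt_snd
  have hba : ∀ (s : ℂ) i, AnalyticAt ℂ (fun v => b v i) (s, 0) := fun s i =>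
    AnalyticAt.comp (g := ContinuousLinearMap.apply ℂ ℂ (Pi.single i 1 : Fin (2 * n) → ℂ))
      (ContinuousLinearMap.analyticAt _ _) (hβa s)
  -- Cramer's vector satisfies `W(·, C) = det · β`. On the hyperplane the corank is at least two, so
  -- every component of `C` vanishes and `C = ℓ C'`.
  set C := fun v => (gramMatrix (W v)).cramer (b v) with hC
  have hCa : ∀ s : ℂ, AnalyticAt ℂ C (s, 0) := fun s =>
    analyticAt_cramer (analyticAt_gramMatrix (hWa s)) (hba s)
  let L : (ℂ × (Fin (2 * n) → ℂ)) →L[ℂ] ℂ := ℓ.comp (.snd ℂ ℂ _)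
  have hLe : L (0, e) = 1 := by simpa [L] using he
  obtain ⟨C', hC'a, hC'0, hCC'⟩ := exists_eq_smul_of_ker (ℓ := L) hLe (f := C) (P := {(t, 0)})
    (by rintro _ rfl; exact hCa t) (by rintro _ rfl; simp [L]) (by
      rintro _ rfl
      filter_upwards [hsnd.eventually hcorank] with v hv h0
      exact cramer_eq_zero_of_two_le (hv h0 v.1) _)
  replace hC'a := hC'a _ rfl
  replace hCC' := hCC' _ rfl
  have hflip : ∀ {v : ℂ × (Fin (2 * n) → ℂ)}, ContinuousAt W v → ContinuousAt C' v →
      ContinuousAt (fun v => (W v).flip (C' v)) v := by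
    intro v h1 h2
    exact ((ContinuousLinearMap.flipₗᵢ ℂ (Fin (2 * n) → ℂ) (Fin (2 * n) → ℂ)
      ℂ).continuous.continuousAt.comp h1).clm_apply h2
  -- One factor `ℓ` cancels from `ℓ W(·, C') = ℓ² g β`.
  have hsolve : ∀ᶠ v in 𝓝 (t, (0 : Fin (2 * n) → ℂ)),
      (W v).flip (C' v) = (L v * g v) • β v.2 := by
    refine eventually_eq_of_smul_eq_smul hLe ?_ ?_ ?_
    · filter_upwards [(hWa t).eventually_analyticAt, hC'a.eventually_analyticAt] with v h1 h2
      exact hflip h1.continuousAt h2.continuousAt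
    · filter_upwards [hg.eventually_analyticAt, (hβa t).eventually_analyticAt] with v h1 h2
      exact (L.continuous.continuousAt.mul h1.continuousAt).smul h2.continuousAt
    · filter_upwards [hdet, hCC'] with v h1 h2
      apply ContinuousLinearMap.coe_injective
      refine (Pi.basisFun ℂ (Fin (2 * n))).ext fun i => ?_
      have h3 := congrFun (Matrix.mulVec_cramer (gramMatrix (W v)) (b v)) i
      rw [show (gramMatrix (W v)).cramer (b v) = L v • C' v from h2, Matrix.mulVec_smul,
        Pi.smul_apply, gramMatrix_mulVec, h1] at h3
      simp only [Pi.basisFun_apply, ContinuousLinearMap.coe_coe, smul_apply,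
        ContinuousLinearMap.flip_apply]
      rw [h3]
      simp only [Pi.smul_apply, smul_eq_mul, hb, L, ContinuousLinearMap.comp_apply,
        ContinuousLinearMap.coe_snd']
      ring
  have hskew : ∀ v a b, W v a b = - W v b a := fun v =>
    apply_eq_neg_of_alternating fun a => by simp [hW, halt₀, halt₁]
  -- `C' (s, 0)` is the derivative of `C` in the direction `e`. Its components are derivatives of
  -- determinants whose matrices at `(s, 0)` are killed from the left by `K`: this plane lies in
  -- both kernels, and `β 0 = (σ₁ - σ₀)(e, ·)` vanishes on it. With corank two, the first derivative
  -- of a determinant is zero.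
  have hC'zero : ∀ s : ℂ, C' (s, 0) = 0 := by
    intro s
    rw [hC'0 _ (by simp [L])]
    have h1 := hasFDerivAt_pi'.1 (hCa s).differentiableAt.hasFDerivAt
    ext i
    have h2 := congrArg (fun T => T ((0 : ℂ), e)) (h1 i).fderiv
    rw [Pi.zero_apply]
    refine h2.symm.trans ?_
    simp only [hC, Matrix.cramer_apply]
    refine fderiv_det_eq_zero (fun k j => analyticAt_updateCol
      (analyticAt_gramMatrix (hWa s)) (hba s) i k j) (hK.trans ?_) _
    refine finrank_ker_updateCol (fun v hv => ?_) i fun v hv => ?_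
    · have : v ∈ LinearMap.ker (Matrix.vecMulLinear (gramMatrix (W (s, 0)))) := by
        rw [ker_vecMulLinear_gramMatrix, LinearMap.mem_ker]
        ext w
        simp [hW, hK₀ v hv, hK₁ v hv]
      simpa using this
    · have h3 : v ⬝ᵥ b (s, 0) = β 0 v := by
        conv_rhs => rw [pi_eq_sum_univ' v]
        simp [hb, dotProduct]
      rw [h3, hβ0, sub_apply, apply_eq_neg_of_alternating (halt₀ 0),
        apply_eq_neg_of_alternating (halt₁ 0), hK₀ v hv, hK₁ v hv]
      simp
  refine ⟨fun v => (g v)⁻¹ • C' v, (hg.inv hgt).smul hC'a, ?_, ?_⟩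
  · filter_upwards [hsolve, hg.continuousAt.eventually_ne hgt] with v h1 h2 a
    have h3 := congrArg (fun T => T a) h1
    simp only [ContinuousLinearMap.flip_apply, smul_apply, smul_eq_mul] at h3
    change W v ((g v)⁻¹ • C' v) a = _
    -- Cramer's rule solves for the second argument; skewness moves the field to the first and
    -- produces the minus sign.
    rw [map_smul, smul_apply, hskew, h3]
    simp only [smul_eq_mul, smul_apply, L, ContinuousLinearMap.comp_apply,
        ContinuousLinearMap.coe_snd']
    field_simp
  · exact Eventually.of_forall fun s => by simp [hC'zero]

end MoserField

end SingSymp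

namespace SingSymp

/-! ### Diffeomorphism germs and equivalence of germs of forms -/

section DiffeoGerm

variable {n : ℕ}

theorem isDiffeoGerm_of_isInvertible {ψ : CSpace n → CSpace n} (hψ : AnalyticAt ℂ ψ 0)
    (h0 : ψ 0 = 0) (hinv : (fderiv ℂ ψ 0).IsInvertible) : IsDiffeoGerm ψ := by
  obtain ⟨A, hA⟩ := hinv
  have hd : HasFDerivAt ψ (A : CSpace n →L[ℂ] CSpace n) 0 := by
    rw [hA]; exact hψ.differentiableAt.hasFDerivAt
  have hc : ContDiffAt ℂ (⊤ : WithTop ℕ∞) ψ 0 := hψ.contDiffAt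
  have hs := hc.hasStrictFDerivAt' hd (by simp)
  have h1 := (hc.to_localInverse hd (by simp)).analyticAt
  have h2 := hs.eventually_right_inverse
  rw [h0] at h1 h2
  refine ⟨hψ, h0, _, h1, ?_, hs.eventually_left_inverse, h2⟩
  have := hc.localInverse_apply_image hd (by simp)
  rwa [h0] at this

theorem IsDiffeoGerm.tendsto {ψ : CSpace n → CSpace n} (h : IsDiffeoGerm ψ) :
    Tendsto ψ (𝓝 0) (𝓝 0) := by
  have := h.1.continuousAt.tendsto
  rwa [h.2.1] at this

theorem IsDiffeoGerm.comp {ψ φ : CSpace n → CSpace n} (hψ : IsDiffeoGerm ψ)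
    (hφ : IsDiffeoGerm φ) : IsDiffeoGerm (ψ ∘ φ) := by
  obtain ⟨ψ', h1, h2, h3, h4⟩ := hψ.2.2
  obtain ⟨φ', k1, k2, k3, k4⟩ := hφ.2.2
  have hψ't : Tendsto ψ' (𝓝 0) (𝓝 0) := by simpa [h2] using h1.continuousAt.tendsto
  refine ⟨AnalyticAt.comp (by rw [hφ.2.1]; exact hψ.1) hφ.1, by simp [hφ.2.1, hψ.2.1], φ' ∘ ψ',
    AnalyticAt.comp (by rw [h2]; exact k1) h1, by simp [h2, k2], ?_, ?_⟩
  · filter_upwards [k3, hφ.tendsto.eventually h3] with x e1 e2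
    simp [e1, e2]
  · filter_upwards [h4, hψ't.eventually k4] with x e1 e2
    simp [e1, e2]

/-- Equivalence of germs at `0` of `2`-forms under analytic diffeomorphism germs. -/
def FormGermEquiv (σ τ : CSpace n → CSpace n →L[ℂ] CSpace n →L[ℂ] ℂ) : Prop :=
  ∃ ψ : CSpace n → CSpace n, IsDiffeoGerm ψ ∧
    ∀ᶠ z in 𝓝 0, ∀ a b, τ (ψ z) (fderiv ℂ ψ z a) (fderiv ℂ ψ z b) = σ z a b

theorem FormGermEquiv.symm {σ τ : CSpace n → CSpace n →L[ℂ] CSpace n →L[ℂ] ℂ}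
    (h : FormGermEquiv σ τ) : FormGermEquiv τ σ := by
  obtain ⟨ψ, hψ, hz⟩ := h
  obtain ⟨φ, h1, h2, h3, h4⟩ := hψ.2.2
  have hφ : IsDiffeoGerm φ := ⟨h1, h2, ψ, hψ.1, hψ.2.1, h4, h3⟩
  refine ⟨φ, hφ, ?_⟩
  filter_upwards [hφ.tendsto.eventually hz, h4.eventually_nhds, h1.eventually_analyticAt,
    hφ.tendsto.eventually hψ.1.eventually_analyticAt] with z e1 e2 e3 e4 a b
  have e5 : (fderiv ℂ ψ (φ z)).comp (fderiv ℂ φ z) = ContinuousLinearMap.id ℂ _ :=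
    (e4.differentiableAt.hasFDerivAt.comp z e3.differentiableAt.hasFDerivAt).unique
      ((hasFDerivAt_id z).congr_of_eventuallyEq e2)
  have e6 : ∀ a, fderiv ℂ ψ (φ z) (fderiv ℂ φ z a) = a := fun a => congrArg (fun T => T a) e5
  rw [← e1, e6, e6, e2.self_of_nhds]

theorem FormGermEquiv.trans {σ τ υ : CSpace n → CSpace n →L[ℂ] CSpace n →L[ℂ] ℂ}
    (h : FormGermEquiv σ τ) (h' : FormGermEquiv τ υ) : FormGermEquiv σ υ := by
  obtain ⟨ψ, hψ, hz⟩ := h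
  obtain ⟨φ, hφ, hz'⟩ := h'
  refine ⟨φ ∘ ψ, hφ.comp hψ, ?_⟩
  filter_upwards [hz, hψ.tendsto.eventually hz', hψ.1.eventually_analyticAt,
    hψ.tendsto.eventually hφ.1.eventually_analyticAt] with z e1 e2 e3 e4 a b
  rw [fderiv_comp z e4.differentiableAt e3.differentiableAt, ← e1, ← e2]
  rfl

end DiffeoGerm

/-- The zeros of an entire function that is not identically zero are discrete, hence countable, and
the complement of a countable set in a space of real dimension two is connected. -/
theorem isPreconnected_setOf_ne_zero {h : ℂ → ℂ} (hh : ∀ t, AnalyticAt ℂ h t) {t₀ : ℂ}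
    (h0 : h t₀ ≠ 0) : IsPreconnected {t | h t ≠ 0} := by
  have hcod := AnalyticOnNhd.eqOn_zero_or_eventually_ne_zero_of_preconnected
    (f := h) (U := Set.univ) (fun t _ => hh t) isPreconnected_univ
  rcases hcod with h1 | h1
  · exact absurd (h1 (Set.mem_univ t₀)) h0
  · have hc : ({t | h t = 0} ∩ Set.univ).Countable :=
      (HereditarilyLindelofSpace.isLindelof _).countable_of_isDiscrete
        (isDiscrete_of_codiscreteWithin h1)
    rw [Set.inter_univ] at hc
    exact (hc.isConnected_compl_of_one_lt_rank (by simp)).isPreconnected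

/-! ### The homotopy between two straightened forms -/

variable {n : ℕ} {σ₀ σ₁ : CSpace n → CSpace n →L[ℂ] CSpace n →L[ℂ] ℂ}
  {ℓ : CSpace n →L[ℂ] ℂ} {e : CSpace n} {u₀ u₁ : CSpace n → ℂ}

/-- Two closed forms with straightened common Martinet hypersurface `ℓ = 0`, the same restriction
to it and a common kernel plane at the origin are equivalent. -/
theorem formGermEquiv_of_agree (hσ₀ : AnalyticAt ℂ σ₀ 0) (hσ₁ : AnalyticAt ℂ σ₁ 0)
    (halt₀ : ∀ z a, σ₀ z a a = 0) (halt₁ : ∀ z a, σ₁ z a a = 0)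
    (hc₀ : ∀ᶠ z in 𝓝 0, ∀ a b c,
      fderiv ℂ σ₀ z a b c + fderiv ℂ σ₀ z b c a + fderiv ℂ σ₀ z c a b = 0)
    (hc₁ : ∀ᶠ z in 𝓝 0, ∀ a b c,
      fderiv ℂ σ₁ z a b c + fderiv ℂ σ₁ z b c a + fderiv ℂ σ₁ z c a b = 0)
    (hagree : ∀ᶠ z in 𝓝 0, ℓ z = 0 → ∀ a b, ℓ a = 0 → ℓ b = 0 → σ₀ z a b = σ₁ z a b)
    (he : ℓ e = 1) (hu₀ : AnalyticAt ℂ u₀ 0) (hu₁ : AnalyticAt ℂ u₁ 0)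
    (hu₀0 : u₀ 0 ≠ 0) (hu₁0 : u₁ 0 ≠ 0)
    (hdet₀ : ∀ᶠ z in 𝓝 0, (gramMatrix (σ₀ z)).det = ℓ z ^ 2 * u₀ z)
    (hdet₁ : ∀ᶠ z in 𝓝 0, (gramMatrix (σ₁ z)).det = ℓ z ^ 2 * u₁ z)
    {K : Submodule ℂ (CSpace n)} (hK : 2 ≤ Module.finrank ℂ K)
    (hK₀ : ∀ v ∈ K, σ₀ 0 v = 0) (hK₁ : ∀ v ∈ K, σ₁ 0 v = 0) : FormGermEquiv σ₀ σ₁ := by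
  obtain ⟨g, hg, hg0, hg1, hdet⟩ := exists_gramMatrix_det_eq_sq_mul hσ₀ hσ₁ halt₀ halt₁ hagree he
    hu₀ hu₁ hdet₀ hdet₁
  have hcorank : ∀ᶠ z in 𝓝 (0 : CSpace n), ℓ z = 0 → ∀ t : ℂ, 2 ≤ Module.finrank ℂ
      (LinearMap.ker (Matrix.vecMulLinear (gramMatrix (σ₀ z + t • (σ₁ z - σ₀ z))))) := by
    filter_upwards [hagree, hdet₀, hdet₁] with z h1 h2 h3 h0 t
    exact two_le_finrank_ker_gramMatrix_pencil (halt₀ z) (halt₁ z) he (h1 h0) (by simp [h2, h0])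
      (by simp [h3, h0]) t
  set δ : CSpace n → CSpace n →L[ℂ] CSpace n →L[ℂ] ℂ := fun z => σ₁ z - σ₀ z with hδdef
  have hδ : AnalyticAt ℂ δ 0 := hσ₁.sub hσ₀
  have haltδ : ∀ z a, δ z a a = 0 := fun z a => by simp [hδdef, halt₀, halt₁]
  have hcδ : ∀ᶠ z in 𝓝 0, ∀ a b c,
      fderiv ℂ δ z a b c + fderiv ℂ δ z b c a + fderiv ℂ δ z c a b = 0 := by
    filter_upwards [hc₀, hc₁, hσ₀.eventually_analyticAt, hσ₁.eventually_analyticAt]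
      with z h1 h2 h3 h4 a b c
    rw [hδdef, fderiv_fun_sub h4.differentiableAt h3.differentiableAt]
    simp only [sub_apply]
    linear_combination h2 a b c - h1 a b c
  set β := dilationAverage ℓ e (fun z => δ z e) with hβdef
  have hβ : AnalyticAt ℂ β 0 := by
    refine AnalyticAt.dilationAverage ?_ (map_zero ℓ)
    exact AnalyticAt.comp (g := ContinuousLinearMap.apply ℂ (CSpace n →L[ℂ] ℂ) e)
      (ContinuousLinearMap.analyticAt _ _) hδ
  have hβ0 : β 0 = σ₁ 0 e - σ₀ 0 e := dilationAverage_of_ker (map_zero ℓ) _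
  have hα : AnalyticAt ℂ (fun z => ℓ z • β z) 0 := (ℓ.analyticAt _).smul hβ
  have hdα := eventually_relative_poincare he hδ (map_zero ℓ) haltδ hcδ (by
    filter_upwards [hagree] with z hz h0 a b ha hb
    simp [hδdef, hz h0 a b ha hb])
  let R : ℂ → ℂ → Prop := fun s t =>
    FormGermEquiv (fun z => σ₀ z + s • δ z) (fun z => σ₀ z + t • δ z)
  have hR : R 0 1 := by
    have hga : ∀ t : ℂ, AnalyticAt ℂ (fun t : ℂ => g (t, 0)) t := fun t =>
      AnalyticAt.comp (g := g) (f := fun t : ℂ => (t, (0 : CSpace n))) (hg t)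
        (analyticAt_id.prod analyticAt_const)
    have hpre := isPreconnected_setOf_ne_zero hga (t₀ := 0) (by rw [hg0]; exact hu₀0)
    -- The equivalence holds between nearby parameters with `g (t, 0) ≠ 0`, and connectedness of the
    -- set of these parameters propagates it from `0` to `1`. Complex parameters are essential,
    -- since the real segment may meet zeros.
    refine hpre.induction₂ R ?_ (fun _ _ _ _ _ _ h h' => h.trans h') (fun _ _ _ _ h => h.symm)
      (x := 0) (y := 1) (by simpa [hg0] using hu₀0) (by simpa [hg1] using hu₁0)
    intro t ht
    refine Filter.Eventually.filter_mono nhdsWithin_le_nhds ?_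
    obtain ⟨X, hX, hXα, hX0⟩ := exists_moser_field hσ₀ hσ₁ halt₀ halt₁ he hK hK₀ hK₁ hβ hβ0 (hg t)
      ht (hdet t) hcorank
    have hstep := moser_step hσ₀ hδ hα halt₀ haltδ hc₀ hcδ hdα hX hXα hX0
    have hsub : Tendsto (fun s : ℂ => s - t) (𝓝 t) (𝓝 0) :=
      (continuous_id.sub continuous_const).tendsto' _ _ (by simp)
    filter_upwards [hsub.eventually hstep] with s hs
    obtain ⟨ψ, h1, h2, h3, h4⟩ := hs
    rw [add_sub_cancel] at h4
    exact ⟨ψ, isDiffeoGerm_of_isInvertible h1 h2 h3, h4⟩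
  simpa [R, hδdef] using hR

end SingSymp

namespace SingSymp

/-! ### From alternating forms to bilinear forms -/

section Curry

/-- A continuous alternating `2`-form as a continuous bilinear form. -/
noncomputable def curryForm (E : Type*) [NormedAddCommGroup E] [NormedSpace ℂ E] :
    (E [⋀^Fin 2]→L[ℂ] ℂ) →L[ℂ] E →L[ℂ] E →L[ℂ] ℂ :=
  (ContinuousLinearMap.compL ℂ E (E [⋀^Fin 1]→L[ℂ] ℂ) (E →L[ℂ] ℂ)
    (ContinuousAlternatingMap.ofSubsingletonLIE (𝕜 := ℂ) (E := E) (F := ℂ)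
      (0 : Fin 1)).symm.toContinuousLinearEquiv.toContinuousLinearMap).comp
    (ContinuousAlternatingMap.curryLeftLI (𝕜 := ℂ) (E := E) (F := ℂ)
      (n := 1)).toContinuousLinearMap

theorem curryForm_apply {E : Type*} [NormedAddCommGroup E] [NormedSpace ℂ E]
    (η : E [⋀^Fin 2]→L[ℂ] ℂ) (a b : E) : curryForm E η a b = η ![a, b] := by
  change η (Matrix.vecCons a (fun _ => b)) = _
  congr 1
  ext i
  fin_cases i <;> rfl

variable {n : ℕ}

theorem curryForm_self (η : CSpace n [⋀^Fin 2]→L[ℂ] ℂ) (a : CSpace n) :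
    curryForm _ η a a = 0 := by
  rw [curryForm_apply]
  exact bilinOf_self η.toAlternatingMap a

theorem gramDet_bilinOf (η : CSpace n [⋀^Fin 2]→L[ℂ] ℂ) :
    gramDet (bilinOf η.toAlternatingMap) = (gramMatrix (curryForm _ η)).det := by
  have : bilinOf η.toAlternatingMap = (curryForm _ η).toLinearMap₁₂ :=
    LinearMap.ext₂ fun a b => (curryForm_apply η a b).symm
  rw [this]
  rfl

theorem curryForm_compContinuousLinearMap (η : CSpace n [⋀^Fin 2]→L[ℂ] ℂ)
    (A : CSpace n →L[ℂ] CSpace n) (a b : CSpace n) :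
    curryForm _ (η.compContinuousLinearMap A) a b = curryForm _ η (A a) (A b) := by
  rw [curryForm_apply, curryForm_apply, ContinuousAlternatingMap.compContinuousLinearMap_apply]
  congr 1
  ext i : 1
  fin_cases i <;> rfl

theorem gramMatrix_det_compContinuousLinearMap (η : CSpace n [⋀^Fin 2]→L[ℂ] ℂ)
    (A : CSpace n →L[ℂ] CSpace n) :
    (gramMatrix (curryForm _ (η.compContinuousLinearMap A))).det =
      LinearMap.det A.toLinearMap ^ 2 * (gramMatrix (curryForm _ η)).det := by
  rw [← gramDet_bilinOf η, ← gramDet_comp, gramDet, gramMatrix]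
  congr 2
  exact LinearMap.ext₂ fun a b =>
    (curryForm_compContinuousLinearMap η A a b).trans (curryForm_apply _ _ _)

theorem closed_curryForm {ω : TwoForm n} {x : CSpace n} (hω : DifferentiableAt ℂ ω x)
    (hc : extDeriv ω x = 0) (a b c : CSpace n) :
    fderiv ℂ (fun x => curryForm _ (ω x)) x a b c + fderiv ℂ (fun x => curryForm _ (ω x)) x b c a +
      fderiv ℂ (fun x => curryForm _ (ω x)) x c a b = 0 := by
  have h1 : ∀ a b c, fderiv ℂ (fun x => curryForm _ (ω x)) x a b c = fderiv ℂ ω x a ![b, c] := by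
    intro a b c
    have := ((curryForm (CSpace n)).hasFDerivAt.comp x hω.hasFDerivAt).fderiv
    rw [← curryForm_apply]
    exact congrArg (fun T => T a b c) this
  have h2 : extDeriv ω x ![a, b, c] = 0 := by rw [hc]; rfl
  rw [extDeriv, ContinuousAlternatingMap.alternatizeUncurryFin_apply] at h2
  replace h2 := (Fin.sum_univ_three _).symm.trans h2
  have r0 : Fin.removeNth (0 : Fin 3) ![a, b, c] = ![b, c] := by
    ext i : 1; fin_cases i <;> rfl
  have r1 : Fin.removeNth (1 : Fin 3) ![a, b, c] = ![a, c] := by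
    ext i : 1; fin_cases i <;> rfl
  have r2 : Fin.removeNth (2 : Fin 3) ![a, b, c] = ![a, b] := by
    ext i : 1; fin_cases i <;> rfl
  rw [r0, r1, r2] at h2
  have h3 : fderiv ℂ ω x b ![c, a] = - fderiv ℂ ω x b ![a, c] := by
    rw [← curryForm_apply, ← curryForm_apply]
    exact apply_eq_neg_of_alternating (curryForm_self _) _ _
  rw [h1, h1, h1, h3]
  simp at h2
  linear_combination h2

theorem analyticAt_curryForm {F : Type*} [NormedAddCommGroup F] [NormedSpace ℂ F]
    {η : F → CSpace n [⋀^Fin 2]→L[ℂ] ℂ} {x : F} (hη : AnalyticAt ℂ η x) :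
    AnalyticAt ℂ (fun x => curryForm _ (η x)) x :=
  ((curryForm (CSpace n)).analyticAt _).comp hη

theorem analyticAt_curryForm_pullback {ω : TwoForm n} {G : CSpace n → CSpace n} {x : CSpace n}
    (hω : AnalyticAt ℂ ω (G x)) (hG : AnalyticAt ℂ G x) :
    AnalyticAt ℂ (fun x => curryForm _ (pullback G ω x)) x := by
  have h1 : AnalyticAt ℂ (fun x => curryForm _ (ω (G x))) x :=
    analyticAt_curryForm (AnalyticAt.comp (g := ω) hω hG)
  have hcomp : ∀ {B : CSpace n → CSpace n →L[ℂ] CSpace n →L[ℂ] ℂ}, AnalyticAt ℂ B x →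
      AnalyticAt ℂ (fun z => ((B z).comp (fderiv ℂ G z)).flip) x := by
    intro B hB
    have h2 : AnalyticAt ℂ (fun z => (B z).comp (fderiv ℂ G z)) x :=
      AnalyticAt.comp₂ (f := B) (g := fderiv ℂ G)
        ((ContinuousLinearMap.compL ℂ (CSpace n) (CSpace n) (CSpace n →L[ℂ] ℂ)).analyticAt_bilinear
          _) hB hG.fderiv
    exact AnalyticAt.comp (g := (ContinuousLinearMap.flipₗᵢ ℂ (CSpace n) (CSpace n)
      ℂ).toContinuousLinearEquiv.toContinuousLinearMap) (ContinuousLinearMap.analyticAt _ _) h2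
  refine (hcomp (hcomp h1)).congr (Eventually.of_forall fun z => ?_)
  ext a b
  exact (curryForm_compContinuousLinearMap _ _ _ _).symm

theorem closed_curryForm_pullback {ω : TwoForm n} {G : CSpace n → CSpace n} {x : CSpace n}
    (hω : AnalyticAt ℂ ω (G x)) (hG : AnalyticAt ℂ G x) (hc : extDeriv ω (G x) = 0)
    (a b c : CSpace n) :
    fderiv ℂ (fun x => curryForm _ (pullback G ω x)) x a b c +
      fderiv ℂ (fun x => curryForm _ (pullback G ω x)) x b c a +
      fderiv ℂ (fun x => curryForm _ (pullback G ω x)) x c a b = 0 := by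
  refine closed_curryForm ?_ ?_ a b c
  · exact DifferentiableAt.continuousAlternatingMapCompContinuousLinearMap
      (DifferentiableAt.comp x hω.differentiableAt hG.differentiableAt) hG.fderiv.differentiableAt
  · have := extDeriv_pullback (r := ⊤) hω.differentiableAt hG.contDiffAt (by simp)
    rw [hc] at this
    exact this.trans (by ext; simp)

/-- By the permutation expansion, the Martinet function is a polynomial in the entries of the Gram
matrix. -/
theorem analyticAt_martinetFun {ω : TwoForm n} {x : CSpace n} (hω : AnalyticAt ℂ ω x) :
    AnalyticAt ℂ (martinetFun ω) x := by
  have h2 : (2 : ℂ) ^ n ≠ 0 := pow_ne_zero _ two_ne_zero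
  have h : martinetFun ω = fun x => ((2 : ℂ) ^ n)⁻¹ *
      ∑ σ : Equiv.Perm (Fin (2 * n)), (σ.sign : ℂ) * ∏ i : Fin n, gramMatrix (curryForm _ (ω x))
        (σ (pairEquiv n (i, 0))) (σ (pairEquiv n (i, 1))) := by
    ext x
    rw [eq_inv_mul_iff_mul_eq₀ h2, martinetFun, topPower, wedgePow_apply]
    simp only [gramMatrix_apply, curryForm_apply]
    rfl
  rw [h]
  refine analyticAt_const.mul (Finset.analyticAt_fun_sum _ fun σ _ => analyticAt_const.mul ?_)
  exact Finset.analyticAt_fun_prod _ fun i _ =>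
    analyticAt_gramMatrix (analyticAt_curryForm hω) _ _

theorem mem_martinetSet_iff {ω : TwoForm n} {x : CSpace n} :
    x ∈ martinetSet ω ↔ martinetFun ω x = 0 :=
  topForm_eq_zero_iff

end Curry

/-! ### Straightening the Martinet hypersurface -/

section Straightening

variable {n : ℕ}

theorem IsDiffeoGerm.exists_symm {G : CSpace n → CSpace n} (hG : IsDiffeoGerm G) :
    ∃ F, IsDiffeoGerm F ∧ (∀ᶠ x in 𝓝 0, F (G x) = x) ∧ ∀ᶠ x in 𝓝 0, G (F x) = x := by
  obtain ⟨F, h1, h2, h3, h4⟩ := hG.2.2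
  exact ⟨F, ⟨h1, h2, G, hG.1, hG.2.1, h4, h3⟩, h3, h4⟩

theorem IsDiffeoGerm.surjective_fderiv {G : CSpace n → CSpace n} (hG : IsDiffeoGerm G) :
    Function.Surjective (fderiv ℂ G 0) := by
  obtain ⟨F, hF, -, h⟩ := hG.exists_symm
  have e1 : HasFDerivAt G (fderiv ℂ G 0) (F 0) := by
    rw [hF.2.1]; exact hG.1.differentiableAt.hasFDerivAt
  have e2 := (e1.comp (0 : CSpace n) hF.1.differentiableAt.hasFDerivAt).unique
     ((hasFDerivAt_id (0 : CSpace n)).congr_of_eventuallyEq h)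
  exact fun a => ⟨fderiv ℂ F 0 a, congrArg (fun T => T a) e2⟩

theorem IsDiffeoGerm.det_fderiv_ne_zero {G : CSpace n → CSpace n} (hG : IsDiffeoGerm G) :
    LinearMap.det (fderiv ℂ G 0).toLinearMap ≠ 0 := by
  have h := LinearMap.injective_iff_surjective.2 hG.surjective_fderiv
  exact (LinearEquiv.isUnit_det' (LinearEquiv.ofBijective _ ⟨h, hG.surjective_fderiv⟩)).ne_zero

theorem analyticAt_det_fderiv {G : CSpace n → CSpace n} {x : CSpace n} (hG : AnalyticAt ℂ G x) :
    AnalyticAt ℂ (fun z => LinearMap.det (fderiv ℂ G z).toLinearMap) x := by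
  simp only [← LinearMap.det_toMatrix']
  refine analyticAt_det fun i j => ?_
  simp only [LinearMap.toMatrix'_apply]
  have h1 : AnalyticAt ℂ (fun z => fderiv ℂ G z (Pi.single j 1)) x :=
    AnalyticAt.comp (g := ContinuousLinearMap.apply ℂ (CSpace n) (Pi.single j 1 : CSpace n))
      (ContinuousLinearMap.analyticAt _ _) hG.fderiv
  have h2 := analyticAt_pi_iff.1 h1 i
  refine h2.congr (Eventually.of_forall fun z => ?_)
  simp

/-- A submersion germ is linear in suitable coordinates. -/
theorem exists_straightening {f : CSpace n → ℂ} (hf : AnalyticAt ℂ f 0) (h0 : f 0 = 0)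
    {e : CSpace n} (he : fderiv ℂ f 0 e = 1) :
    ∃ G : CSpace n → CSpace n, IsDiffeoGerm G ∧ ∀ᶠ z in 𝓝 0, f (G z) = fderiv ℂ f 0 z := by
  set ℓ := fderiv ℂ f 0 with hℓ
  -- Since `ℓ e = 1`, this map satisfies `ℓ ∘ F = f`, and its derivative at the origin is the
  -- identity; its inverse germ is the required coordinate change.
  let F : CSpace n → CSpace n := fun x => x + (f x - ℓ x) • e
  have hFa : AnalyticAt ℂ F 0 :=
    analyticAt_id.add ((hf.sub (ℓ.analyticAt _)).smul analyticAt_const)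
  have hFd : HasFDerivAt F (ContinuousLinearMap.id ℂ (CSpace n)) 0 := by
    have := (hasFDerivAt_id (𝕜 := ℂ) (0 : CSpace n)).add
      ((hf.differentiableAt.hasFDerivAt.sub ℓ.hasFDerivAt).smul_const e)
    convert! this using 1
    ext a
    simp [hℓ]
  have hF : IsDiffeoGerm F := isDiffeoGerm_of_isInvertible hFa (by simp [F, h0])
    (by rw [hFd.fderiv]; exact ⟨ContinuousLinearEquiv.refl ℂ _, rfl⟩)
  obtain ⟨G, hG, -, hFG⟩ := hF.exists_symm
  refine ⟨G, hG, ?_⟩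
  filter_upwards [hFG] with z hz
  have h1 : ℓ (F (G z)) = f (G z) := by simp [F, he]
  rw [← h1, hz]

end Straightening

end SingSymp

/-! ### Consequences of structural smoothness and the final assembly -/

namespace SingSymp

variable {n : ℕ}

/-- The Gram determinant of a straightened form. -/
theorem exists_gramMatrix_det_pullback (n : ℕ) : ∃ c : ℂ, c ≠ 0 ∧
    ∀ (ω : TwoForm n) (G : CSpace n → CSpace n) (z : CSpace n),
      (gramMatrix (curryForm _ (pullback G ω z))).det =
        c * LinearMap.det (fderiv ℂ G z).toLinearMap ^ 2 * martinetFun ω (G z) ^ 2 := by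
  obtain ⟨c, hc, h⟩ := exists_wedgePow_sq_eq n
  refine ⟨c⁻¹, inv_ne_zero hc, fun ω G z => ?_⟩
  rw [martinetFun, topPower, h, gramDet_bilinOf, pullback, gramMatrix_det_compContinuousLinearMap]
  field_simp

/-- At a structurally smooth point the form has corank at most two. -/
theorem finrank_ker_le_two {σ : CSpace n → CSpace n →L[ℂ] CSpace n →L[ℂ] ℂ}
    (hσ : AnalyticAt ℂ σ 0) {ℓ : CSpace n →L[ℂ] ℂ} {e : CSpace n} (he : ℓ e = 1)
    {u : CSpace n → ℂ} (hu : AnalyticAt ℂ u 0) (hu0 : u 0 ≠ 0)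
    (hdet : ∀ᶠ z in 𝓝 0, (gramMatrix (σ z)).det = ℓ z ^ 2 * u z) :
    Module.finrank ℂ (LinearMap.ker (σ 0).toLinearMap₁₂) ≤ 2 := by
  -- Along the transversal line `τ e` the Gram determinant is `τ ^ 2` times a function nonzero at
  -- `0`, which excludes corank three.
  have hline : AnalyticAt ℂ (fun τ : ℂ => τ • e) 0 := analyticAt_id.smul analyticAt_const
  have ht : Tendsto (fun τ : ℂ => τ • e) (𝓝 0) (𝓝 0) := by
    simpa using hline.continuousAt.tendsto
  have h := finrank_ker_lt_three (M := fun τ : ℂ => gramMatrix (σ (τ • e)))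
    (u := fun τ => u (τ • e)) (fun i j => ?_) ?_ (by simpa using hu0) ?_
  · rw [ker_vecMulLinear_gramMatrix, zero_smul] at h
    exact h
  · refine (analyticAt_gramMatrix ?_ i j).differentiableAt
    exact AnalyticAt.comp (g := σ) (by rwa [zero_smul]) hline
  · exact ContinuousAt.comp (g := u) (by rw [zero_smul]; exact hu.continuousAt) hline.continuousAt
  · filter_upwards [ht.eventually hdet] with τ hτ
    rw [hτ, map_smul, he, smul_eq_mul, mul_one]

theorem formGermEquiv_pullback {ω : TwoForm n} {G : CSpace n → CSpace n} (hG : IsDiffeoGerm G) :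
    FormGermEquiv (fun z => curryForm _ (pullback G ω z)) (fun z => curryForm _ (ω z)) :=
  ⟨G, hG, Eventually.of_forall fun _ _ _ => (curryForm_compContinuousLinearMap _ _ _ _).symm⟩

/-- The Martinet function of `ω₁` in coordinates straightening the common Martinet
hypersurface. -/
theorem exists_eq_mul_of_common {f : CSpace n → ℂ} (hf : AnalyticAt ℂ f 0)
    (hf0 : fderiv ℂ f 0 ≠ 0) {G : CSpace n → CSpace n} (hG : IsDiffeoGerm G)
    {ℓ : CSpace n →L[ℂ] ℂ} {e : CSpace n} (he : ℓ e = 1)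
    (hz : ∀ᶠ z in 𝓝 0, ℓ z = 0 → f (G z) = 0) :
    ∃ r : CSpace n → ℂ, AnalyticAt ℂ r 0 ∧ r 0 ≠ 0 ∧ ∀ᶠ z in 𝓝 0, f (G z) = ℓ z * r z := by
  have hfG : AnalyticAt ℂ (fun z => f (G z)) 0 :=
    AnalyticAt.comp (g := f) (by rwa [hG.2.1]) hG.1
  obtain ⟨r, hr, -, hfr⟩ := exists_eq_smul_of_ker he (f := fun z => f (G z)) (P := {0})
    (by rintro _ rfl; exact hfG) (by rintro _ rfl; exact map_zero ℓ) (by rintro _ rfl; exact hz)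
  replace hr := hr _ rfl
  replace hfr := hfr _ rfl
  -- Differentiating `f ∘ G = ℓ r` at the origin gives `r 0 • ℓ`. If `r 0 = 0`, then `df` vanishes
  -- on the range of `dG`, which is the whole space.
  refine ⟨r, hr, fun hr0 => hf0 ?_, hfr⟩
  have e1 : HasFDerivAt (fun z => f (G z)) ((fderiv ℂ f 0).comp (fderiv ℂ G 0)) 0 := by
    have : HasFDerivAt f (fderiv ℂ f 0) (G 0) := by
      rw [hG.2.1]; exact hf.differentiableAt.hasFDerivAt
    exact this.comp (0 : CSpace n) hG.1.differentiableAt.hasFDerivAt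
  have e2 := (ℓ.hasFDerivAt (x := 0)).smul hr.differentiableAt.hasFDerivAt
  have e3 := e1.unique (e2.congr_of_eventuallyEq hfr)
  ext a
  obtain ⟨b, rfl⟩ := hG.surjective_fderiv a
  simpa [hr0] using congrArg (fun T => T b) e3

/-- The kernel of a form lies in that of its power; the powers have equal kernels; and corank at
most two brings the kernel of the second power back into that of `η₁`. The bound on `n` makes the
exponent `n - 1` positive. -/
theorem ker_bilinOf_le_of_formKer_eq {η₀ η₁ : CSpace n [⋀^Fin 2]→L[ℂ] ℂ} (hn : 2 ≤ n)
    (hker : formKer (wedgePow η₀.toAlternatingMap (n - 1)) =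
      formKer (wedgePow η₁.toAlternatingMap (n - 1)))
    (h₁ : Module.finrank ℂ (LinearMap.ker (bilinOf η₁.toAlternatingMap)) ≤ 2) :
    LinearMap.ker (bilinOf η₀.toAlternatingMap) ≤ LinearMap.ker (bilinOf η₁.toAlternatingMap) := by
  obtain ⟨k, rfl⟩ : ∃ k, n = k + 2 := ⟨n - 2, by omega⟩
  intro v hv
  have h := mem_formKer_wedgePow hv (k + 2 - 1)
  rw [hker] at h
  exact bilinOf_eq_zero_of_mem_formKer (by simp) h₁ h

end SingSymp

open SingSymp in
theorem mainTheorem3 (n : ℕ) (ω₀ ω₁ : SingSymp.TwoForm n)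
    (h₀ : SingSymp.IsSingularSymplecticGerm ω₀) (h₁ : SingSymp.IsSingularSymplecticGerm ω₁)
    (hs₀ : SingSymp.StructurallySmooth ω₀) (hs₁ : SingSymp.StructurallySmooth ω₁)
    (hcommon : ∀ᶠ x in 𝓝 (0 : SingSymp.CSpace n),
      x ∈ SingSymp.martinetSet ω₀ ↔ x ∈ SingSymp.martinetSet ω₁)
    (hrank₀ : SingSymp.formRank
      (SingSymp.restrictForm (SingSymp.martinetTangent ω₀ 0) (ω₀ 0)) + 4 ≤ 2 * n)
    (hrank₁ : SingSymp.formRank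
        (SingSymp.restrictForm (SingSymp.martinetTangent ω₁ 0) (ω₁ 0)) =
      SingSymp.formRank (SingSymp.restrictForm (SingSymp.martinetTangent ω₀ 0) (ω₀ 0)))
    (hpull : ∀ᶠ x in 𝓝 (0 : SingSymp.CSpace n), x ∈ SingSymp.martinetSet ω₀ →
      SingSymp.restrictForm (SingSymp.martinetTangent ω₀ x) (ω₀ x) =
        SingSymp.restrictForm (SingSymp.martinetTangent ω₀ x) (ω₁ x))
    (hker : SingSymp.formKer (SingSymp.wedgePow (ω₀ 0).toAlternatingMap (n - 1)) =
      SingSymp.formKer (SingSymp.wedgePow (ω₁ 0).toAlternatingMap (n - 1))) :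
    ∃ Ψ : SingSymp.CSpace n → SingSymp.CSpace n, SingSymp.IsDiffeoGerm Ψ ∧
      ∀ᶠ x in 𝓝 (0 : SingSymp.CSpace n), SingSymp.pullback Ψ ω₁ x = ω₀ x := by
  have hf₀ := analyticAt_martinetFun h₀.analytic
  have hf₁ := analyticAt_martinetFun h₁.analytic
  set f₀ := martinetFun ω₀ with hf₀def
  set f₁ := martinetFun ω₁ with hf₁def
  set ℓ := fderiv ℂ f₀ 0 with hℓ
  obtain ⟨e, he⟩ : ∃ e, ℓ e = 1 := by
    obtain ⟨v, hv⟩ := DFunLike.ne_iff.1 hs₀.2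
    exact ⟨(ℓ v)⁻¹ • v, by rw [map_smul, smul_eq_mul, inv_mul_cancel₀ hv]⟩
  obtain ⟨G, hG, hfG⟩ := exists_straightening hf₀ hs₀.1 he
  have hmart : ∀ᶠ z in 𝓝 0, ℓ z = 0 → G z ∈ martinetSet ω₀ := by
    filter_upwards [hfG] with z h1 h2
    rw [mem_martinetSet_iff, ← hf₀def, h1, h2]
  obtain ⟨r, hr, hr0, hf₁G⟩ := exists_eq_mul_of_common hf₁ hs₁.2 hG he (by
    filter_upwards [hmart, hG.tendsto.eventually hcommon] with z h1 h2 h3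
    exact mem_martinetSet_iff.1 (h2.1 (h1 h3)))
  obtain ⟨c, hc, hcdet⟩ := exists_gramMatrix_det_pullback n
  set σ₀ := fun z => curryForm _ (pullback G ω₀ z) with hσ₀def
  set σ₁ := fun z => curryForm _ (pullback G ω₁ z) with hσ₁def
  have hω₀G : AnalyticAt ℂ ω₀ (G 0) := by rw [hG.2.1]; exact h₀.analytic
  have hω₁G : AnalyticAt ℂ ω₁ (G 0) := by rw [hG.2.1]; exact h₁.analytic
  have hσ₀ : AnalyticAt ℂ σ₀ 0 := analyticAt_curryForm_pullback hω₀G hG.1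
  have hσ₁ : AnalyticAt ℂ σ₁ 0 := analyticAt_curryForm_pullback hω₁G hG.1
  have halt₀ : ∀ z a, σ₀ z a a = 0 := fun z => curryForm_self _
  have halt₁ : ∀ z a, σ₁ z a a = 0 := fun z => curryForm_self _
  have hclosed : ∀ {ω : TwoForm n}, IsSingularSymplecticGerm ω → ∀ᶠ z in 𝓝 0, ∀ a b c,
      fderiv ℂ (fun z => curryForm _ (pullback G ω z)) z a b c +
      fderiv ℂ (fun z => curryForm _ (pullback G ω z)) z b c a +
      fderiv ℂ (fun z => curryForm _ (pullback G ω z)) z c a b = 0 := by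
    intro ω h
    filter_upwards [hG.tendsto.eventually h.analytic.eventually_analyticAt,
      hG.tendsto.eventually h.closed, hG.1.eventually_analyticAt] with z e1 e2 e3
    exact closed_curryForm_pullback e1 e3 e2
  have hdetG := analyticAt_det_fderiv hG.1
  have hdetG0 := hG.det_fderiv_ne_zero
  -- The Gram determinant is the square of the Martinet function times this unit. As that function
  -- is `ℓ`, or `ℓ r` for the second form, the determinant has order exactly two.
  set u₀ := fun z => c * LinearMap.det (fderiv ℂ G z).toLinearMap ^ 2 with hu₀def
  have hu₀ : AnalyticAt ℂ u₀ 0 := analyticAt_const.mul (hdetG.pow 2)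
  have hu₀0 : u₀ 0 ≠ 0 := mul_ne_zero hc (pow_ne_zero _ hdetG0)
  have hdet₀ : ∀ᶠ z in 𝓝 0, (gramMatrix (σ₀ z)).det = ℓ z ^ 2 * u₀ z := by
    filter_upwards [hfG] with z hz
    rw [hcdet, ← hf₀def, hz]
    ring
  have hdet₁ : ∀ᶠ z in 𝓝 0, (gramMatrix (σ₁ z)).det = ℓ z ^ 2 * (u₀ z * r z ^ 2) := by
    filter_upwards [hf₁G] with z hz
    rw [hcdet, ← hf₁def, hz]
    ring
  have hu₁ : AnalyticAt ℂ (fun z => u₀ z * r z ^ 2) 0 := hu₀.mul (hr.pow 2)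
  have hu₁0 : u₀ 0 * r 0 ^ 2 ≠ 0 := mul_ne_zero hu₀0 (pow_ne_zero _ hr0)
  have hagree : ∀ᶠ z in 𝓝 0, ℓ z = 0 → ∀ a b, ℓ a = 0 → ℓ b = 0 → σ₀ z a b = σ₁ z a b := by
    filter_upwards [hmart, hG.tendsto.eventually hpull, hfG.eventually_nhds,
      hG.1.eventually_analyticAt, hG.tendsto.eventually hf₀.eventually_analyticAt]
      with z h1 h2 h3 h4 h5 h6 a b ha hb
    -- From `f₀ ∘ G = ℓ`, the derivative of `G` sends `ker ℓ` into the tangent space of the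
    -- hypersurface. Equality of the pullbacks there becomes agreement of `σ₀` and `σ₁` on `ker ℓ`.
    have e1 : (fderiv ℂ f₀ (G z)).comp (fderiv ℂ G z) = ℓ :=
      (h5.differentiableAt.hasFDerivAt.comp z h4.differentiableAt.hasFDerivAt).unique
        (ℓ.hasFDerivAt.congr_of_eventuallyEq h3)
    have e2 : ∀ a, ℓ a = 0 → fderiv ℂ G z a ∈ martinetTangent ω₀ (G z) := by
      intro a ha
      rw [← e1] at ha
      exact ha
    have e3 := congrArg (fun η => η ![⟨_, e2 a ha⟩, ⟨_, e2 b hb⟩]) (h2 (h1 h6))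
    have e4 : ∀ η : CSpace n [⋀^Fin 2]→L[ℂ] ℂ, restrictForm (martinetTangent ω₀ (G z)) η
        ![⟨_, e2 a ha⟩, ⟨_, e2 b hb⟩] = curryForm _ η (fderiv ℂ G z a) (fderiv ℂ G z b) := by
      intro η
      rw [curryForm_apply]
      change η _ = _
      congr 1
      ext i : 1
      fin_cases i <;> rfl
    rw [e4, e4] at e3
    rw [hσ₀def, hσ₁def]
    simp only [pullback]
    rw [curryForm_compContinuousLinearMap, curryForm_compContinuousLinearMap, e3]
  have hK₁ : Module.finrank ℂ (LinearMap.ker (σ₁ 0).toLinearMap₁₂) ≤ 2 :=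
    finrank_ker_le_two hσ₁ he hu₁ hu₁0 hdet₁
  have hσapp : ∀ (ω : TwoForm n) a b, curryForm _ (pullback G ω 0) a b =
      bilinOf (ω 0).toAlternatingMap (fderiv ℂ G 0 a) (fderiv ℂ G 0 b) := by
    intro ω a b
    rw [pullback, curryForm_compContinuousLinearMap, hG.2.1, curryForm_apply]
    rfl
  have hcorank₁ : Module.finrank ℂ (LinearMap.ker (bilinOf (ω₁ 0).toAlternatingMap)) ≤ 2 := by
    have hle : LinearMap.ker (bilinOf (ω₁ 0).toAlternatingMap) ≤
        (LinearMap.ker (σ₁ 0).toLinearMap₁₂).map (fderiv ℂ G 0).toLinearMap := by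
      intro v hv
      obtain ⟨a, rfl⟩ := hG.surjective_fderiv v
      refine ⟨a, LinearMap.ext fun b => ?_, rfl⟩
      have := hσapp ω₁ a b
      rw [LinearMap.mem_ker.1 hv] at this
      exact this
    exact (Submodule.finrank_mono hle).trans ((Submodule.finrank_map_le _ _).trans hK₁)
  -- The bound `2 ≤ n` comes from `hrank₀`.
  have hkerle := ker_bilinOf_le_of_formKer_eq (by omega) hker hcorank₁
  have hσequiv : FormGermEquiv σ₀ σ₁ := by
    -- The common plane `K` is the kernel of `σ₀` at the origin; `hkerle`, transported by the
    -- derivative of `G`, places it in the kernel of `σ₁`.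
    refine formGermEquiv_of_agree hσ₀ hσ₁ halt₀ halt₁ (hclosed h₀) (hclosed h₁) hagree he hu₀ hu₁
      hu₀0 hu₁0 hdet₀ hdet₁ (K := LinearMap.ker (σ₀ 0).toLinearMap₁₂) ?_ ?_ ?_
    · refine two_le_finrank_ker (halt₀ 0) (n := n) (by simp) ?_
      exact ker_ne_bot_of_gramMatrix_det_eq_zero (by simp [hdet₀.self_of_nhds])
    · intro v hv
      ext b
      exact congrArg (fun T => T b) hv
    · intro v hv
      have h1 : fderiv ℂ G 0 v ∈ LinearMap.ker (bilinOf (ω₀ 0).toAlternatingMap) := by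
        refine LinearMap.ext fun w => ?_
        obtain ⟨b, rfl⟩ := hG.surjective_fderiv w
        exact (hσapp ω₀ v b).symm.trans (congrArg (fun T => T b) hv)
      ext b
      refine (hσapp ω₁ v b).trans ?_
      rw [LinearMap.mem_ker.1 (hkerle h1)]
      rfl
  obtain ⟨Ψ, hΨ, hz⟩ := ((formGermEquiv_pullback (ω := ω₀) hG).symm.trans hσequiv).trans
    (formGermEquiv_pullback (ω := ω₁) hG)
  refine ⟨Ψ, hΨ, ?_⟩
  filter_upwards [hz] with z h
  ext v
  have hv : v = ![v 0, v 1] := by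
    ext i : 1
    fin_cases i <;> rfl
  rw [hv, ← curryForm_apply, ← curryForm_apply, ← h]
  exact curryForm_compContinuousLinearMap _ _ _ _
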